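/- Let $\omega=e^{2\pi i/3}$, so that $i\sqrt3=\omega-\omega^2$. Let $G_{25920}\subset GL(4,\mathbb C)$ be Blichfeldt's group generated by $$C=\mathrm{diag}(1,1,\omega,\omega^2),\quad D=\mathrm{diag}(\omega,\omega,\omega,1),\quad V=\frac1{i\sqrt3}\begin{pmatrix} i\sqrt3&0&0&0\\0&1&1&1\\0&1&\omega&\omega^2\\0&1&\omega^2&\omega\end{pmatrix},\quad F=\begin{pmatrix}0&0&-1&0\\0&1&0&0\\-1&0&0&0\\0&0&0&-1\end{pmatrix},$$ and let $W\subset GL(4,\mathbb C)$ be the Shephard–Todd group No. 32, generated by the four order-three reflections $v\mapsto v-(1-\omega)\frac{\langle v,a\rangle}{\langle a,a\rangle}a$ with roots $a=(0,0,1,0),\ (1,1,-1,0),\ (0,1,0,0),\ (1,-1,0,1)$. A reflection in $GL(n,\mathbb C)$ is an element of finite order with exactly $n-1$ eigenvalues (with multiplicity) equal to $1$. A finite irreducible subgroup of $GL(n,\mathbb C)$ is primitive if there is no decomposition $\mathbb C^n=V_1\oplus\dots\oplus V_k$, $k\ge2$, into subspaces of equal dimension that are permuted by the group. Then: 1. $W$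 is generated by its reflections of order $3$, has order $25920\cdot 6$, and has degrees $12,18,24,30$; that is, $\mathbb C[x_1,\dots,x_4]^W=\mathbb C[f_1,\dots,f_4]$ with $f_1,\dots,f_4$ algebraically independent and homogeneous of degrees $12,18,24,30$. 2. $G_{25920}$ is primitive, has order $25920\cdot 2$ and centre of order $2$, and $G_{25920}=W\cap SL(4,\mathbb C)$. 3. The quotient variety $\mathbb P^3/G_{25920}$ (the orbit space with the quotient topology and the sheaf of invariant functions) exists as a scheme over $\mathbb C$. Over $\mathbb C$ it is isomorphic to the weighted projective space $\mathbb P(12,18,24,30)$ and to $\mathbb P(2,3,4,5)$, and it is rational, i.e. birational over $\mathbb C$ to affine $3$-space. -/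

import Mathlib

open CategoryTheory AlgebraicGeometry MvPolynomial

noncomputable section

namespace QuotG25920

/-! ### Linear groups -/

/-- A (complex) reflection: an element of finite order of `GL(n, ℂ)` exactly `n - 1` of whose `n`
eigenvalues (counted with multiplicity) are equal to `1`. -/
def IsReflection {n : ℕ} (g : GL (Fin n) ℂ) : Prop :=
  IsOfFinOrder g ∧ (g : Matrix (Fin n) (Fin n) ℂ).charpoly.roots.count 1 + 1 = n

/-- The subgroup `SL(n, ℂ)` of `GL(n, ℂ)`. -/
def SLn (n : ℕ) : Subgroup (GL (Fin n) ℂ) :=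
  (Matrix.GeneralLinearGroup.det (n := Fin n) (R := ℂ)).ker

/-- The linear automorphism of `ℂⁿ` given by a matrix. -/
def lin {n : ℕ} (g : GL (Fin n) ℂ) : (Fin n → ℂ) →ₗ[ℂ] (Fin n → ℂ) :=
  Matrix.toLin' (g : Matrix (Fin n) (Fin n) ℂ)

/-- `G` acts irreducibly on `ℂⁿ`. -/
def IsIrreducibleGroup {n : ℕ} (G : Subgroup (GL (Fin n) ℂ)) : Prop :=
  0 < n ∧ ∀ W : Submodule ℂ (Fin n → ℂ),
    (∀ g ∈ G, W.map (lin g) ≤ W) → W = ⊥ ∨ W = ⊤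

/-- `G` permutes the summands of some decomposition of `ℂⁿ` into a direct sum of `k` subspaces
of dimension `m`. -/
def PreservesDecomposition {n : ℕ} (G : Subgroup (GL (Fin n) ℂ)) (m k : ℕ) : Prop :=
  ∃ W : Fin k → Submodule ℂ (Fin n → ℂ),
    DirectSum.IsInternal W ∧ (∀ i, Module.finrank ℂ (W i) = m) ∧
      ∀ g ∈ G, ∀ i, ∃ j, (W i).map (lin g) = W j

/-- A primitive group: finite, irreducible, and not permuting the summands of a nontrivial
decomposition of `ℂⁿ` into a direct sum of subspaces of equal dimension. -/
def IsPrimitiveGroup {n : ℕ} (G : Subgroup (GL (Fin n) ℂ)) : Prop :=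
  Finite G ∧ IsIrreducibleGroup G ∧ ∀ m k : ℕ, 2 ≤ k → ¬ PreservesDecomposition G m k

/-! ### The two groups -/

/-- The primitive cube root of unity `ω = (-1 + i√3) / 2`. -/
def ω : ℂ := (-1 + Complex.I * (Real.sqrt 3 : ℝ)) / 2

/-- The matrix of the order three reflection `v ↦ v - (1 - ω) ⟨v, a⟩ / ⟨a, a⟩ a` whose root is a
nonzero real vector `a`. -/
def reflMatrix (a : Fin 4 → ℂ) : Matrix (Fin 4) (Fin 4) ℂ :=
  1 - ((1 - ω) / (a ⬝ᵥ a)) • Matrix.vecMulVec a a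

/-- Roots of the four generating reflections of the Shephard–Todd group No. 32, in the order of
the nodes of its (linear) diagram `3[3]3[3]3[3]3`. -/
def root32 : Fin 4 → Fin 4 → ℂ :=
  ![![0, 0, 1, 0], ![1, 1, -1, 0], ![0, 1, 0, 0], ![1, -1, 0, 1]]

/-- The Shephard–Todd reflection group No. 32. -/
def ST32 : Subgroup (GL (Fin 4) ℂ) :=
  Subgroup.closure {g | ∃ i, (g : Matrix (Fin 4) (Fin 4) ℂ) = reflMatrix (root32 i)}

/-- The generator `C` of Blichfeldt's primitive group of order `25920 · 2` in `SL(4, ℂ)`. -/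
def blichfeldtC : Matrix (Fin 4) (Fin 4) ℂ := Matrix.diagonal ![1, 1, ω, ω ^ 2]

/-- The generator `D` of Blichfeldt's group. -/
def blichfeldtD : Matrix (Fin 4) (Fin 4) ℂ := Matrix.diagonal ![ω, ω, ω, 1]

/-- The generator `V` of Blichfeldt's group. -/
def blichfeldtV : Matrix (Fin 4) (Fin 4) ℂ :=
  (1 / (Complex.I * (Real.sqrt 3 : ℝ))) •
    !![Complex.I * (Real.sqrt 3 : ℝ), 0, 0, 0;
       0, 1, 1, 1;
       0, 1, ω, ω ^ 2;
       0, 1, ω ^ 2, ω]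

/-- The generator `F` of Blichfeldt's group. -/
def blichfeldtF : Matrix (Fin 4) (Fin 4) ℂ :=
  !![0, 0, -1, 0;
     0, 1, 0, 0;
     -1, 0, 0, 0;
     0, 0, 0, -1]

/-- The primitive group `G₂₅₉₂₀`, given by Blichfeldt's generators. -/
def G25920 : Subgroup (GL (Fin 4) ℂ) :=
  Subgroup.closure {g | (g : Matrix (Fin 4) (Fin 4) ℂ) = blichfeldtC ∨
    (g : Matrix (Fin 4) (Fin 4) ℂ) = blichfeldtD ∨
    (g : Matrix (Fin 4) (Fin 4) ℂ) = blichfeldtV ∨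
    (g : Matrix (Fin 4) (Fin 4) ℂ) = blichfeldtF}

/-! ### Polynomial invariants -/

/-- The linear substitution `f ↦ f ∘ g` on polynomials. -/
def subst {n : ℕ} (g : GL (Fin n) ℂ) : MvPolynomial (Fin n) ℂ →ₐ[ℂ] MvPolynomial (Fin n) ℂ :=
  aeval fun i => ∑ j, C ((g : Matrix (Fin n) (Fin n) ℂ) i j) * X j

/-- The algebra of `G`-invariant polynomials is a polynomial algebra on homogeneous generators of
degrees `d 0, …, d (n - 1)`. -/
def HasDegrees {n : ℕ} (G : Subgroup (GL (Fin n) ℂ)) (d : Fin n → ℕ) : Prop :=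
  ∃ f : Fin n → MvPolynomial (Fin n) ℂ, (∀ i, (f i).IsHomogeneous (d i)) ∧
    AlgebraicIndependent ℂ f ∧
    ∀ p : MvPolynomial (Fin n) ℂ,
      p ∈ Algebra.adjoin ℂ (Set.range f) ↔ ∀ g ∈ G, subst g p = p

theorem subst_isHomogeneous {n : ℕ} (g : GL (Fin n) ℂ) {p : MvPolynomial (Fin n) ℂ} {m : ℕ}
    (hp : p.IsHomogeneous m) : (subst g p).IsHomogeneous m := by
  have h := hp.aeval (fun i => ∑ j, C ((g : Matrix (Fin n) (Fin n) ℂ) i j) * X j)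
    (n := 1) (fun i => IsHomogeneous.sum _ _ _ fun j _ => isHomogeneous_C_mul_X _ _)
  simpa [subst] using h

theorem subst_comp {n : ℕ} (g h : GL (Fin n) ℂ) (p : MvPolynomial (Fin n) ℂ) :
    subst h (subst g p) = subst (g * h) p := by
  have : (subst h).comp (subst g) = subst (g * h) := by
    ext1 i
    simp only [subst, AlgHom.comp_apply, aeval_X, map_sum, map_mul, algHom_C,
      Matrix.GeneralLinearGroup.coe_mul, Matrix.mul_apply, Finset.mul_sum, Finset.sum_mul]
    rw [Finset.sum_comm]
    simp [mul_assoc, algebraMap_eq]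
  exact DFunLike.congr_fun this p

theorem subst_one {n : ℕ} (p : MvPolynomial (Fin n) ℂ) : subst 1 p = p := by
  have : subst (1 : GL (Fin n) ℂ) = AlgHom.id ℂ _ := by
    ext1 i
    simp [subst, Matrix.one_apply]
  rw [this]; rfl

/-! ### Projective spaces and the action -/

/-- `Spec ℂ`. -/
abbrev SpecC : Scheme.{0} := Spec (.of ℂ)

/-- The standard grading of `ℂ[x₁, …, xₙ]`. -/
instance standardGrading (n : ℕ) : GradedAlgebra (homogeneousSubmodule (Fin n) ℂ) :=
  MvPolynomial.gradedAlgebra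

/-- Projective space `ℙⁿ⁻¹ = Proj ℂ[x₁, …, xₙ]` over `ℂ`. -/
def ProjSpace (n : ℕ) : Scheme.{0} := Proj (homogeneousSubmodule (Fin n) ℂ)

/-- The structure morphism of projective space. -/
def ProjSpace.str (n : ℕ) : ProjSpace n ⟶ SpecC :=
  Proj.toSpecZero (homogeneousSubmodule (Fin n) ℂ) ≫
    Spec.map (CommRingCat.ofHom (algebraMap ℂ (homogeneousSubmodule (Fin n) ℂ 0)))

/-- The grading of `ℂ[x₁, …, xₙ]` in which `xᵢ` has degree `a i`. -/
instance weightedGrading {n : ℕ} (a : Fin n → ℕ) :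
    GradedAlgebra (weightedHomogeneousSubmodule ℂ a) :=
  weightedGradedAlgebra ℂ a

/-- The weighted projective space `ℙ(a₁, …, aₙ)` over `ℂ`. -/
def WeightedProj {n : ℕ} (a : Fin n → ℕ) : Scheme.{0} :=
  Proj (weightedHomogeneousSubmodule ℂ a)

/-- The structure morphism of weighted projective space. -/
def WeightedProj.str {n : ℕ} (a : Fin n → ℕ) : WeightedProj a ⟶ SpecC :=
  Proj.toSpecZero (weightedHomogeneousSubmodule ℂ a) ≫
    Spec.map (CommRingCat.ofHom (algebraMap ℂ (weightedHomogeneousSubmodule ℂ a 0)))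

/-- `f ↦ f ∘ g` as a homomorphism of graded rings. -/
def substGraded {n : ℕ} (g : GL (Fin n) ℂ) :
    homogeneousSubmodule (Fin n) ℂ →+*ᵍ homogeneousSubmodule (Fin n) ℂ where
  toRingHom := (subst g : MvPolynomial (Fin n) ℂ →+* MvPolynomial (Fin n) ℂ)
  map_mem hp := subst_isHomogeneous g hp

theorem irrelevant_le_map_substGraded {n : ℕ} (g : GL (Fin n) ℂ) :
    HomogeneousIdeal.irrelevant (homogeneousSubmodule (Fin n) ℂ) ≤
      (HomogeneousIdeal.irrelevant (homogeneousSubmodule (Fin n) ℂ)).map (substGraded g) := by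
  change (HomogeneousIdeal.irrelevant (homogeneousSubmodule (Fin n) ℂ)).toIdeal ≤
    ((HomogeneousIdeal.irrelevant (homogeneousSubmodule (Fin n) ℂ)).map (substGraded g)).toIdeal
  refine (HomogeneousIdeal.toIdeal_irrelevant_le _).2 fun i hi x hx => ?_
  have hx' : x = substGraded g (subst g⁻¹ x) := by
    change x = subst g (subst g⁻¹ x)
    rw [subst_comp, inv_mul_cancel, subst_one]
  rw [hx']
  exact Ideal.mem_map_of_mem _
    (HomogeneousIdeal.mem_irrelevant_of_mem _ hi (subst_isHomogeneous g⁻¹ hx))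

/-- The automorphism of `ℙⁿ⁻¹` induced by `g ∈ GL(n, ℂ)`; on `ℂ`-points it is `[x] ↦ [g x]`. -/
def projAct {n : ℕ} (g : GL (Fin n) ℂ) : ProjSpace n ⟶ ProjSpace n :=
  Proj.map (substGraded g) (irrelevant_le_map_substGraded g)

/-- `π : X ⟶ Y` is the (geometric) quotient of the scheme `X` by the group of automorphisms
`act g`, `g : G`: as a ringed space, `Y` is the orbit space of `X`, with the quotient topology and
the sheaf of invariant functions. -/
structure IsGeometricQuotient {G : Type*} {X Y : Scheme.{0}} (act : G → (X ⟶ X)) (π : X ⟶ Y) :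
    Prop where
  invariant : ∀ g, act g ≫ π = π
  isQuotientMap : Topology.IsQuotientMap π
  orbits : ∀ x y : X, π x = π y ↔ ∃ g, act g x = y
  injective : ∀ U : Y.Opens, Function.Injective (π.app U)
  range : ∀ (U : Y.Opens) (s : Γ(X, π ⁻¹ᵁ U)), s ∈ Set.range (π.app U) ↔
    ∀ (g : G) (h : π ⁻¹ᵁ U ≤ act g ⁻¹ᵁ π ⁻¹ᵁ U), (act g).appLE (π ⁻¹ᵁ U) (π ⁻¹ᵁ U) h s = s

end QuotG25920

end

/-! The group theory is a computation with 240 vectors `rootVec`: one vector on each of 40 lines,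
multiplied by the sixth roots of unity. All eight generators permute them (`genMat_mulVec_rootVec`),
and a matrix is determined by its effect on the four roots along the coordinate axes, so an identity
between words in the generators is a finite check. Such checks write each Blichfeldt generator as a
word in the reflections, and each generating reflection as ω times an element of G = `G25920`. Hence
every element of W = `ST32` is a cube root of unity times an element of G. As det(c g) = c⁴ = c for
such a multiple, G = W ∩ SL₄ and |W| = 3|G|. Successive orbits of roots under the subgroups
generated by the first few reflections give |W| ≥ 3·8·27·240 = 155520.

The upper bound comes from invariants. The sums of the d-th powers of the 240 linear forms are
W-invariant; those with d = 12, 18, 24, 30 are algebraically independent, because their Jacobian is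
nonzero at one point modulo a prime above 37. Over the invariants, ℂ[x] contains |W| linearly
independent powers of a generic linear form, so a comparison of growth gives |W| ≤ 12·18·24·30 =
155520 (`card_le_prod_degree`). Equality leaves no room for another invariant: one outside ℂ[f]
would produce a second family, independent of the monomials in f and of comparable growth
(`mem_range_aeval_of_card_eq`).

Irreducibility follows since a nonzero stable subspace contains a root and W is transitive on roots.
Primitivity follows since an order three reflection s satisfies (s - 1)(s - ω) = 0 and so cannot
move a summand of a direct sum to another one. These arguments use W but apply to G, because scalars
preserve subspaces.

For the geometry, W and G have the same orbits in ℙ³, and they have the same invariant forms in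
degrees divisible by 6, because the scalars relating them have sixth power 1. The inclusion of ℂ[f₁,
…, f₄], graded with weights 2, 3, 4, 5, multiplies degrees by 6 and induces ℙ³ ⟶ ℙ(2, 3, 4, 5).
Integrality over the invariants, transitivity of W on the primes above a given prime, and an
explicit description of sections on D₊(a) show that this is the geometric quotient
(`isGeometricQuotient_quotientMap`). Multiplying all weights by 6 does not change the weighted
projective space. On x₀x₁ ≠ 0 in ℙ(2, 3, 4, 5) one may normalize x₀ = x₁ in exactly one way, so this
chart is an open subset of affine space. -/

noncomputable section

open CategoryTheory AlgebraicGeometry MvPolynomial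
open HomogeneousLocalization TopologicalSpace

universe u

/-! ### Morphisms of `Proj` induced by ring homomorphisms that multiply degrees -/

namespace HomogeneousLocalization

variable {A B : Type u} [CommRing A] [CommRing B] {σ τ : Type*}
  [SetLike σ A] [AddSubgroupClass σ A] [SetLike τ B] [AddSubgroupClass τ B]
  {𝒜 : ℕ → σ} {ℬ : ℕ → τ} [GradedRing 𝒜] [GradedRing ℬ]

/-- The map on homogeneous fractions induced by a ring homomorphism that multiplies degrees
by `k`. -/
def NumDenSameDeg.mapMul (f : A →+* B) {k : ℕ} (hf : ∀ n, ∀ a ∈ 𝒜 n, f a ∈ ℬ (k * n))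
    {P : Submonoid A} {Q : Submonoid B} (hPQ : P ≤ Q.comap f) (c : NumDenSameDeg 𝒜 P) :
    NumDenSameDeg ℬ Q :=
  ⟨k * c.deg, ⟨f c.num, hf _ _ c.num.2⟩, ⟨f c.den, hf _ _ c.den.2⟩, hPQ c.den_mem⟩

/-- The map on homogeneous localizations induced by a ring homomorphism that multiplies degrees
by `k`. -/
def mapMul (f : A →+* B) {k : ℕ} (hf : ∀ n, ∀ a ∈ 𝒜 n, f a ∈ ℬ (k * n))
    {P : Submonoid A} {Q : Submonoid B} (hPQ : P ≤ Q.comap f) :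
    HomogeneousLocalization 𝒜 P →+* HomogeneousLocalization ℬ Q where
  toFun := Quotient.map' (NumDenSameDeg.mapMul f hf hPQ)
    fun x y (e : x.embedding = y.embedding) ↦ by
      apply_fun IsLocalization.map (Localization Q) f hPQ at e
      simp_rw [HomogeneousLocalization.NumDenSameDeg.embedding, Localization.mk_eq_mk',
        IsLocalization.map_mk', ← Localization.mk_eq_mk'] at e
      exact e
  map_add' := Quotient.ind₂' fun x y ↦ by
    refine val_injective _ (Eq.trans ?_ (val_add _ _).symm)
    change Localization.mk (f _) _ = Localization.mk (f _) _ + Localization.mk (f _) _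
    rw [Localization.add_mk]
    congr 1
    · simp [NumDenSameDeg.mapMul]
    · ext; simp [NumDenSameDeg.mapMul]
  map_mul' := Quotient.ind₂' fun x y ↦ by
    refine val_injective _ (Eq.trans ?_ (val_mul _ _).symm)
    change Localization.mk (f _) _ = Localization.mk (f _) _ * Localization.mk (f _) _
    rw [Localization.mk_mul]
    congr 1
    · simp
    · ext; simp [NumDenSameDeg.mapMul]
  map_zero' := by
    refine val_injective _ (Eq.trans ?_ val_zero.symm)
    change Localization.mk (f _) _ = _
    simp [Localization.mk_zero]
  map_one' := by
    refine val_injective _ (Eq.trans ?_ val_one.symm)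
    change Localization.mk (f _) _ = _
    rw [← Localization.mk_one]
    congr 1
    · simp
    · ext; simp [NumDenSameDeg.mapMul]

variable (f : A →+* B) {k : ℕ} (hf : ∀ n, ∀ a ∈ 𝒜 n, f a ∈ ℬ (k * n))

lemma mapMul_mk {P : Submonoid A} {Q : Submonoid B} (hPQ : P ≤ Q.comap f)
    (c : NumDenSameDeg 𝒜 P) :
    mapMul f hf hPQ (mk c) = mk (NumDenSameDeg.mapMul f hf hPQ c) := rfl

lemma val_mapMul {P : Submonoid A} {Q : Submonoid B} (hPQ : P ≤ Q.comap f)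
    (x : HomogeneousLocalization 𝒜 P) :
    (mapMul f hf hPQ x).val = IsLocalization.map (Localization Q) f hPQ x.val := by
  obtain ⟨c, rfl⟩ := x.mk_surjective
  rw [mapMul_mk, val_mk, val_mk, Localization.mk_eq_mk', Localization.mk_eq_mk',
    IsLocalization.map_mk']
  rfl

/-- The map on homogeneous localizations at primes induced by a ring homomorphism that multiplies
degrees by `k`. -/
def localMapMul (I : Ideal A) [I.IsPrime] (J : Ideal B) [J.IsPrime] (hIJ : I = J.comap f) :
    AtPrime 𝒜 I →+* AtPrime ℬ J :=
  mapMul f hf (Localization.le_comap_primeCompl_iff.mpr (hIJ ▸ le_rfl))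

lemma val_localMapMul (I : Ideal A) [I.IsPrime] (J : Ideal B) [J.IsPrime]
    (hIJ : I = J.comap f) (x : AtPrime 𝒜 I) :
    (localMapMul f hf I J hIJ x).val = Localization.localRingHom I J f hIJ x.val :=
  val_mapMul ..

instance (I : Ideal A) [I.IsPrime] (J : Ideal B) [J.IsPrime] (hIJ : I = J.comap f) :
    IsLocalHom (localMapMul f hf I J hIJ) where
  map_nonunit x hx := by
    rw [← isUnit_iff_isUnit_val] at hx ⊢
    rw [val_localMapMul] at hx
    exact IsLocalHom.map_nonunit _ hx

/-- The map `A_{(s)} → B_{(f s)}` induced by a ring homomorphism that multiplies degrees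
by `k`. -/
def awayMapMul (s : A) : Away 𝒜 s →+* Away ℬ (f s) :=
  mapMul f hf <| by rintro _ ⟨n, rfl⟩; exact ⟨n, by simp⟩

lemma awayMapMul_mk {d : ℕ} {s : A} (hs : s ∈ 𝒜 d) (n : ℕ) (a : A) (ha : a ∈ 𝒜 (n • d)) :
    awayMapMul f hf s (.mk 𝒜 hs n a ha) = .mk ℬ (hf _ _ hs) n (f a)
      (by have := hf _ _ ha; rwa [smul_eq_mul, mul_left_comm] at this) := by
  apply val_injective
  rw [awayMapMul, val_mapMul, Away.val_mk, Away.val_mk, Localization.mk_eq_mk',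
    Localization.mk_eq_mk', IsLocalization.map_mk']
  congr 1
  ext; simp

end HomogeneousLocalization

namespace AlgebraicGeometry

variable {A B : Type u} [CommRing A] [CommRing B] {σ τ : Type u}
  [SetLike σ A] [AddSubgroupClass σ A] [SetLike τ B] [AddSubgroupClass τ B]
  {𝒜 : ℕ → σ} {ℬ : ℕ → τ} [GradedRing 𝒜] [GradedRing ℬ]
  (f : A →+* B) {k : ℕ} (hf : ∀ n, ∀ a ∈ 𝒜 n, f a ∈ ℬ (k * n)) (hk : 0 < k)

-- As k > 0, distinct degrees of 𝒜 go to distinct degrees of ℬ, so components cannot mix. This is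
-- what makes contractions of homogeneous ideals homogeneous.
include hf hk in
lemma decompose_map_of_mul_degree (a : A) (n : ℕ) :
    (DirectSum.decompose ℬ (f a) (k * n) : B) = f (DirectSum.decompose 𝒜 a n) := by
  classical
  conv_lhs => rw [← DirectSum.sum_support_decompose 𝒜 a]
  rw [map_sum, DirectSum.decompose_sum, DFinsupp.finsetSum_apply,
    AddSubmonoidClass.coe_finsetSum]
  have key : ∀ i, (DirectSum.decompose ℬ (f (DirectSum.decompose 𝒜 a i)) (k * n) : B) =
      if i = n then f (DirectSum.decompose 𝒜 a n) else 0 := by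
    intro i
    split_ifs with h
    · subst h
      exact DirectSum.decompose_of_mem_same _ (hf _ _ (SetLike.coe_mem _))
    · exact DirectSum.decompose_of_mem_ne _ (hf _ _ (SetLike.coe_mem _))
        (fun h' => h (Nat.eq_of_mul_eq_mul_left hk h'))
  simp only [key]
  rw [Finset.sum_ite_eq']
  split_ifs with h
  · rfl
  · simp only [DFinsupp.mem_support_toFun, ne_eq, not_not] at h
    simp [h]

/-- The contraction of a homogeneous ideal along a ring homomorphism that multiplies degrees. -/
abbrev HomogeneousIdeal.comapMul (I : HomogeneousIdeal ℬ) : HomogeneousIdeal 𝒜 where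
  toSubmodule := I.toIdeal.comap f
  is_homogeneous' := fun n a ha => by
    change f _ ∈ I.toIdeal
    rw [← decompose_map_of_mul_degree f hf hk]
    exact I.isHomogeneous _ ha

-- A pointwise condition, saying that the image of the irrelevant ideal has no zeros. It is weaker
-- than generating the irrelevant ideal of ℬ: invariants of positive degree in general generate it
-- only up to radical.
variable (hirr : ∀ p : ProjectiveSpectrum ℬ,
  ∃ n > 0, ∃ a ∈ 𝒜 n, f a ∉ p.asHomogeneousIdeal)

namespace ProjectiveSpectrum

/-- The map `Proj ℬ → Proj 𝒜` on points induced by a ring homomorphism that multiplies degrees. -/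
abbrev comapMulFun (p : ProjectiveSpectrum ℬ) : ProjectiveSpectrum 𝒜 where
  asHomogeneousIdeal := HomogeneousIdeal.comapMul f hf hk p.1
  isPrime := p.2.comap f
  not_irrelevant_le le := by
    obtain ⟨n, hn, a, ha, hap⟩ := hirr p
    exact hap (le (HomogeneousIdeal.mem_irrelevant_of_mem _ hn ha))

/-- The continuous map `Proj ℬ → Proj 𝒜` induced by a ring homomorphism that multiplies
degrees. -/
abbrev comapMul : C(ProjectiveSpectrum ℬ, ProjectiveSpectrum 𝒜) where
  toFun := comapMulFun f hf hk hirr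
  continuous_toFun := by
    simp_rw [continuous_iff_isClosed, _root_.ProjectiveSpectrum.isClosed_iff_zeroLocus, exists_imp, forall_eq_apply_imp_iff]
    refine fun s ↦ ⟨f '' s, ?_⟩
    ext p
    simp [comapMulFun, HomogeneousIdeal.comapMul, Set.subset_def]
    rfl

end ProjectiveSpectrum

namespace Proj

open ProjectiveSpectrum.StructureSheaf _root_.AlgebraicGeometry.ProjectiveSpectrum

/-- The ring homomorphism on stalks induced by a ring homomorphism that multiplies degrees. -/
abbrev stalkMapMul (p : ProjectiveSpectrum ℬ) :
    AtPrime 𝒜 (comapMulFun f hf hk hirr p).1.toIdeal →+* AtPrime ℬ p.1.toIdeal :=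
  localMapMul f hf _ _ rfl

variable (U : Opens (ProjectiveSpectrum 𝒜)) (V : Opens (ProjectiveSpectrum ℬ))
  (hUV : V.1 ⊆ ProjectiveSpectrum.comapMul f hf hk hirr ⁻¹' U.1)

/-- The map on (dependent functions underlying) sections of the structure sheaves. -/
abbrev comapMulStructureSheafFun
    (s : ∀ x : U, AtPrime 𝒜 x.1.1.1) (y : V) : AtPrime ℬ y.1.1.1 :=
  stalkMapMul f hf hk hirr y.1 <| s ⟨.comapMul f hf hk hirr y.1, hUV y.2⟩

lemma isLocallyFraction_comapMulStructureSheafFun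
    (s : ∀ x : U, AtPrime 𝒜 x.1.1.1) (hs : (isLocallyFraction 𝒜).pred s) :
    (isLocallyFraction ℬ).pred (comapMulStructureSheafFun f hf hk hirr U V hUV s) := by
  rintro ⟨p, hpV⟩
  rcases hs ⟨.comapMul f hf hk hirr p, hUV hpV⟩ with ⟨W, m, iWU, i, a, b, hb, h_frac⟩
  refine ⟨W.comap (ProjectiveSpectrum.comapMul f hf hk hirr) ⊓ V, ⟨m, hpV⟩,
    Opens.infLERight _ _, k * i,
    ⟨f a, hf _ _ a.2⟩, ⟨f b, hf _ _ b.2⟩, fun ⟨q, ⟨hqW, hqV⟩⟩ ↦ hb ⟨_, hqW⟩,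
    fun ⟨q, ⟨hqW, hqV⟩⟩ ↦ ?_⟩
  exact congrArg (stalkMapMul f hf hk hirr q) (h_frac ⟨_, hqW⟩)

/-- The ring homomorphism on sections of the structure sheaves. -/
def comapMulStructureSheaf :
    (Proj.structureSheaf 𝒜).1.obj (.op U) →+* (Proj.structureSheaf ℬ).1.obj (.op V) where
  toFun s := ⟨comapMulStructureSheafFun _ _ _ _ _ _ hUV s.1,
      isLocallyFraction_comapMulStructureSheafFun _ _ _ _ _ _ hUV _ s.2⟩
  map_one' := Subtype.ext <| funext fun p => map_one
    (stalkMapMul f hf hk hirr p.1)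
  map_zero' := Subtype.ext <| funext fun p => map_zero
    (stalkMapMul f hf hk hirr p.1)
  map_add' _ _ := Subtype.ext <| funext fun p => map_add
    (stalkMapMul f hf hk hirr p.1) _ _
  map_mul' _ _ := Subtype.ext <| funext fun p => map_mul
    (stalkMapMul f hf hk hirr p.1) _ _

/-- The morphism between objects of sections of the structure sheaves. -/
abbrev comapMulStructureSheafHom :
    (Proj.structureSheaf 𝒜).1.obj (.op U) ⟶ (Proj.structureSheaf ℬ).1.obj (.op V) :=
  CommRingCat.ofHom (comapMulStructureSheaf f hf hk hirr U V hUV)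

/-- The morphism of sheafed spaces induced by a ring homomorphism that multiplies degrees. -/
abbrev sheafedSpaceMapMul :
    Proj.toSheafedSpace ℬ ⟶ Proj.toSheafedSpace 𝒜 where
  hom :=
    { base := TopCat.ofHom <| comapMul f hf hk hirr
      c := { app U := comapMulStructureSheafHom f hf hk hirr U.unop
              (U.unop.comap (comapMul f hf hk hirr)) Set.Subset.rfl } }

lemma germ_mapMul_sectionInBasicOpen {p : ProjectiveSpectrum ℬ}
    (c : NumDenSameDeg 𝒜 (p.comapMul f hf hk hirr).1.toIdeal.primeCompl) :
    (toSheafedSpace ℬ).presheaf.germ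
      ((Opens.map (sheafedSpaceMapMul f hf hk hirr).hom.base).obj _) p (mem_basicOpen_den _ _ _)
      ((sheafedSpaceMapMul f hf hk hirr).hom.c.app _ (sectionInBasicOpen 𝒜 _ c)) =
    (toSheafedSpace ℬ).presheaf.germ
      (ProjectiveSpectrum.basicOpen _ (f c.den)) p c.4
      (sectionInBasicOpen ℬ p (c.mapMul f hf le_rfl)) :=
  rfl

/-- A germ is a homogeneous fraction, represented by a section over the basic open set of its
denominator, and on such sections the map is explicit. Locality and bijectivity of stalk maps
thereby become statements about homogeneous localizations. -/
theorem stalkMap_sheafedSpaceMapMul (p : ProjectiveSpectrum ℬ)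
    (z : AtPrime 𝒜 (comapMulFun f hf hk hirr p).1.toIdeal) :
    ((sheafedSpaceMapMul f hf hk hirr).hom.stalkMap p).hom
        ((stalkIso' 𝒜 (comapMulFun f hf hk hirr p)).symm z) =
      (stalkIso' ℬ p).symm (stalkMapMul f hf hk hirr p z) := by
  obtain ⟨c, rfl⟩ := z.mk_surjective
  erw [stalkIso'_symm_mk]
  erw [PresheafedSpace.stalkMap_germ_apply]
  erw [germ_mapMul_sectionInBasicOpen]

/-- The morphism `Proj ℬ ⟶ Proj 𝒜` induced by a ring homomorphism `f` that multiplies degrees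
by `k > 0` and such that no point of `Proj ℬ` contains the image of the irrelevant ideal. -/
def mapMul : Proj ℬ ⟶ Proj 𝒜 where
  __ := (sheafedSpaceMapMul f hf hk hirr).hom
  prop p := .mk fun x hx ↦ by
    obtain ⟨z, rfl⟩ := (stalkIso' 𝒜 (comapMulFun f hf hk hirr p)).symm.surjective x
    have h : IsUnit ((stalkIso' ℬ p).symm (stalkMapMul f hf hk hirr p z)) :=
      Eq.mp (congrArg IsUnit (stalkMap_sheafedSpaceMapMul f hf hk hirr p z)) hx
    exact ((isUnit_map_iff _ _).mp ((isUnit_map_iff _ _).mp h)).map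
      (stalkIso' 𝒜 (comapMulFun f hf hk hirr p)).symm

theorem ι_comp_mapMul (s : A) : (basicOpen ℬ (f s)).ι ≫ mapMul f hf hk hirr =
    (mapMul f hf hk hirr).resLE (basicOpen 𝒜 s) (basicOpen ℬ (f s)) le_rfl ≫ (basicOpen 𝒜 s).ι :=
  (Scheme.Hom.resLE_comp_ι _ _).symm

lemma awayToSection_comp_mapMul_appLE {i : ℕ} {s : A} (hs : s ∈ 𝒜 i) :
    awayToSection 𝒜 s ≫
      Scheme.Hom.appLE (mapMul f hf hk hirr) (basicOpen 𝒜 s) (basicOpen ℬ (f s)) (by rfl) =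
    CommRingCat.ofHom (awayMapMul f hf s : Away 𝒜 s →+* Away ℬ (f s)) ≫
      awayToSection ℬ (f s) := by
  ext x
  obtain ⟨n, x, hx, rfl⟩ := x.mk_surjective _ hs
  simp only [CommRingCat.hom_comp, RingHom.coe_comp, Function.comp_apply, CommRingCat.hom_ofHom,
    awayMapMul_mk]
  refine Subtype.ext <| funext fun p ↦ ?_
  change HomogeneousLocalization.mk _ = .mk _
  ext
  simp [NumDenSameDeg.mapMul]

/-- The description on affine charts. The charts D₊(f s) cover `Proj ℬ` by `hirr`, so later
identities between morphisms can be checked on them. -/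
theorem awayι_comp_mapMul {i : ℕ} (hi : 0 < i) (s : A) (hs : s ∈ 𝒜 i) :
    awayι ℬ (f s) (hf _ _ hs) (Nat.mul_pos hk hi) ≫ mapMul f hf hk hirr =
    Spec.map (CommRingCat.ofHom (awayMapMul f hf s)) ≫ awayι 𝒜 s hs hi := by
  rw [awayι, awayι, Category.assoc, ι_comp_mapMul, ← Category.assoc, ← Category.assoc]
  congr 1
  rw [Iso.inv_comp_eq, ← Category.assoc, Iso.eq_comp_inv, basicOpenIsoSpec_hom,
    basicOpenIsoSpec_hom, basicOpenToSpec, basicOpenToSpec, Category.assoc, ← Spec.map_comp,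
    ← awayToSection_comp_mapMul_appLE f hf hk hirr hs, Spec.map_comp, ← Category.assoc,
    ← Category.assoc]
  congr 1
  exact (Scheme.Opens.toSpecΓ_SpecMap_appLE _ _ _ _).symm

end Proj

end AlgebraicGeometry

end

/-! ### Points, sections, base schemes and composition for maps of `Proj` -/

noncomputable section

open CategoryTheory AlgebraicGeometry MvPolynomial
open HomogeneousLocalization TopologicalSpace

universe u

namespace AlgebraicGeometry.Proj

variable {A B : Type u} [CommRing A] [CommRing B] {σ τ : Type u}
  [SetLike σ A] [AddSubgroupClass σ A] [SetLike τ B] [AddSubgroupClass τ B]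
  {𝒜 : ℕ → σ} {ℬ : ℕ → τ} [GradedRing 𝒜] [GradedRing ℬ]
  (f : A →+* B) {k : ℕ} (hf : ∀ n, ∀ a ∈ 𝒜 n, f a ∈ ℬ (k * n)) (hk : 0 < k)
  (hirr : ∀ p : ProjectiveSpectrum ℬ, ∃ n > 0, ∃ a ∈ 𝒜 n, f a ∉ p.asHomogeneousIdeal)

/-- The value of a section of the structure sheaf of `Proj` at a point. -/
def evalAt (V : (Proj ℬ).Opens) (y : ProjectiveSpectrum ℬ) (hy : y ∈ V) (s : Γ(Proj ℬ, V)) :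
    AtPrime ℬ y.asHomogeneousIdeal.toIdeal := s.1 ⟨y, hy⟩

lemma section_ext (V : (Proj ℬ).Opens) (s t : Γ(Proj ℬ, V))
    (h : ∀ y hy, evalAt V y hy s = evalAt V y hy t) : s = t :=
  Subtype.ext (funext fun y => h y.1 y.2)

lemma evalAt_awayToSection {d : ℕ} {b : B} (hb : b ∈ ℬ d) (n : ℕ) (x : B) (hx : x ∈ ℬ (n • d))
    (y : ProjectiveSpectrum ℬ) (hy : y ∈ basicOpen ℬ b) :
    (evalAt (basicOpen ℬ b) y hy (awayToSection ℬ b (Away.mk ℬ hb n x hx))).val =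
      Localization.mk x (⟨b ^ n, fun h => hy (y.isPrime.mem_of_pow_mem _ h)⟩ :
        y.asHomogeneousIdeal.toIdeal.primeCompl) := rfl

lemma mem_homogeneousIdeal_iff (I : HomogeneousIdeal ℬ) (b : B) :
    b ∈ I ↔ ∀ n, (DirectSum.decompose ℬ b n : B) ∈ I := by
  classical
  refine ⟨fun h n => I.isHomogeneous n h, fun h => ?_⟩
  rw [← DirectSum.sum_support_decompose ℬ b]
  exact Ideal.sum_mem _ fun i _ => h i

lemma point_ext (x y : Proj ℬ)
    (h : ∀ n, ∀ b ∈ ℬ n, b ∈ x.asHomogeneousIdeal ↔ b ∈ y.asHomogeneousIdeal) : x = y := by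
  apply ProjectiveSpectrum.ext
  ext b
  change b ∈ x.asHomogeneousIdeal ↔ b ∈ y.asHomogeneousIdeal
  rw [mem_homogeneousIdeal_iff, mem_homogeneousIdeal_iff]
  exact forall_congr' fun n => h n _ (SetLike.coe_mem _)

/-- The affine open cover of `Proj ℬ` by the `D₊(f a)`, where `a` is homogeneous of positive
degree. -/
def mapMulAffineOpenCover : (Proj ℬ).AffineOpenCover where
  I₀ := Σ i : PNat, 𝒜 i
  X s := .of (Away ℬ (f s.2))
  f s := awayι ℬ (f s.2) (hf _ _ s.2.2) (Nat.mul_pos hk s.1.2)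
  idx x := ⟨⟨_, (hirr x).choose_spec.1⟩, ⟨_, (hirr x).choose_spec.2.choose_spec.1⟩⟩
  covers x := by
    change x ∈ (awayι ℬ _ _ _).opensRange
    rw [opensRange_awayι]
    exact (hirr x).choose_spec.2.choose_spec.2

lemma awayι_comp_mapMul_comp_toSpecZero {R : Type u} [CommRing R] (a : R →+* 𝒜 0)
    (b : R →+* ℬ 0) (hab : ∀ r, f (a r) = b r) {i : ℕ} (hi : 0 < i) (s : A) (hs : s ∈ 𝒜 i) :
    awayι ℬ (f s) (hf _ _ hs) (Nat.mul_pos hk hi) ≫ mapMul f hf hk hirr ≫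
        toSpecZero 𝒜 ≫ Spec.map (CommRingCat.ofHom a) =
      awayι ℬ (f s) (hf _ _ hs) (Nat.mul_pos hk hi) ≫
        toSpecZero ℬ ≫ Spec.map (CommRingCat.ofHom b) := by
  rw [← Category.assoc, awayι_comp_mapMul f hf hk hirr hi _ hs, Category.assoc,
    awayι_toSpecZero_assoc, awayι_toSpecZero_assoc, ← Spec.map_comp, ← Spec.map_comp,
    ← Spec.map_comp, ← CommRingCat.ofHom_comp, ← CommRingCat.ofHom_comp, ← CommRingCat.ofHom_comp]
  congr 2
  ext r
  simp only [RingHom.comp_apply, awayMapMul, val_mapMul]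
  change IsLocalization.map _ _ _ (Localization.mk _ 1) = Localization.mk _ 1
  rw [Localization.mk_one_eq_algebraMap, Localization.mk_one_eq_algebraMap,
    IsLocalization.map_eq, hab]

/-- The morphism of `Proj` induced by a ring homomorphism compatible with ring homomorphisms from
`R` is a morphism over `Spec R`. -/
theorem mapMul_comp_toSpecZero {R : Type u} [CommRing R] (a : R →+* 𝒜 0) (b : R →+* ℬ 0)
    (hab : ∀ r, f (a r) = b r) :
    mapMul f hf hk hirr ≫ toSpecZero 𝒜 ≫ Spec.map (CommRingCat.ofHom a) =
      toSpecZero ℬ ≫ Spec.map (CommRingCat.ofHom b) :=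
  (mapMulAffineOpenCover f hf hk hirr).openCover.hom_ext _ _ fun s =>
    awayι_comp_mapMul_comp_toSpecZero f hf hk hirr a b hab s.1.2 s.2 s.2.2

/-- The morphism depends only on the ring homomorphism. -/
lemma mapMul_congr {f f' : A →+* B} (h : f = f') {k : ℕ}
    (hf : ∀ n, ∀ a ∈ 𝒜 n, f a ∈ ℬ (k * n)) (hf' : ∀ n, ∀ a ∈ 𝒜 n, f' a ∈ ℬ (k * n))
    (hk hk' : 0 < k)
    (hirr : ∀ p : ProjectiveSpectrum ℬ, ∃ n > 0, ∃ a ∈ 𝒜 n, f a ∉ p.asHomogeneousIdeal)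
    (hirr' : ∀ p : ProjectiveSpectrum ℬ, ∃ n > 0, ∃ a ∈ 𝒜 n, f' a ∉ p.asHomogeneousIdeal) :
    mapMul f hf hk hirr = mapMul f' hf' hk' hirr' := by
  subst h
  rfl

variable {C υ : Type u} [CommRing C] [SetLike υ C] [AddSubgroupClass υ C] {𝒞 : ℕ → υ}
  [GradedRing 𝒞]

/-- Both sides agree on the affine charts. When g fixes the image of f, this is the invariance of
the quotient map under g. -/
theorem map_comp_mapMul (g : ℬ →+*ᵍ 𝒞)
    (hg : HomogeneousIdeal.irrelevant 𝒞 ≤ (HomogeneousIdeal.irrelevant ℬ).map g)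
    (hirr' : ∀ p : ProjectiveSpectrum 𝒞, ∃ n > 0, ∃ a ∈ 𝒜 n,
      g.toRingHom.comp f a ∉ p.asHomogeneousIdeal) :
    map g hg ≫ mapMul f hf hk hirr =
      mapMul (g.toRingHom.comp f) (fun n a ha => g.map_mem (hf n a ha)) hk hirr' := by
  have key : ∀ {i : ℕ} (hi : 0 < i) (s : A) (hs : s ∈ 𝒜 i),
      awayι 𝒞 (g (f s)) (g.map_mem (hf _ _ hs)) (Nat.mul_pos hk hi) ≫
        map g hg ≫ mapMul f hf hk hirr =
      awayι 𝒞 (g (f s)) (g.map_mem (hf _ _ hs)) (Nat.mul_pos hk hi) ≫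
        mapMul (g.toRingHom.comp f) (fun n a ha => g.map_mem (hf n a ha)) hk hirr' := by
    intro i hi s hs
    refine Eq.trans ?_ (awayι_comp_mapMul (g.toRingHom.comp f)
      (fun n a ha => g.map_mem (hf n a ha)) hk hirr' hi s hs).symm
    rw [awayι_comp_map_assoc g hg (Nat.mul_pos hk hi) (f s) (hf _ _ hs),
      awayι_comp_mapMul f hf hk hirr hi s hs, ← Category.assoc, ← Spec.map_comp,
      ← CommRingCat.ofHom_comp]
    congr 3
    ext x
    obtain ⟨n, a, ha, rfl⟩ := Away.mk_surjective _ hs x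
    rw [RingHom.comp_apply, awayMapMul_mk, Away.map_mk, awayMapMul_mk]
    rfl
  exact (mapMulAffineOpenCover (g.toRingHom.comp f) (fun n a ha => g.map_mem (hf n a ha)) hk
    hirr').openCover.hom_ext _ _ fun s => key s.1.2 s.2 s.2.2

/-- The `D₊(a)`, where `a` is homogeneous of positive degree, form a basis of `Proj 𝒜`. -/
lemma exists_basicOpen_le (U : (Proj 𝒜).Opens) (x : ProjectiveSpectrum 𝒜) (hx : x ∈ U) :
    ∃ m > 0, ∃ a ∈ 𝒜 m, a ∉ x.asHomogeneousIdeal ∧ basicOpen 𝒜 a ≤ U := by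
  obtain ⟨_, ⟨c, rfl⟩, hxc, hcU⟩ :=
    (ProjectiveSpectrum.isTopologicalBasis_basic_opens 𝒜).exists_subset_of_mem_open hx U.isOpen
  have h0 : ∃ m, (DirectSum.decompose 𝒜 c m : A) ∉ x.asHomogeneousIdeal := by
    by_contra! h
    exact hxc ((mem_homogeneousIdeal_iff _ _).2 h)
  obtain ⟨m, hm⟩ := h0
  have h1 : ∃ d > 0, ∃ b ∈ 𝒜 d, b ∉ x.asHomogeneousIdeal := by
    by_contra! h
    exact x.not_irrelevant_le ((HomogeneousIdeal.toIdeal_irrelevant_le _).2 fun i hi b hb =>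
      h i hi b hb)
  obtain ⟨d, hd, b, hb, hbx⟩ := h1
  -- The component of c may have degree zero; the factor b makes the degree positive without leaving
  -- the complement of x.
  refine ⟨m + d, by omega, DirectSum.decompose 𝒜 c m * b,
    SetLike.mul_mem_graded (SetLike.coe_mem _) hb,
    fun h => (x.isPrime.mem_or_mem h).elim hm hbx, fun p hp => hcU ?_⟩
  intro hpc
  exact hp (Ideal.mul_mem_right _ _ (p.asHomogeneousIdeal.isHomogeneous _ hpc))

end AlgebraicGeometry.Proj

end

/-! ### When a degree-multiplying ring homomorphism induces an isomorphism of `Proj` -/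

noncomputable section

open CategoryTheory AlgebraicGeometry MvPolynomial
open HomogeneousLocalization TopologicalSpace

universe u

namespace AlgebraicGeometry.Proj

variable {A B : Type u} [CommRing A] [CommRing B] {σ τ : Type u}
  [SetLike σ A] [AddSubgroupClass σ A] [SetLike τ B] [AddSubgroupClass τ B]
  {𝒜 : ℕ → σ} {ℬ : ℕ → τ} [GradedRing 𝒜] [GradedRing ℬ]
  (f : A →+* B) {k : ℕ} (hf : ∀ n, ∀ a ∈ 𝒜 n, f a ∈ ℬ (k * n)) (hk : 0 < k)
  (hirr : ∀ p : ProjectiveSpectrum ℬ, ∃ n > 0, ∃ a ∈ 𝒜 n, f a ∉ p.asHomogeneousIdeal)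

lemma stalkMapMul_injective [IsDomain B] (hinj : Function.Injective f)
    (p : ProjectiveSpectrum ℬ) : Function.Injective (stalkMapMul f hf hk hirr p) := by
  rw [injective_iff_map_eq_zero]
  intro x hx
  obtain ⟨c, rfl⟩ := x.mk_surjective
  have h := congrArg val hx
  rw [stalkMapMul, localMapMul, mapMul_mk, val_mk, val_zero, Localization.mk_eq_mk',
    IsLocalization.mk'_eq_zero_iff] at h
  obtain ⟨m, hm⟩ := h
  have hm0 : (m : B) ≠ 0 := fun h0 => m.2 (h0 ▸ zero_mem _)
  have h1 : f c.num = 0 := (mul_eq_zero.mp hm).resolve_left hm0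
  apply mk_eq_zero_of_num
  ext
  exact hinj (h1.trans (map_zero f).symm)

/-- The denominator of a fraction is nonzero, so its degree is a multiple of k. The numerator has
the same degree, and both lift. -/
lemma stalkMapMul_surjective (hsurj : ∀ n, ∀ b ∈ ℬ (k * n), ∃ a ∈ 𝒜 n, f a = b)
    (hdvd : ∀ n, ∀ b ∈ ℬ n, b ≠ 0 → k ∣ n)
    (p : ProjectiveSpectrum ℬ) : Function.Surjective (stalkMapMul f hf hk hirr p) := by
  intro y
  obtain ⟨⟨d, ⟨b, hb⟩, ⟨c, hc⟩, hcp⟩, rfl⟩ := y.mk_surjective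
  have hc0 : c ≠ 0 := fun h0 => hcp (h0 ▸ zero_mem _)
  obtain ⟨n, rfl⟩ := hdvd d c hc hc0
  obtain ⟨a, ha, rfl⟩ := hsurj n b hb
  obtain ⟨a', ha', rfl⟩ := hsurj n c hc
  exact ⟨mk ⟨n, ⟨a, ha⟩, ⟨a', ha'⟩, hcp⟩, rfl⟩

lemma stalkMap_mapMul (p : ProjectiveSpectrum ℬ)
    (z : AtPrime 𝒜 (ProjectiveSpectrum.comapMulFun f hf hk hirr p).1.toIdeal) :
    ((mapMul f hf hk hirr).stalkMap p).hom
        ((stalkIso' 𝒜 (ProjectiveSpectrum.comapMulFun f hf hk hirr p)).symm z) =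
      (stalkIso' ℬ p).symm (stalkMapMul f hf hk hirr p z) :=
  stalkMap_sheafedSpaceMapMul f hf hk hirr p z

lemma isIso_mapMul_stalkMap (p : Proj ℬ)
    (h : Function.Bijective (stalkMapMul f hf hk hirr p)) :
    IsIso ((mapMul f hf hk hirr).stalkMap p) := by
  apply (ConcreteCategory.isIso_iff_bijective _).2
  have h1 := ((stalkIso' ℬ p).symm.bijective.comp h).comp
    (stalkIso' 𝒜 (ProjectiveSpectrum.comapMulFun f hf hk hirr p)).bijective
  refine (iff_of_eq (congrArg Function.Bijective (funext fun x => ?_))).2 h1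
  obtain ⟨z, rfl⟩ := (stalkIso' 𝒜 (ProjectiveSpectrum.comapMulFun f hf hk hirr p)).symm.surjective x
  refine (stalkMap_mapMul f hf hk hirr p z).trans ?_
  simp only [Function.comp]
  erw [RingEquiv.apply_symm_apply]

/-- If `f` identifies the graded ring `ℬ` with `𝒜` after multiplying the degrees by `k`, then it
induces an isomorphism of `Proj`. -/
theorem isIso_mapMul [IsDomain B] (hinj : Function.Injective f)
    (hsurj : ∀ n, ∀ b ∈ ℬ (k * n), ∃ a ∈ 𝒜 n, f a = b)
    (hdvd : ∀ n, ∀ b ∈ ℬ n, b ≠ 0 → k ∣ n) :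
    IsIso (mapMul f hf hk hirr) := by
  have hcomp : ∀ n, ∀ b ∈ ℬ n, ∃ a, (∃ m, a ∈ 𝒜 m) ∧ f a = b := by
    intro n b hb
    by_cases h0 : b = 0
    · exact ⟨0, ⟨0, zero_mem _⟩, by simp [h0]⟩
    · obtain ⟨m, rfl⟩ := hdvd n b hb h0
      obtain ⟨a, ha, rfl⟩ := hsurj m b hb
      exact ⟨a, ⟨m, ha⟩, rfl⟩
  have hfs : Function.Surjective f := by
    classical
    intro b
    rw [← DirectSum.sum_support_decompose ℬ b]
    choose g hg using fun i => (hcomp i (DirectSum.decompose ℬ b i) (SetLike.coe_mem _))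
    exact ⟨∑ i ∈ (DirectSum.decompose ℬ b).support, g i, by simp [(hg _).2]⟩
  have hbij : Function.Bijective (ProjectiveSpectrum.comapMulFun f hf hk hirr) := by
    constructor
    · intro x y hxy
      refine point_ext x y fun n b _ => ?_
      obtain ⟨a, rfl⟩ := hfs b
      exact (iff_of_eq (congrArg (fun z : ProjectiveSpectrum 𝒜 => a ∈ z.asHomogeneousIdeal) hxy))
    · intro q
      have hmem : ∀ a, f a ∈ q.asHomogeneousIdeal.toIdeal.map f ↔ a ∈ q.asHomogeneousIdeal := by
        intro a
        rw [Ideal.mem_map_iff_of_surjective f hfs]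
        constructor
        · rintro ⟨a', h, h'⟩
          rwa [← hinj h']
        · intro h
          exact ⟨a, h, rfl⟩
      have hhom : (q.asHomogeneousIdeal.toIdeal.map f).IsHomogeneous ℬ := by
        intro n b hb
        by_cases hn : k ∣ n
        · obtain ⟨m, rfl⟩ := hn
          obtain ⟨a, rfl⟩ := hfs b
          rw [decompose_map_of_mul_degree f hf hk, hmem]
          exact q.asHomogeneousIdeal.isHomogeneous _ ((hmem a).1 hb)
        · have : (DirectSum.decompose ℬ b n : B) = 0 := by
            by_contra h
            exact hn (hdvd n _ (SetLike.coe_mem _) h)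
          rw [this]
          exact zero_mem _
      have hprime : (q.asHomogeneousIdeal.toIdeal.map f).IsPrime := by
        have := q.isPrime
        refine Ideal.map_isPrime_of_surjective hfs ?_
        rw [(RingHom.injective_iff_ker_eq_bot f).1 hinj]
        exact bot_le
      refine ⟨⟨⟨_, hhom⟩, hprime, fun hle => q.not_irrelevant_le ?_⟩, ?_⟩
      · refine (HomogeneousIdeal.toIdeal_irrelevant_le _).2 fun i hi a ha => ?_
        exact (hmem a).1 (hle (HomogeneousIdeal.mem_irrelevant_of_mem _ (Nat.mul_pos hk hi)
          (hf _ _ ha)))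
      · refine point_ext (ℬ := 𝒜) _ _ fun n a _ => hmem a
  -- An isomorphism is a homeomorphism inducing isomorphisms on stalks. Bijectivity on points is
  -- known, so openness remains: since f is surjective, each basic open set is the preimage of a
  -- basic open set.
  rw [isIso_iff_isIso_stalkMap]
  refine ⟨?_, fun p => isIso_mapMul_stalkMap f hf hk hirr p
    ⟨stalkMapMul_injective f hf hk hirr hinj p,
      stalkMapMul_surjective f hf hk hirr hsurj hdvd p⟩⟩
  have hopen : IsOpenMap (ProjectiveSpectrum.comapMul f hf hk hirr) := by
    rw [(ProjectiveSpectrum.isTopologicalBasis_basic_opens ℬ).isOpenMap_iff]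
    rintro _ ⟨b, rfl⟩
    obtain ⟨a, rfl⟩ := hfs b
    convert (ProjectiveSpectrum.basicOpen 𝒜 a).isOpen
    ext q
    constructor
    · rintro ⟨p, hp, rfl⟩
      exact hp
    · intro hq
      obtain ⟨p, rfl⟩ := hbij.2 q
      exact ⟨p, hq, rfl⟩
  exact (TopCat.isIso_iff_isHomeomorph _).2
    ⟨(ProjectiveSpectrum.comapMul f hf hk hirr).continuous, hopen, hbij⟩

end AlgebraicGeometry.Proj

end

/-! ### Quotients of projective space by finite linear groups -/

noncomputable section

open CategoryTheory AlgebraicGeometry MvPolynomial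
open HomogeneousLocalization TopologicalSpace

namespace QuotG25920

section Invariants

variable {n : ℕ} (W : Subgroup (GL (Fin n) ℂ))

/-- The action of a linear group on polynomials by `w • p = p ∘ w⁻¹`. -/
abbrev polynomialAction : MulSemiringAction W (MvPolynomial (Fin n) ℂ) where
  smul w p := subst (w : GL (Fin n) ℂ)⁻¹ p
  one_smul p := by
    change subst (((1 : W) : GL (Fin n) ℂ))⁻¹ p = p
    simp [subst_one]
  mul_smul v w p := by
    change subst (((v * w : W) : GL (Fin n) ℂ))⁻¹ p = subst _ (subst _ p)
    simp [subst_comp]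
  smul_zero w := map_zero (subst _)
  smul_add w := map_add (subst _)
  smul_one w := map_one (subst _)
  smul_mul w := map_mul (subst _)

variable {A : Type} [CommRing A] (φ : A →+* MvPolynomial (Fin n) ℂ)
  (hinv : ∀ p, p ∈ φ.range ↔ ∀ w ∈ W, subst w p = p)

include hinv

lemma isIntegral_of_range_eq_invariants [Finite W] : φ.IsIntegral := by
  let := polynomialAction W
  let := φ.toAlgebra
  have : Algebra.IsInvariant A (MvPolynomial (Fin n) ℂ) W := ⟨fun p hp => by
    obtain ⟨a, ha⟩ := (hinv p).2 fun w hw => by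
      have := hp ⟨w, hw⟩⁻¹
      change subst (((⟨w, hw⟩ : W)⁻¹ : W) : GL (Fin n) ℂ)⁻¹ p = p at this
      simpa using this
    exact ⟨a, ha⟩⟩
  exact (Algebra.IsInvariant.isIntegral A (MvPolynomial (Fin n) ℂ) W).isIntegral

/-- A finite group acts transitively on the primes above a given prime of its ring of invariants.
This controls the fibres of the quotient map. -/
lemma exists_comap_subst_eq [Finite W] (P Q : Ideal (MvPolynomial (Fin n) ℂ)) [P.IsPrime]
    [Q.IsPrime] (hPQ : P.comap φ = Q.comap φ) : ∃ w ∈ W, Q = P.comap (subst w) := by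
  let := polynomialAction W
  let := φ.toAlgebra
  have : Algebra.IsInvariant A (MvPolynomial (Fin n) ℂ) W := ⟨fun p hp => by
    obtain ⟨a, ha⟩ := (hinv p).2 fun w hw => by
      have := hp ⟨w, hw⟩⁻¹
      change subst (((⟨w, hw⟩ : W)⁻¹ : W) : GL (Fin n) ℂ)⁻¹ p = p at this
      simpa using this
    exact ⟨a, ha⟩⟩
  have : SMulCommClass W A (MvPolynomial (Fin n) ℂ) := ⟨fun w a p => by
    change subst (w : GL (Fin n) ℂ)⁻¹ (φ a * p) = φ a * subst (w : GL (Fin n) ℂ)⁻¹ p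
    rw [map_mul, (hinv (φ a)).1 ⟨a, rfl⟩ _ (inv_mem w.2)]⟩
  obtain ⟨w, hw⟩ := Algebra.IsInvariant.exists_smul_of_under_eq A (MvPolynomial (Fin n) ℂ) W P Q hPQ
  refine ⟨w, w.2, ?_⟩
  ext p
  rw [hw, Ideal.mem_pointwise_smul_iff_inv_smul_mem, Ideal.mem_comap]
  change subst (((w⁻¹ : W) : GL (Fin n) ℂ))⁻¹ p ∈ P ↔ _
  simp

end Invariants

section Quotient

variable {n : ℕ} {A : Type} [CommRing A] {σ : Type} [SetLike σ A] [AddSubgroupClass σ A]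
  {𝒜 : ℕ → σ} [GradedRing 𝒜] (φ : A →+* MvPolynomial (Fin n) ℂ) {k : ℕ} (hk : 0 < k)
  (hφ : ∀ m, ∀ a ∈ 𝒜 m, φ a ∈ homogeneousSubmodule (Fin n) ℂ (k * m))
  (hinj : Function.Injective φ) (W : Subgroup (GL (Fin n) ℂ))
  (hinv : ∀ p, p ∈ φ.range ↔ ∀ w ∈ W, subst w p = p)

include hφ hk hinv in
/-- If a point of projective space contains the images of all homogeneous invariants of positive
degree, then it contains the irrelevant ideal. -/
lemma exists_invariant_notMem [Finite W]
    (p : ProjectiveSpectrum (homogeneousSubmodule (Fin n) ℂ)) :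
    ∃ m > 0, ∃ a ∈ 𝒜 m, φ a ∉ p.asHomogeneousIdeal := by
  classical
  by_contra! hcon
  have hp := p.isPrime
  have hsub : ∀ a, φ a - C (constantCoeff (φ a)) ∈ p.asHomogeneousIdeal := by
    intro a
    have h0 : φ (DirectSum.decompose 𝒜 a 0) ∈ homogeneousSubmodule (Fin n) ℂ 0 := by
      simpa using hφ 0 _ (SetLike.coe_mem (DirectSum.decompose 𝒜 a 0))
    have hpos : ∀ m, 0 < m → constantCoeff (φ (DirectSum.decompose 𝒜 a m)) = 0 := by
      intro m hm
      have := hφ m _ (SetLike.coe_mem (DirectSum.decompose 𝒜 a m))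
      rw [mem_homogeneousSubmodule] at this
      exact this.coeff_eq_zero (by simpa using (Nat.mul_pos hk hm).ne)
    rw [mem_homogeneousSubmodule, ← totalDegree_zero_iff_isHomogeneous,
      totalDegree_eq_zero_iff_eq_C] at h0
    rw [← DirectSum.sum_support_decompose 𝒜 a, map_sum, map_sum, map_sum, ← Finset.sum_sub_distrib]
    refine Ideal.sum_mem _ fun m _ => ?_
    rcases Nat.eq_zero_or_pos m with rfl | hm
    · rw [h0]
      simp
    · rw [hpos m hm]
      simpa using hcon m hm _ (SetLike.coe_mem _)
  have hprime : (RingHom.ker (constantCoeff (R := ℂ) (σ := Fin n))).IsPrime :=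
    RingHom.ker_isPrime _
  -- By `hsub`, p and the ideal of the origin have the same contraction, so they are conjugate under
  -- W. The substitution preserves degrees, so every form of positive degree then lies in p.
  obtain ⟨w, -, hw⟩ := exists_comap_subst_eq W φ hinv
    (RingHom.ker (constantCoeff (R := ℂ) (σ := Fin n))) p.asHomogeneousIdeal.toIdeal (by
      ext a
      rw [Ideal.mem_comap, Ideal.mem_comap, RingHom.mem_ker]
      have h1 := hsub a
      constructor
      · intro h
        rw [h, map_zero, sub_zero] at h1
        exact h1
      · intro h
        have h2 : C (constantCoeff (φ a)) ∈ p.asHomogeneousIdeal.toIdeal := by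
          have := Ideal.sub_mem _ h h1
          simpa using this
        by_contra h3
        exact hp.ne_top (Ideal.eq_top_of_isUnit_mem _ h2 ((IsUnit.mk0 _ h3).map C)))
  refine p.not_irrelevant_le ((HomogeneousIdeal.toIdeal_irrelevant_le _).2 fun i hi b hb => ?_)
  change b ∈ p.asHomogeneousIdeal.toIdeal
  rw [hw, Ideal.mem_comap, RingHom.mem_ker]
  exact (subst_isHomogeneous w hb).coeff_eq_zero (by simpa using hi.ne)

include hφ hk hinj in
lemma mem_of_map_mem_homogeneous {a : A} {m : ℕ}
    (h : φ a ∈ homogeneousSubmodule (Fin n) ℂ (k * m)) : a ∈ 𝒜 m := by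
  have h1 := decompose_map_of_mul_degree φ hφ hk a m
  rw [DirectSum.decompose_of_mem_same _ h] at h1
  rw [hinj h1]
  exact SetLike.coe_mem _

variable [Finite W]

/-- The morphism from projective space to `Proj 𝒜`, where `𝒜` is the ring of invariants. -/
def quotientMap : ProjSpace n ⟶ Proj 𝒜 :=
  Proj.mapMul φ hφ hk (exists_invariant_notMem φ hk hφ W hinv)

-- Lying over for an integral extension provides a prime above q containing I. Its homogeneous core
-- is again prime, still contains I, and still contracts to q because q is homogeneous.
include hk hφ hinv in
lemma exists_point_over (I : HomogeneousIdeal (homogeneousSubmodule (Fin n) ℂ))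
    (q : ProjectiveSpectrum 𝒜) (hI : I.toIdeal.comap φ ≤ q.asHomogeneousIdeal.toIdeal) :
    ∃ p : ProjectiveSpectrum (homogeneousSubmodule (Fin n) ℂ), I ≤ p.asHomogeneousIdeal ∧
      ∀ a, φ a ∈ p.asHomogeneousIdeal ↔ a ∈ q.asHomogeneousIdeal := by
  let := φ.toAlgebra
  have : Algebra.IsIntegral A (MvPolynomial (Fin n) ℂ) :=
    ⟨isIntegral_of_range_eq_invariants W φ hinv⟩
  have := q.isPrime
  obtain ⟨Q, hQI, hQ, hQq⟩ := Ideal.exists_ideal_over_prime_of_isIntegral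
    q.asHomogeneousIdeal.toIdeal I.toIdeal hI
  let P := Q.homogeneousCore (homogeneousSubmodule (Fin n) ℂ)
  have hP : P.toIdeal.IsPrime := hQ.homogeneousCore
  have hmem : ∀ a, φ a ∈ P ↔ a ∈ q.asHomogeneousIdeal := by
    intro a
    rw [Proj.mem_homogeneousIdeal_iff (ℬ := 𝒜)]
    have hQq' : ∀ a, φ a ∈ Q ↔ a ∈ q.asHomogeneousIdeal := fun a => by
      rw [← HomogeneousIdeal.mem_iff, ← hQq]; rfl
    constructor
    · intro h m
      rw [← hQq', ← decompose_map_of_mul_degree φ hφ hk]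
      exact Ideal.toIdeal_homogeneousCore_le _ _ (P.isHomogeneous _ h)
    · intro h
      classical
      rw [← DirectSum.sum_support_decompose 𝒜 a, map_sum]
      refine Ideal.sum_mem _ fun m _ => ?_
      exact Ideal.mem_homogeneousCore_of_homogeneous_of_mem
        ⟨_, hφ m _ (SetLike.coe_mem _)⟩ ((hQq' _).2 (h m))
  refine ⟨⟨P, hP, fun hle => q.not_irrelevant_le ?_⟩, ?_, hmem⟩
  · refine (HomogeneousIdeal.toIdeal_irrelevant_le _).2 fun i hi a ha => ?_
    exact (hmem a).1 (hle (HomogeneousIdeal.mem_irrelevant_of_mem _ (Nat.mul_pos hk hi)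
      (hφ _ _ ha)))
  · exact (Ideal.homogeneousCore.gc _ _ _).1 hQI

include hinj in
lemma isQuotientMap_quotientMap :
    Topology.IsQuotientMap (quotientMap φ hk hφ W hinv) := by
  have hsurj : Function.Surjective (quotientMap φ hk hφ W hinv) := by
    intro q
    obtain ⟨p, -, hp⟩ := exists_point_over φ hk hφ W hinv ⊥ q (by
      intro a ha
      have h0 : φ a = 0 := ha
      rw [hinj (h0.trans (map_zero φ).symm)]
      exact zero_mem _)
    exact ⟨p, Proj.point_ext (ℬ := 𝒜) _ _ fun m a _ => hp a⟩
  -- A closed continuous surjection is a quotient map. The image of a closed set is the zero locus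
  -- of the contraction of its vanishing ideal; the nontrivial inclusion is lying over relative to
  -- that ideal.
  refine IsClosedMap.isQuotientMap ?_ (quotientMap φ hk hφ W hinv).continuous hsurj
  intro Z hZ
  obtain ⟨s, rfl⟩ := (ProjectiveSpectrum.isClosed_iff_zeroLocus _ _).1 hZ
  have key : quotientMap φ hk hφ W hinv '' ProjectiveSpectrum.zeroLocus _ s =
      ProjectiveSpectrum.zeroLocus 𝒜 ((ProjectiveSpectrum.vanishingIdeal
        (ProjectiveSpectrum.zeroLocus (homogeneousSubmodule (Fin n) ℂ) s)).toIdeal.comap φ) := by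
    ext q
    constructor
    · rintro ⟨p, hp, rfl⟩ a ha
      exact (ProjectiveSpectrum.mem_vanishingIdeal _ _).1 ha p hp
    · intro hq
      obtain ⟨p, hIp, hp⟩ := exists_point_over φ hk hφ W hinv _ q hq
      refine ⟨p, ?_, Proj.point_ext (ℬ := 𝒜) _ _ fun m a _ => hp a⟩
      exact fun b hb => hIp (ProjectiveSpectrum.subset_vanishingIdeal_zeroLocus _ s hb)
  rw [key]
  exact ProjectiveSpectrum.isClosed_zeroLocus _ _

variable (G : Subgroup (GL (Fin n) ℂ)) (hGW : G ≤ W)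
  (hW : ∀ w ∈ W, ∃ g ∈ G, ∃ c : ℂ, c ^ k = 1 ∧
    (w : Matrix (Fin n) (Fin n) ℂ) = c • (g : Matrix (Fin n) (Fin n) ℂ))

lemma subst_eq_of_eq_smul {w g : GL (Fin n) ℂ} {c : ℂ}
    (h : (w : Matrix (Fin n) (Fin n) ℂ) = c • (g : Matrix (Fin n) (Fin n) ℂ)) {m : ℕ}
    {p : MvPolynomial (Fin n) ℂ} (hp : p.IsHomogeneous m) : subst w p = c ^ m • subst g p := by
  have h1 : ∀ i, subst w (X i) = C c * subst g (X i) := by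
    intro i
    simp [subst, h, Finset.mul_sum, mul_assoc]
  rw [p.as_sum, map_sum, map_sum, Finset.smul_sum]
  refine Finset.sum_congr rfl fun d hd => ?_
  have hdm : ∑ i, d i = m := by
    rw [← hp (mem_support_iff.1 hd), Finsupp.weight_apply, Finsupp.sum_fintype _ _ (by simp)]
    simp
  rw [monomial_eq, Finsupp.prod_fintype _ _ (by simp)]
  simp only [map_mul, map_prod, map_pow, h1, mul_pow, Finset.prod_mul_distrib,
    Finset.prod_pow_eq_pow_sum, hdm, smul_eq_C_mul]
  have hC : ∀ v : GL (Fin n) ℂ, subst v (C (coeff d p)) = C (coeff d p) :=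
    fun v => (subst v).commutes _
  rw [hC, hC]
  ring

-- A scalar c with cᵏ = 1 acts trivially on forms of degree divisible by k. In these degrees
-- invariance under G is therefore the same as invariance under W.
include hW hinv hk hφ hinj in
omit [Finite W] in
lemma mem_range_of_invariant {m : ℕ} {p : MvPolynomial (Fin n) ℂ}
    (hp : p.IsHomogeneous (k * m)) (h : ∀ g ∈ G, subst g p = p) :
    ∃ a ∈ 𝒜 m, φ a = p := by
  obtain ⟨a, rfl⟩ := (hinv p).2 fun w hw => by
    obtain ⟨g, hg, c, hc, hwc⟩ := hW w hw
    rw [subst_eq_of_eq_smul hwc hp, h g hg, pow_mul, hc, one_pow, one_smul]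
  exact ⟨a, mem_of_map_mem_homogeneous φ hk hφ hinj hp, rfl⟩

include hGW in
lemma projAct_comp_quotientMap {g : GL (Fin n) ℂ} (hg : g ∈ G) :
    projAct g ≫ quotientMap φ hk hφ W hinv = quotientMap φ hk hφ W hinv := by
  have h : ((substGraded g).toRingHom.comp φ) = φ :=
    RingHom.ext fun a => (hinv (φ a)).1 ⟨a, rfl⟩ g (hGW hg)
  refine (Proj.map_comp_mapMul φ hφ hk _ (substGraded g) (irrelevant_le_map_substGraded g)
    (by rw [h]; exact exists_invariant_notMem φ hk hφ W hinv)).trans ?_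
  exact Proj.mapMul_congr h _ _ _ _ _ _

lemma projAct_apply_mem (g : GL (Fin n) ℂ) (x : ProjSpace n) (p : MvPolynomial (Fin n) ℂ) :
    p ∈ ProjectiveSpectrum.asHomogeneousIdeal
      (projAct g x : ProjectiveSpectrum (homogeneousSubmodule (Fin n) ℂ)) ↔
    subst g p ∈ ProjectiveSpectrum.asHomogeneousIdeal
      (x : ProjectiveSpectrum (homogeneousSubmodule (Fin n) ℂ)) := Iff.rfl

-- Points with the same image are conjugate under W, and the scalar separating an element of W from
-- one of G does not affect homogeneous ideals.
include hGW hW in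
lemma quotientMap_eq_iff (x y : ProjSpace n) :
    quotientMap φ hk hφ W hinv x = quotientMap φ hk hφ W hinv y ↔
      ∃ g : G, projAct g.1 x = y := by
  constructor
  · intro h
    let x' : ProjectiveSpectrum (homogeneousSubmodule (Fin n) ℂ) := x
    let y' : ProjectiveSpectrum (homogeneousSubmodule (Fin n) ℂ) := y
    have hx := x'.isPrime
    have hy := y'.isPrime
    obtain ⟨w, hw, hwQ⟩ := exists_comap_subst_eq W φ hinv x'.asHomogeneousIdeal.toIdeal
      y'.asHomogeneousIdeal.toIdeal
      (congrArg (fun z : ProjectiveSpectrum 𝒜 => z.asHomogeneousIdeal.toIdeal) h)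
    obtain ⟨g, hg, c, hc, hwc⟩ := hW w hw
    have hc0 : c ≠ 0 := fun h0 => by simp [h0, hk.ne'] at hc
    refine ⟨⟨g, hg⟩, Proj.point_ext (ℬ := homogeneousSubmodule (Fin n) ℂ) _ _ fun m p hp => ?_⟩
    rw [projAct_apply_mem]
    change _ ↔ p ∈ y'.asHomogeneousIdeal.toIdeal
    rw [hwQ, Ideal.mem_comap, subst_eq_of_eq_smul hwc hp, smul_eq_C_mul]
    rw [Ideal.unit_mul_mem_iff_mem _ ((IsUnit.mk0 _ (pow_ne_zero m hc0)).map C)]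
    rfl
  · rintro ⟨g, rfl⟩
    rw [← Scheme.Hom.comp_apply, projAct_comp_quotientMap φ hk hφ W hinv G hGW g.2]

include hinj in
lemma quotientMap_app_injective (U : (Proj 𝒜).Opens) :
    Function.Injective ((quotientMap φ hk hφ W hinv).app U) := by
  intro s t hst
  refine Proj.section_ext U s t fun q hq => ?_
  obtain ⟨p, rfl⟩ := (isQuotientMap_quotientMap φ hk hφ hinj W hinv).surjective q
  exact Proj.stalkMapMul_injective φ hφ hk _ hinj p
    (congrArg (Proj.evalAt (quotientMap φ hk hφ W hinv ⁻¹ᵁ U) p hq) hst)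

include hinj hGW hW in
/-- An invariant section over the preimage of an open set is locally the pullback of a section. -/
lemma exists_local_section (U : (Proj 𝒜).Opens)
    (s : Γ(ProjSpace n, quotientMap φ hk hφ W hinv ⁻¹ᵁ U))
    (hs : ∀ (g : G) (h : quotientMap φ hk hφ W hinv ⁻¹ᵁ U ≤
      projAct g.1 ⁻¹ᵁ quotientMap φ hk hφ W hinv ⁻¹ᵁ U), (projAct g.1).appLE _ _ h s = s)
    (x : ProjectiveSpectrum 𝒜) (hx : x ∈ U) :
    ∃ (V : (Proj 𝒜).Opens) (hVU : V ≤ U) (t : Γ(Proj 𝒜, V)), x ∈ V ∧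
      ∀ (p : ProjectiveSpectrum (homogeneousSubmodule (Fin n) ℂ))
        (hp : ProjectiveSpectrum.comapMulFun φ hφ hk (exists_invariant_notMem φ hk hφ W hinv) p ∈ V),
        Proj.stalkMapMul φ hφ hk (exists_invariant_notMem φ hk hφ W hinv) p
          (Proj.evalAt V _ hp t) =
        Proj.evalAt (ℬ := homogeneousSubmodule (Fin n) ℂ)
          (quotientMap φ hk hφ W hinv ⁻¹ᵁ U) p (hVU hp) s := by
  -- After shrinking to D₊(a), the section is a single fraction b / φ(a)^r upstairs, with an
  -- invariant denominator.
  obtain ⟨m, hm, a, ha, hxa, haU⟩ := Proj.exists_basicOpen_le U x hx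
  have hbij := (ConcreteCategory.isIso_iff_bijective
    (Proj.basicOpenIsoAway (homogeneousSubmodule (Fin n) ℂ) (φ a) (hφ _ _ ha)
      (Nat.mul_pos hk hm)).hom).1 inferInstance
  have hle : Proj.basicOpen (homogeneousSubmodule (Fin n) ℂ) (φ a) ≤
    quotientMap φ hk hφ W hinv ⁻¹ᵁ U := fun p hp => haU hp
  obtain ⟨β, hβ⟩ := hbij.2 ((ProjSpace n).presheaf.map (homOfLE hle).op s)
  rw [Proj.basicOpenIsoAway_hom] at hβ
  obtain ⟨r, b, hb, rfl⟩ := Away.mk_surjective _ (hφ _ _ ha) β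
  have heval : ∀ (p : ProjectiveSpectrum (homogeneousSubmodule (Fin n) ℂ))
      (hp : φ a ∉ p.asHomogeneousIdeal),
      (Proj.evalAt (ℬ := homogeneousSubmodule (Fin n) ℂ)
          (quotientMap φ hk hφ W hinv ⁻¹ᵁ U) p (hle hp) s).val =
        Localization.mk b (⟨φ a ^ r, fun h => hp (p.isPrime.mem_of_pow_mem _ h)⟩ :
          p.asHomogeneousIdeal.toIdeal.primeCompl) := by
    intro p hp
    rw [← Proj.evalAt_awayToSection (hφ _ _ ha) r b hb p hp]
    exact congrArg (fun s' => (Proj.evalAt (ℬ := homogeneousSubmodule (Fin n) ℂ)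
      (Proj.basicOpen (homogeneousSubmodule (Fin n) ℂ) (φ a)) p hp s').val) hβ.symm
  obtain ⟨y, rfl⟩ := (isQuotientMap_quotientMap φ hk hφ hinj W hinv).surjective x
  have hya : φ a ∉ ProjectiveSpectrum.asHomogeneousIdeal
    (y : ProjectiveSpectrum (homogeneousSubmodule (Fin n) ℂ)) := hxa
  -- The invariance of s is compared at the single point y. Localizations of a domain lose nothing,
  -- so equality of the germs of b / φ(a)^r and its transform already forces equality of the
  -- numerators.
  have hbinv : ∀ g ∈ G, subst g b = b := by
    intro g hg
    have h : quotientMap φ hk hφ W hinv ⁻¹ᵁ U ≤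
        projAct g ⁻¹ᵁ quotientMap φ hk hφ W hinv ⁻¹ᵁ U := by
      intro p hp
      change quotientMap φ hk hφ W hinv (projAct g p) ∈ U
      rw [← Scheme.Hom.comp_apply, projAct_comp_quotientMap φ hk hφ W hinv G hGW hg]
      exact hp
    have hga : subst g (φ a) = φ a := (hinv (φ a)).1 ⟨a, rfl⟩ g (hGW hg)
    have hgy : φ a ∉ ProjectiveSpectrum.asHomogeneousIdeal
        (projAct g y : ProjectiveSpectrum (homogeneousSubmodule (Fin n) ℂ)) := by
      rw [projAct_apply_mem, hga]
      exact hya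
    have e := congrArg HomogeneousLocalization.val (congrArg (Proj.evalAt
      (ℬ := homogeneousSubmodule (Fin n) ℂ) _ y (hle hya)) (hs ⟨g, hg⟩ h))
    replace e := e.trans (heval y hya)
    let y' : ProjectiveSpectrum (homogeneousSubmodule (Fin n) ℂ) := y
    let gy : ProjectiveSpectrum (homogeneousSubmodule (Fin n) ℂ) := projAct g y
    have := y'.isPrime
    have := gy.isPrime
    have hIJ : gy.asHomogeneousIdeal.toIdeal =
        y'.asHomogeneousIdeal.toIdeal.comap (substGraded g) := rfl
    have e2 := val_localRingHom (f := substGraded g) (I := gy.asHomogeneousIdeal.toIdeal)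
      (J := y'.asHomogeneousIdeal.toIdeal) (hIJ := hIJ) (Proj.evalAt
        (ℬ := homogeneousSubmodule (Fin n) ℂ) (quotientMap φ hk hφ W hinv ⁻¹ᵁ U) gy (hle hgy) s)
    replace e2 := e2.symm.trans e
    rw [heval gy hgy] at e2
    replace e2 := (Localization.localRingHom_mk _ _ _ hIJ _ _).symm.trans e2
    rw [Localization.mk_eq_mk_iff, Localization.r_iff_exists] at e2
    obtain ⟨c, hc⟩ := e2
    have h0 : (φ a) ^ r ≠ 0 := fun h0 => hya (by
      rw [eq_zero_of_pow_eq_zero h0]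
      exact zero_mem _)
    have hc0 : (c : MvPolynomial (Fin n) ℂ) ≠ 0 := fun h0 => c.2 (by
      rw [h0]
      exact zero_mem _)
    have hc' := mul_left_cancel₀ hc0 hc
    change φ a ^ r * subst g b = subst g (φ a ^ r) * b at hc'
    rw [map_pow, hga] at hc'
    exact mul_left_cancel₀ h0 hc'
  -- The degree of b is r times that of φ(a), hence divisible by k, so b descends although it is
  -- only known to be G-invariant.
  obtain ⟨a', ha', rfl⟩ := mem_range_of_invariant φ hk hφ hinj W hinv G hW (m := r • m) (p := b)
    (by rw [smul_eq_mul, mul_left_comm]; exact hb) hbinv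
  refine ⟨Proj.basicOpen 𝒜 a, haU, Proj.awayToSection 𝒜 a (Away.mk 𝒜 ha r a' ha'), hxa,
    fun p hp => ?_⟩
  apply val_injective
  rw [heval p hp, val_localMapMul, Proj.evalAt_awayToSection ha r a' ha' _ hp,
    Localization.localRingHom_mk]
  congr 1
  ext
  simp

omit [Finite W] in
lemma appLE_app_of_comp_eq {X Y : Scheme} {f : X ⟶ X} {π : X ⟶ Y} (e : f ≫ π = π) (U : Y.Opens)
    (h : π ⁻¹ᵁ U ≤ f ⁻¹ᵁ π ⁻¹ᵁ U) (t : Γ(Y, U)) : f.appLE _ _ h (π.app U t) = π.app U t := by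
  have key : ∀ π' : X ⟶ Y, π' = π → ∀ h', π'.appLE U (π ⁻¹ᵁ U) h' = π.app U := by
    rintro _ rfl h'
    exact Scheme.Hom.appLE_eq_app _
  have h1 := (Scheme.Hom.comp_appLE f π U (π ⁻¹ᵁ U) h).symm.trans (key _ e h)
  exact ConcreteCategory.congr_hom h1 t

include hinj hGW hW in
theorem isGeometricQuotient_quotientMap :
    IsGeometricQuotient (fun g : G => projAct g.1) (quotientMap φ hk hφ W hinv) where
  invariant g := projAct_comp_quotientMap φ hk hφ W hinv G hGW g.2
  isQuotientMap := isQuotientMap_quotientMap φ hk hφ hinj W hinv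
  orbits := quotientMap_eq_iff φ hk hφ W hinv G hGW hW
  injective := quotientMap_app_injective φ hk hφ hinj W hinv
  range U s := by
    constructor
    · rintro ⟨t, rfl⟩ g h
      exact appLE_app_of_comp_eq (projAct_comp_quotientMap φ hk hφ W hinv G hGW g.2) U h t
    · intro hs
      choose V hVU t hxV ht using fun x : U =>
        exists_local_section φ hk hφ hinj W hinv G hGW hW U s hs x.1 x.2
      have hsurj := (isQuotientMap_quotientMap φ hk hφ hinj W hinv).surjective
      -- The local descents agree on overlaps because they have the same pullback and pullback is
      -- injective on stalks.
      obtain ⟨t₀, ht₀, -⟩ := (Proj 𝒜).sheaf.existsUnique_gluing' V U (fun x => homOfLE (hVU x))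
        (fun x hx => Opens.mem_iSup.2 ⟨⟨x, hx⟩, hxV ⟨x, hx⟩⟩) t (fun i j => by
          refine Proj.section_ext (V i ⊓ V j) _ _ fun q hq => ?_
          obtain ⟨p, rfl⟩ := hsurj q
          exact Proj.stalkMapMul_injective φ hφ hk _ hinj p
            ((ht i p hq.1).trans (ht j p hq.2).symm))
      refine ⟨t₀, Proj.section_ext (quotientMap φ hk hφ W hinv ⁻¹ᵁ U) _ _ fun p hp => ?_⟩
      have h1 := ht ⟨_, hp⟩ p (hxV ⟨_, hp⟩)
      rw [← ht₀ ⟨_, hp⟩] at h1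
      exact h1

end Quotient

end QuotG25920

end

/-! ### Weighted projective spaces: dense charts and rescaling of weights -/

noncomputable section

open CategoryTheory AlgebraicGeometry MvPolynomial
open HomogeneousLocalization TopologicalSpace

universe u

namespace AlgebraicGeometry.Proj

variable {A : Type u} [CommRing A] [IsDomain A] {σ : Type u} [SetLike σ A] [AddSubgroupClass σ A]
  (𝒜 : ℕ → σ) [GradedRing 𝒜]

/-- A nonempty principal open subset of `Proj` of a graded domain is dense. -/
lemma dense_basicOpen {m : ℕ} (hm : 0 < m) {a : A} (ha : a ∈ 𝒜 m) (h0 : a ≠ 0) :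
    Dense (basicOpen 𝒜 a : Set (Proj 𝒜)) := by
  let η : ProjectiveSpectrum 𝒜 := ⟨⊥, Ideal.isPrime_bot, fun h =>
    h0 (h (HomogeneousIdeal.mem_irrelevant_of_mem _ hm ha))⟩
  intro x
  rw [mem_closure_iff]
  intro U hU hx
  obtain ⟨m', -, a', -, hxa, hle⟩ := exists_basicOpen_le (𝒜 := 𝒜) ⟨U, hU⟩ x hx
  refine ⟨η, hle (fun h => hxa ?_), h0⟩
  have : a' = 0 := h
  rw [this]
  exact zero_mem _

end AlgebraicGeometry.Proj

namespace QuotG25920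

lemma exists_X_notMem {n : ℕ} {a : Fin n → ℕ}
    (p : ProjectiveSpectrum (weightedHomogeneousSubmodule ℂ a)) :
    ∃ i, (X i : MvPolynomial (Fin n) ℂ) ∉ p.asHomogeneousIdeal := by
  by_contra! h
  refine p.not_irrelevant_le ((HomogeneousIdeal.toIdeal_irrelevant_le _).2 fun m hm b hb => ?_)
  rw [← SetLike.mem_coe]
  have hb' : IsWeightedHomogeneous a b m := hb
  rw [b.as_sum]
  refine Ideal.sum_mem _ fun d hd => ?_
  have hdm := hb' (mem_support_iff.1 hd)
  have hd0 : d ≠ 0 := by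
    rintro rfl
    simp at hdm
    omega
  obtain ⟨i, hi⟩ := Finsupp.ne_iff.1 hd0
  have : monomial d (coeff d b) = X i * monomial (d - Finsupp.single i 1) (coeff d b) := by
    rw [X, monomial_mul, one_mul, add_tsub_cancel_of_le]
    rw [Finsupp.single_le_iff]
    exact Nat.one_le_iff_ne_zero.2 hi
  rw [this]
  exact Ideal.mul_mem_right _ _ (h i)

/-- Multiplying all weights by a positive integer does not change a weighted projective space. -/
theorem exists_weightedProj_iso {n k : ℕ} (hk : 0 < k) {a b : Fin n → ℕ} (ha : ∀ i, 0 < a i)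
    (hb : ∀ i, b i = k * a i) :
    ∃ e : WeightedProj a ≅ WeightedProj b, e.hom ≫ WeightedProj.str b = WeightedProj.str a := by
  have hw : ∀ d : Fin n →₀ ℕ, Finsupp.weight b d = k * Finsupp.weight a d := by
    intro d
    rw [Finsupp.weight_apply, Finsupp.weight_apply, Finsupp.sum, Finsupp.sum, Finset.mul_sum]
    refine Finset.sum_congr rfl fun i _ => ?_
    rw [hb]
    simp only [smul_eq_mul]
    ring
  have hf : ∀ m, ∀ p ∈ weightedHomogeneousSubmodule ℂ a m,
      RingHom.id (MvPolynomial (Fin n) ℂ) p ∈ weightedHomogeneousSubmodule ℂ b (k * m) := by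
    intro m p hp d hd
    rw [hw, hp hd]
  have hirr : ∀ p : ProjectiveSpectrum (weightedHomogeneousSubmodule ℂ b), ∃ m > 0,
      ∃ q ∈ weightedHomogeneousSubmodule ℂ a m,
        RingHom.id (MvPolynomial (Fin n) ℂ) q ∉ p.asHomogeneousIdeal := by
    intro p
    obtain ⟨i, hi⟩ := exists_X_notMem p
    exact ⟨a i, ha i, X i, isWeightedHomogeneous_X _ _ _, hi⟩
  have hiso : IsIso (Proj.mapMul (RingHom.id _) hf hk hirr) := by
    refine Proj.isIso_mapMul _ hf hk hirr Function.injective_id ?_ ?_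
    · intro m p hp
      refine ⟨p, fun d hd => ?_, rfl⟩
      have := hp hd
      rw [hw] at this
      exact Nat.eq_of_mul_eq_mul_left hk this
    · intro m p hp hp0
      obtain ⟨d, hd⟩ := MvPolynomial.ne_zero_iff.1 hp0
      exact ⟨_, (hp hd).symm.trans (hw d)⟩
  let e : WeightedProj b ≅ WeightedProj a := @asIso _ _ _ _ _ hiso
  refine ⟨e.symm, ?_⟩
  rw [Iso.symm_hom, Iso.inv_comp_eq]
  exact (Proj.mapMul_comp_toSpecZero _ hf hk hirr (algebraMap ℂ _) (algebraMap ℂ _)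
    (fun _ => rfl)).symm

/-! ### Rationality of `ℙ(2, 3, 4, 5)` -/

/-- Setting `x₁ = x₀`. -/
abbrev dehom : MvPolynomial (Fin 4) ℂ →ₐ[ℂ] MvPolynomial (Fin 3) ℂ := rename ![0, 0, 1, 2]

/-- Within one weighted degree no two monomials are identified: the exponent sum d₀ + d₁, the
exponents d₂, d₃ and the degree 2d₀ + 3d₁ + 4d₂ + 5d₃ determine d₀ and d₁. -/
lemma dehom_injOn {m : ℕ} {p : MvPolynomial (Fin 4) ℂ}
    (hp : p.IsWeightedHomogeneous ![2, 3, 4, 5] m) (h : dehom p = 0) : p = 0 := by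
  ext d
  by_contra hd
  rw [coeff_zero] at hd
  have key : coeff (d.mapDomain ![0, 0, 1, 2]) (dehom p) = coeff d p := by
    conv_lhs => rw [p.as_sum]
    simp only [map_sum, rename_monomial, coeff_sum, coeff_monomial]
    rw [Finset.sum_eq_single d]
    · simp
    · intro e he hed
      refine if_neg fun heq => hed ?_
      have h1 := hp hd
      have h2 := hp (mem_support_iff.1 he)
      rw [Finsupp.weight_apply, Finsupp.sum_fintype _ _ (by simp)] at h1 h2
      have hmap : ∀ d : Fin 4 →₀ ℕ, d.mapDomain ![0, 0, 1, 2] (0 : Fin 3) = d 0 + d 1 ∧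
          d.mapDomain ![0, 0, 1, 2] (1 : Fin 3) = d 2 ∧
          d.mapDomain ![0, 0, 1, 2] (2 : Fin 3) = d 3 := by
        intro d
        rw [Finsupp.mapDomain, Finsupp.sum_fintype _ _ (by simp)]
        simp [Fin.sum_univ_four]
      have h3 := hmap d
      rw [← heq, (hmap e).1, (hmap e).2.1, (hmap e).2.2] at h3
      simp [Fin.sum_univ_four] at h1 h2
      ext i
      fin_cases i <;> simp <;> omega
    · intro hd'
      exact absurd (mem_support_iff.2 hd) hd'
  rw [h, coeff_zero] at key
  exact hd key.symm

/-- The coordinate ring of an affine open subset of `ℙ(2, 3, 4, 5)`. -/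
abbrev chartRing : Type :=
  Away (weightedHomogeneousSubmodule ℂ ![2, 3, 4, 5]) (X 0 * X 1 : MvPolynomial (Fin 4) ℂ)

abbrev LocU : Type := Localization.Away (X 0 : MvPolynomial (Fin 3) ℂ)

lemma algebraMap_LocU_injective :
    Function.Injective (algebraMap (MvPolynomial (Fin 3) ℂ) LocU) :=
  IsLocalization.injective LocU (powers_le_nonZeroDivisors_of_noZeroDivisors (X_ne_zero 0))

/-- Setting `x₁ = x₀` and inverting `x₀`. -/
def dehomLoc : MvPolynomial (Fin 4) ℂ →+* LocU :=
  (algebraMap (MvPolynomial (Fin 3) ℂ) LocU).comp (dehom : MvPolynomial (Fin 4) ℂ →+* _)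

lemma dehomLoc_X_mul_X : dehomLoc (X 0 * X 1) =
    algebraMap (MvPolynomial (Fin 3) ℂ) LocU (X 0) ^ 2 := by
  simp [dehomLoc, dehom, sq]

lemma isUnit_dehomLoc : IsUnit (dehomLoc (X 0 * X 1)) := by
  rw [dehomLoc_X_mul_X]
  exact (IsLocalization.Away.algebraMap_isUnit (S := LocU) (X 0 : MvPolynomial (Fin 3) ℂ)).pow 2

/-- Restriction to the slice x₀ = x₁ = u. Where x₀x₁ ≠ 0, scaling by t turns (x₀, x₁) into (t²x₀,
t³x₁), whose entries are equal for exactly one t ≠ 0; this is why the restriction is an isomorphism.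
-/
def chartMap : chartRing →+* LocU :=
  (IsLocalization.Away.lift (S := Localization.Away (X 0 * X 1 : MvPolynomial (Fin 4) ℂ))
    (g := dehomLoc) (X 0 * X 1 : MvPolynomial (Fin 4) ℂ) isUnit_dehomLoc).comp
      (algebraMap chartRing _)

lemma X_mul_X_mem : (X 0 * X 1 : MvPolynomial (Fin 4) ℂ) ∈
    weightedHomogeneousSubmodule ℂ ![2, 3, 4, 5] 5 := by
  simpa using (isWeightedHomogeneous_X ℂ ![2, 3, 4, 5] 0).mul
    (isWeightedHomogeneous_X ℂ ![2, 3, 4, 5] 1)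

lemma chartMap_mk (r : ℕ) (p : MvPolynomial (Fin 4) ℂ)
    (hp : p ∈ weightedHomogeneousSubmodule ℂ ![2, 3, 4, 5] (r • 5)) :
    chartMap (Away.mk _ X_mul_X_mem r p hp) * algebraMap (MvPolynomial (Fin 3) ℂ) LocU (X 0) ^ (2 * r) =
      algebraMap _ LocU (dehom p) := by
  have h1 : algebraMap (MvPolynomial (Fin 3) ℂ) LocU (X 0) ^ (2 * r) =
      (IsLocalization.Away.lift (S := Localization.Away (X 0 * X 1 : MvPolynomial (Fin 4) ℂ))
        (g := dehomLoc) (X 0 * X 1 : MvPolynomial (Fin 4) ℂ) isUnit_dehomLoc)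
          (algebraMap (MvPolynomial (Fin 4) ℂ) _ ((X 0 * X 1) ^ r)) := by
    rw [IsLocalization.Away.lift_eq, map_pow, dehomLoc_X_mul_X, pow_mul]
  rw [h1, chartMap, RingHom.comp_apply, ← map_mul]
  have h2 : algebraMap chartRing (Localization.Away (X 0 * X 1 : MvPolynomial (Fin 4) ℂ))
      (Away.mk _ X_mul_X_mem r p hp) *
        algebraMap (MvPolynomial (Fin 4) ℂ) _ ((X 0 * X 1) ^ r) =
          algebraMap (MvPolynomial (Fin 4) ℂ) _ p := by
    rw [HomogeneousLocalization.algebraMap_apply, Away.val_mk, Localization.mk_eq_mk',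
      IsLocalization.mk'_spec]
  rw [h2, IsLocalization.Away.lift_eq]
  rfl

lemma chartMap_injective : Function.Injective chartMap := by
  rw [injective_iff_map_eq_zero]
  intro z hz
  obtain ⟨r, p, hp, rfl⟩ := Away.mk_surjective _ X_mul_X_mem z
  have h := chartMap_mk r p hp
  rw [hz, zero_mul] at h
  have hp0 := dehom_injOn hp (algebraMap_LocU_injective (h.symm.trans (map_zero _).symm))
  subst hp0
  apply val_injective
  rw [Away.val_mk, Localization.mk_zero, val_zero]

lemma mem_range_chartMap (r : ℕ) (p : MvPolynomial (Fin 4) ℂ)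
    (hp : p ∈ weightedHomogeneousSubmodule ℂ ![2, 3, 4, 5] (r • 5)) (z : LocU)
    (h : z * algebraMap (MvPolynomial (Fin 3) ℂ) LocU (X 0) ^ (2 * r) =
      algebraMap _ LocU (dehom p)) : z ∈ chartMap.range := by
  refine ⟨Away.mk _ X_mul_X_mem r p hp, ?_⟩
  have hu := (IsLocalization.Away.algebraMap_isUnit (S := LocU)
    (X 0 : MvPolynomial (Fin 3) ℂ)).pow (2 * r)
  exact hu.mul_right_cancel ((chartMap_mk r p hp).trans h.symm)

lemma chartMap_surjective : Function.Surjective chartMap := by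
  rw [← RingHom.range_eq_top, eq_top_iff]
  rintro z -
  have hX := fun i => isWeightedHomogeneous_X ℂ ![2, 3, 4, 5] i
  have h1 : ∀ i : Fin 3, algebraMap (MvPolynomial (Fin 3) ℂ) LocU (X i) ∈ chartMap.range := by
    intro i
    fin_cases i
    -- Degree zero fractions restricting to the coordinates: u is x₀⁵/(x₀x₁)², v is x₂x₀⁸/(x₀x₁)⁴, w
    -- is x₃x₀¹⁰/(x₀x₁)⁵. Below, u⁻¹ is x₁⁵/(x₀x₁)³.
    · refine mem_range_chartMap 2 (X 0 ^ 5) (by simpa using (hX 0).pow 5) _ ?_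
      simp [dehom]
      ring
    · refine mem_range_chartMap 4 (X 2 * X 0 ^ 8) (by simpa using (hX 2).mul ((hX 0).pow 8)) _ ?_
      simp [dehom]
    · refine mem_range_chartMap 5 (X 3 * X 0 ^ 10) (by simpa using (hX 3).mul ((hX 0).pow 10)) _ ?_
      simp [dehom]
  have h2 : IsLocalization.Away.invSelf (S := LocU) (X 0 : MvPolynomial (Fin 3) ℂ) ∈
      chartMap.range := by
    refine mem_range_chartMap 3 (X 1 ^ 5) (by simpa using (hX 1).pow 5) _ ?_
    have := IsLocalization.Away.mul_invSelf (S := LocU) (X 0 : MvPolynomial (Fin 3) ℂ)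
    simp [dehom]
    linear_combination (algebraMap (MvPolynomial (Fin 3) ℂ) LocU (X 0)) ^ 5 * this
  have h3 : ∀ q, algebraMap (MvPolynomial (Fin 3) ℂ) LocU q ∈ chartMap.range := by
    intro q
    induction q using MvPolynomial.induction_on with
    | C c =>
      refine mem_range_chartMap 0 (C c) (by simpa using isWeightedHomogeneous_C _ _) _ ?_
      simp [dehom]
    | add p q hp hq =>
      rw [map_add]
      exact add_mem hp hq
    | mul_X p i hp =>
      rw [map_mul]
      exact mul_mem hp (h1 i)
  obtain ⟨m, q, hq⟩ := IsLocalization.Away.surj (S := LocU) (X 0 : MvPolynomial (Fin 3) ℂ) z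
  have : z = algebraMap _ _ q *
      (IsLocalization.Away.invSelf (S := LocU) (X 0 : MvPolynomial (Fin 3) ℂ)) ^ m := by
    rw [← hq, mul_assoc, ← mul_pow, IsLocalization.Away.mul_invSelf, one_pow, mul_one]
  rw [this]
  exact mul_mem (h3 q) (pow_mem h2 m)

/-- The spectrum of `chartRing` ≅ ℂ[u, v, w]ᵤ is a dense open subscheme of both sides, compatibly
with the structure morphisms. -/
theorem birationalOver_weightedProj :
    AlgebraicGeometry.Scheme.BirationalOver (WeightedProj.str ![2, 3, 4, 5])
      (AffineSpace (Fin 3) SpecC ↘ SpecC) := by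
  let ι₁ : Spec (.of chartRing) ⟶ WeightedProj ![2, 3, 4, 5] :=
    Proj.awayι (weightedHomogeneousSubmodule ℂ ![2, 3, 4, 5]) (X 0 * X 1) X_mul_X_mem (by norm_num)
  have h1 : IsOpenImmersion ι₁ := inferInstanceAs (IsOpenImmersion (Proj.awayι _ _ _ _))
  have h2 : IsDominant ι₁ := ⟨by
    have := Proj.dense_basicOpen (weightedHomogeneousSubmodule ℂ ![2, 3, 4, 5])
      (by norm_num : 0 < 5) X_mul_X_mem (mul_ne_zero (X_ne_zero _) (X_ne_zero _))
    rw [← Proj.opensRange_awayι _ _ X_mul_X_mem (by norm_num)] at this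
    exact this⟩
  let e : chartRing ≃+* LocU := RingEquiv.ofBijective chartMap
    ⟨chartMap_injective, chartMap_surjective⟩
  let ι₂ : Spec (.of chartRing) ⟶ AffineSpace (Fin 3) SpecC :=
    (Scheme.Spec.mapIso e.symm.toCommRingCatIso.op).hom ≫
      Spec.map (CommRingCat.ofHom (algebraMap (MvPolynomial (Fin 3) ℂ) LocU)) ≫
      (AffineSpace.SpecIso (Fin 3) (.of ℂ)).inv
  have h3 : IsOpenImmersion ι₂ := inferInstanceAs (IsOpenImmersion (_ ≫ _ ≫ _))
  have : Nontrivial LocU := algebraMap_LocU_injective.nontrivial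
  have : Nontrivial chartRing := e.symm.injective.nontrivial
  have h4 : IsDominant ι₂ := by
    have : Nonempty (Spec (.of chartRing)) := inferInstance
    exact ⟨ι₂.isOpenEmbedding.isOpen_range.dense (Set.range_nonempty _)⟩
  refine (ι₁.birationalOver _ _ rfl).symm.trans (ι₂.birationalOver _ _ ?_)
  change (Spec.map _ ≫ Spec.map _ ≫ _) ≫ _ = Proj.awayι _ _ _ _ ≫ Proj.toSpecZero _ ≫ Spec.map _
  rw [Proj.awayι_toSpecZero_assoc, Category.assoc, Category.assoc, AffineSpace.SpecIso_inv_over,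
    ← Spec.map_comp, ← Spec.map_comp, ← Spec.map_comp]
  refine congrArg Spec.map (ConcreteCategory.hom_ext _ _ fun c => e.injective ?_)
  change e (e.symm _) = chartMap _
  rw [e.apply_symm_apply]
  have h5 := chartMap_mk 0 (C c) (by simpa using isWeightedHomogeneous_C _ _)
  rw [mul_zero, pow_zero, mul_one, dehom, rename_C] at h5
  refine h5.symm.trans (congrArg chartMap ?_)
  apply val_injective
  rw [Away.val_mk]
  change _ = Localization.mk (C c) 1
  congr 1

end QuotG25920

end

/-! ### Growth of linearly independent families of polynomials -/

noncomputable section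

open CategoryTheory AlgebraicGeometry MvPolynomial

namespace QuotG25920

section Growth

variable {n : ℕ}

/-- The exponents of the monomials of weighted degree at most `N`. -/
def box (w : Fin n → ℕ) (N : ℕ) : Finset (Fin n → ℕ) :=
  {a ∈ Fintype.piFinset fun _ => Finset.range (N + 1) | ∑ i, a i * w i ≤ N}

lemma mem_box {w : Fin n → ℕ} (hw : ∀ i, 0 < w i) {N : ℕ} {a : Fin n → ℕ} :
    a ∈ box w N ↔ ∑ i, a i * w i ≤ N := by
  simp only [box, Finset.mem_filter, Fintype.mem_piFinset, Finset.mem_range, and_iff_right_iff_imp]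
  intro h i
  have h1 := Finset.single_le_sum (f := fun i => a i * w i) (fun _ _ => Nat.zero_le _)
    (Finset.mem_univ i)
  have h2 := Nat.le_mul_of_pos_right (a i) (hw i)
  omega

lemma card_box_le (w : Fin n → ℕ) (N : ℕ) : (box w N).card ≤ (N + 1) ^ n := by
  refine (Finset.card_filter_le _ _).trans ?_
  simp

/-- Dividing each exponent by its weight with remainder maps one box to the other. A fibre is
determined by the remainders, of which there are ∏ wᵢ choices. -/
lemma card_box_one_le {w : Fin n → ℕ} (hw : ∀ i, 0 < w i) (N : ℕ) :
    (box (1 : Fin n → ℕ) N).card ≤ (∏ i, w i) * (box w N).card := by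
  refine Finset.card_le_mul_card_image_of_maps_to (f := fun a i => a i / w i) ?_ _ ?_
  · intro a ha
    rw [mem_box (by simp)] at ha
    rw [mem_box hw]
    refine le_trans (Finset.sum_le_sum fun i _ => ?_) ha
    simpa using Nat.div_mul_le_self (a i) (w i)
  · intro b _
    have : ∏ i, w i = (Fintype.piFinset fun i => Finset.range (w i)).card := by simp
    rw [this]
    refine Finset.card_le_card_of_injOn (fun a i => a i % w i) ?_ ?_
    · intro a _
      simp only [Finset.mem_coe, Fintype.mem_piFinset, Finset.mem_range]
      exact fun i => Nat.mod_lt _ (hw i)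
    · intro a ha a' ha' h
      simp only [Finset.coe_filter, Set.mem_ofPred_eq] at ha ha'
      funext i
      rw [← Nat.div_add_mod (a i) (w i), ← Nat.div_add_mod (a' i) (w i)]
      have h1 : a i % w i = a' i % w i := congrFun h i
      have h2 : a i / w i = a' i / w i := congrFun (ha.2.trans ha'.2.symm) i
      rw [h1, h2]

lemma card_le_card_box {ι : Type*} {v : ι → MvPolynomial (Fin n) ℂ} (hv : LinearIndependent ℂ v)
    (F : Finset ι) (M : ℕ) (h : ∀ i ∈ F, (v i).totalDegree ≤ M) : F.card ≤ (box (1 : Fin n → ℕ) M).card := by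
  have h1 : LinearIndependent ℂ (fun i : F => (⟨v i, (mem_restrictTotalDegree _ _ _).2
      (h i i.2)⟩ : restrictTotalDegree (Fin n) ℂ M)) := by
    refine LinearIndependent.of_comp (restrictTotalDegree (Fin n) ℂ M).subtype ?_
    exact hv.comp _ Subtype.val_injective
  have h2 := h1.fintype_card_le_finrank
  rw [Fintype.card_coe] at h2
  refine h2.trans ?_
  have h3 : Module.finrank ℂ (restrictTotalDegree (Fin n) ℂ M) =
      Nat.card {d : Fin n →₀ ℕ | (d.sum fun _ e => e) ≤ M} :=
    Module.finrank_eq_nat_card_basis (basisRestrictSupport ℂ _)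
  have h4 : (box (1 : Fin n → ℕ) M).card = Nat.card (box (1 : Fin n → ℕ) M) := by simp
  rw [h3, h4]
  refine Nat.card_le_card_of_injective (fun d => ⟨d.1, ?_⟩) ?_
  · rw [mem_box (by simp)]
    have := d.2
    rw [Set.mem_ofPred_eq, Finsupp.sum_fintype _ _ (by simp)] at this
    simpa using this
  · intro d d' hdd
    exact Subtype.ext (DFunLike.coe_injective (Subtype.ext_iff.1 hdd))

/-- A linearly independent family of polynomials in `n` variables cannot grow faster than the
family of all monomials. -/
theorem sum_inv_prod_le_one {κ : Type*} [Fintype κ] (w : κ → Fin n → ℕ) (hw : ∀ k i, 0 < w k i)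
    (v : κ × (Fin n →₀ ℕ) → MvPolynomial (Fin n) ℂ) (hv : LinearIndependent ℂ v) (c : ℕ)
    (hdeg : ∀ k a, (v (k, a)).totalDegree ≤ ∑ i, a i * w k i + c) :
    ∑ k, (1 : ℝ) / ∏ i, (w k i : ℝ) ≤ 1 := by
  classical
  by_contra! hr
  set r := ∑ k, (1 : ℝ) / ∏ i, (w k i : ℝ)
  have hprod : ∀ k, (0 : ℝ) < ∏ i, (w k i : ℝ) :=
    fun k => Finset.prod_pos fun i _ => by exact_mod_cast hw k i
  let g : ℕ → ℝ := fun N => ((box (1 : Fin n → ℕ) N).card : ℝ)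
  -- The members of the family with weighted exponent degree at most N number at least r · g(N) and
  -- have degree at most N + c; independence bounds their number by g(N + c).
  have h1 : ∀ N, r * g N ≤ g (N + c) := by
    intro N
    let e : (Fin n → ℕ) ≃ (Fin n →₀ ℕ) := Finsupp.equivFunOnFinite.symm
    let F : Finset (κ × (Fin n →₀ ℕ)) := Finset.univ.biUnion fun k =>
      (box (w k) N).image fun a => (k, e a)
    have hF : F.card = ∑ k, (box (w k) N).card := by
      rw [Finset.card_biUnion]
      · refine Finset.sum_congr rfl fun k _ => Finset.card_image_of_injective _ ?_
        intro a a' h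
        exact e.injective (Prod.ext_iff.1 h).2
      · intro k _ k' _ hkk
        rw [Function.onFun, Finset.disjoint_left]
        intro x hx hx'
        obtain ⟨a, -, rfl⟩ := Finset.mem_image.1 hx
        obtain ⟨a', -, h⟩ := Finset.mem_image.1 hx'
        exact hkk (Prod.ext_iff.1 h).1.symm
    have h2 := card_le_card_box hv F (N + c) (by
      intro i hi
      obtain ⟨k, -, hk⟩ := Finset.mem_biUnion.1 hi
      obtain ⟨a, ha, rfl⟩ := Finset.mem_image.1 hk
      rw [mem_box (hw k)] at ha
      exact (hdeg k (e a)).trans (Nat.add_le_add_right ha c))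
    rw [hF] at h2
    calc r * g N = ∑ k, 1 / (∏ i, (w k i : ℝ)) * g N := Finset.sum_mul _ _ _
      _ ≤ ∑ k, ((box (w k) N).card : ℝ) := by
        refine Finset.sum_le_sum fun k _ => ?_
        rw [one_div_mul_eq_div, div_le_iff₀ (hprod k), mul_comm]
        have := card_box_one_le (hw k) N
        simp only [g]
        exact_mod_cast this
      _ ≤ g (N + c) := by
        simp only [g]
        exact_mod_cast h2
  have h3 : ∀ m : ℕ, r ^ m ≤ g (m * c) := by
    intro m
    induction m with
    | zero =>
      have : 0 < (box (1 : Fin n → ℕ) 0).card :=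
        Finset.card_pos.2 ⟨0, by rw [mem_box (by simp)]; simp⟩
      simp only [pow_zero, zero_mul, g]
      exact_mod_cast this
    | succ m ih =>
      calc r ^ (m + 1) = r * r ^ m := pow_succ' _ _
        _ ≤ r * g (m * c) := by gcongr
        _ ≤ g (m * c + c) := h1 _
        _ = g ((m + 1) * c) := by rw [add_mul, one_mul]
  -- If r > 1, the exponential lower bound rᵐ for g(mc) contradicts the polynomial bound (mc + 1)ⁿ ≤
  -- (m(c + 1))ⁿ.
  have h4 := (tendsto_pow_const_div_const_pow_of_one_lt n hr).eventually_lt_const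
    (u := 1 / ((c : ℝ) + 1) ^ n) (by positivity)
  obtain ⟨m, hm, hm1⟩ := (h4.and (Filter.eventually_ge_atTop 1)).exists
  rw [div_lt_div_iff₀ (by positivity) (by positivity), one_mul, ← mul_pow] at hm
  refine absurd hm (not_lt.2 ((h3 m).trans ?_))
  have h5 : g (m * c) ≤ ((m * c : ℕ) + 1 : ℝ) ^ n := by
    have := card_box_le (1 : Fin n → ℕ) (m * c)
    simp only [g]
    exact_mod_cast this
  refine h5.trans ?_
  gcongr
  push_cast
  have : (1 : ℝ) ≤ m := by exact_mod_cast hm1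
  linarith

end Growth

/-! ### The Jacobian criterion -/

section Jacobian

variable {n : ℕ}

lemma pderiv_aeval (f : Fin n → MvPolynomial (Fin n) ℂ) (j : Fin n) (P : MvPolynomial (Fin n) ℂ) :
    pderiv j (aeval f P) = ∑ i, aeval f (pderiv i P) * pderiv j (f i) := by
  induction P using MvPolynomial.induction_on with
  | C c => simp [algebraMap_eq]
  | add p q hp hq => simp only [map_add, hp, hq, add_mul, Finset.sum_add_distrib]
  | mul_X p i hp =>
    simp only [map_mul, aeval_X, Derivation.leibniz, hp, smul_eq_mul, map_add, add_mul,
      Finset.sum_add_distrib, pderiv_X]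
    congr 1
    · simp [Pi.single_apply, Finset.sum_ite_eq]
    · rw [Finset.mul_sum]
      exact Finset.sum_congr rfl fun _ _ => by ring

lemma totalDegree_pderiv_lt {i : Fin n} {P : MvPolynomial (Fin n) ℂ} (h : pderiv i P ≠ 0) :
    (pderiv i P).totalDegree < P.totalDegree := by
  have key : ∀ m ∈ (pderiv i P).support, (m.sum fun _ e => e) + 1 ≤ P.totalDegree := by
    intro m hm
    rw [mem_support_iff, coeff_pderiv] at hm
    have := le_totalDegree (mem_support_iff.2 (left_ne_zero_of_mul hm))
    rwa [Finsupp.sum_add_index' (fun _ => rfl) (fun _ _ _ => rfl),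
      Finsupp.sum_single_index rfl] at this
  obtain ⟨m, hm⟩ := MvPolynomial.ne_zero_iff.1 h
  have h0 := key m (mem_support_iff.2 hm)
  exact (Finset.sup_lt_iff (by simp only [Nat.bot_eq_zero]; omega)).2 fun m hm => key m hm

lemma eq_C_of_pderiv_eq_zero {P : MvPolynomial (Fin n) ℂ} (h : ∀ i, pderiv i P = 0) :
    P = C (coeff 0 P) := by
  ext d
  rw [coeff_C]
  split_ifs with hd
  · rw [hd]
  · obtain ⟨i, hi⟩ := Finsupp.ne_iff.1 (Ne.symm hd)
    have h1 := coeff_pderiv (i := i) P (d - Finsupp.single i 1)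
    rw [h i, coeff_zero, tsub_add_cancel_of_le
      (Finsupp.single_le_iff.2 (Nat.one_le_iff_ne_zero.2 hi))] at h1
    refine (mul_eq_zero.1 h1.symm).resolve_right ?_
    exact Nat.cast_add_one_ne_zero _

/-- The Jacobian criterion for algebraic independence. -/
theorem algebraicIndependent_of_jacobian (f : Fin n → MvPolynomial (Fin n) ℂ)
    (h : (Matrix.of fun i j => pderiv j (f i)).det ≠ 0) : AlgebraicIndependent ℂ f := by
  rw [algebraicIndependent_iff]
  intro P hP
  -- The chain rule and the invertibility of the Jacobian matrix over the fraction field turn a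
  -- relation P into the relations ∂ᵢP of smaller degree. By induction these vanish, so P is
  -- constant, hence zero.
  induction hd : P.totalDegree using Nat.strong_induction_on generalizing P with
  | _ d ih =>
    have h1 : ∀ i, aeval f (pderiv i P) = 0 := by
      have h2 : Matrix.vecMul (fun i => aeval f (pderiv i P)) (Matrix.of fun i j => pderiv j (f i)) = 0 := by
        funext j
        have := pderiv_aeval f j P
        rw [hP, map_zero] at this
        exact this.symm
      exact congrFun (Matrix.eq_zero_of_vecMul_eq_zero h h2)
    have h3 : ∀ i, pderiv i P = 0 := by
      intro i
      by_contra h4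
      exact h4 (ih _ (hd ▸ totalDegree_pderiv_lt h4) _ (h1 i) rfl)
    have h5 := eq_C_of_pderiv_eq_zero h3
    rw [h5, aeval_C] at hP
    have h6 : coeff 0 P = 0 := (FaithfulSMul.algebraMap_injective ℂ (MvPolynomial (Fin n) ℂ))
      (hP.trans (map_zero _).symm)
    rw [h5, h6, C_0]

end Jacobian

end QuotG25920

end

/-! ### Invariants of a finite group: counting and generation -/

noncomputable section

open CategoryTheory AlgebraicGeometry MvPolynomial

namespace QuotG25920

variable {n : ℕ} (W : Subgroup (GL (Fin n) ℂ))

/-- The algebra of invariant polynomials. -/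
def invariantSubalgebra : Subalgebra ℂ (MvPolynomial (Fin n) ℂ) where
  carrier := {p | ∀ w ∈ W, subst w p = p}
  mul_mem' hp hq w hw := by rw [map_mul, hp w hw, hq w hw]
  add_mem' hp hq w hw := by rw [map_add, hp w hw, hq w hw]
  algebraMap_mem' c w _ := (subst w).commutes c

/-- The forms fixed by a given w ≠ 1 make up a proper subspace, and ℂⁿ is not a finite union of
proper subspaces. -/
lemma exists_linearForm [Finite W] : ∃ l : MvPolynomial (Fin n) ℂ, l.totalDegree ≤ 1 ∧
    ∀ w ∈ W, subst w l = l → w = 1 := by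
  classical
  have : Fintype W := Fintype.ofFinite W
  let E : W → Submodule ℂ (Fin n → ℂ) := fun w =>
    LinearMap.ker (Matrix.vecMulLinear ((w : GL (Fin n) ℂ) : Matrix (Fin n) (Fin n) ℂ) - LinearMap.id)
  have hE : ∀ w c, c ∈ E w ↔ Matrix.vecMul c ((w : GL (Fin n) ℂ) : Matrix (Fin n) (Fin n) ℂ) = c := by
    intro w c
    simp [E, sub_eq_zero]
  let s : Finset (Submodule ℂ (Fin n → ℂ)) := (Finset.univ.filter (· ≠ 1)).image E
  have hs : ⊤ ∉ s := by
    intro h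
    obtain ⟨w, hw, hwE⟩ := Finset.mem_image.1 h
    refine (Finset.mem_filter.1 hw).2 (Subtype.ext (Units.ext ?_))
    refine Matrix.ext_of_single_vecMul fun i => ?_
    rw [(hE w _).1 (hwE ▸ Submodule.mem_top)]
    simp
  obtain ⟨c, hc⟩ := (Set.ne_univ_iff_exists_notMem _).1 (Subspace.biUnion_ne_univ_of_top_notMem hs)
  refine ⟨∑ i, C (c i) * X i, ?_, fun w hw h => ?_⟩
  · refine totalDegree_finsetSum_le fun i _ => ?_
    exact (isHomogeneous_C_mul_X _ _).totalDegree_le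
  · by_contra hw1
    refine hc ?_
    simp only [Set.mem_iUnion, SetLike.mem_coe]
    refine ⟨E ⟨w, hw⟩, Finset.mem_image.2 ⟨⟨w, hw⟩, ?_, rfl⟩, ?_⟩
    · exact Finset.mem_filter.2 ⟨Finset.mem_univ _, fun h => hw1 (Subtype.ext_iff.1 h)⟩
    rw [hE]
    funext j
    have h1 := congrArg (coeff (Finsupp.single j 1)) h
    simp only [map_sum, map_mul, subst, algHom_C, aeval_X, coeff_sum, algebraMap_eq, coeff_C_mul,
      coeff_X, Finsupp.single_left_inj one_ne_zero] at h1
    simpa [Matrix.vecMul, dotProduct] using h1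

/-- A linear relation with invariant coefficients is a polynomial of degree less than |W| in l. It
vanishes at all conjugates of l, and these are |W| distinct elements of a domain. -/
lemma linearIndependent_pow [Finite W] {l : MvPolynomial (Fin n) ℂ}
    (hl : ∀ w ∈ W, subst w l = l → w = 1) :
    LinearIndependent (invariantSubalgebra W) fun i : Fin (Nat.card W) => l ^ (i : ℕ) := by
  have : Fintype W := Fintype.ofFinite W
  rw [Fintype.linearIndependent_iff]
  intro g hg
  let P : Polynomial (MvPolynomial (Fin n) ℂ) :=
    ∑ i : Fin (Nat.card W), Polynomial.C (g i : MvPolynomial (Fin n) ℂ) * Polynomial.X ^ (i : ℕ)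
  have hP : P = 0 := by
    refine Polynomial.eq_zero_of_natDegree_lt_card_of_eval_eq_zero P
      (f := fun w : W => subst (w : GL (Fin n) ℂ) l) ?_ ?_ ?_
    · intro w w' h
      have h1 : subst ((w : GL (Fin n) ℂ) * (w' : GL (Fin n) ℂ)⁻¹) l = l := by
        rw [← subst_comp]
        have : subst (w : GL (Fin n) ℂ) l = subst (w' : GL (Fin n) ℂ) l := h
        rw [this, subst_comp, mul_inv_cancel, subst_one]
      exact Subtype.ext (mul_inv_eq_one.1 (hl _ (mul_mem w.2 (inv_mem w'.2)) h1))
    · intro w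
      have h1 := congrArg (subst (w : GL (Fin n) ℂ)) hg
      rw [map_zero, map_sum] at h1
      rw [← h1]
      simp only [P, Polynomial.eval_finsetSum, Polynomial.eval_mul, Polynomial.eval_C,
        Polynomial.eval_pow, Polynomial.eval_X]
      refine Finset.sum_congr rfl fun i _ => ?_
      rw [Subalgebra.smul_def, smul_eq_mul, map_mul, map_pow, (g i).2 w w.2]
    · rw [← Nat.card_eq_fintype_card]
      refine lt_of_le_of_lt (Polynomial.natDegree_sum_le_of_forall_le (n := Nat.card W - 1) _ _
        fun i _ => ?_) (Nat.sub_lt Nat.card_pos one_pos)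
      refine (Polynomial.natDegree_C_mul_X_pow_le _ _).trans ?_
      omega
  intro i
  have h2 := congrArg (fun Q => Polynomial.coeff Q (i : ℕ)) hP
  simp only [P, Polynomial.finsetSum_coeff, Polynomial.coeff_C_mul_X_pow, Polynomial.coeff_zero,
    Fin.val_inj] at h2
  simpa using h2

/-- A linearly independent family of invariants cannot grow faster than the family of all
monomials divided by the order of the group. -/
theorem card_mul_sum_inv_prod_le_one [Finite W] {κ : Type*} [Fintype κ] (w : κ → Fin n → ℕ)
    (hw : ∀ k i, 0 < w k i) (u : κ × (Fin n →₀ ℕ) → MvPolynomial (Fin n) ℂ)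
    (hu : LinearIndependent ℂ u) (huW : ∀ x, u x ∈ invariantSubalgebra W) (c : ℕ)
    (hdeg : ∀ k a, (u (k, a)).totalDegree ≤ ∑ i, a i * w k i + c) :
    (Nat.card W : ℝ) * ∑ k, (1 : ℝ) / ∏ i, (w k i : ℝ) ≤ 1 := by
  obtain ⟨l, hl1, hl⟩ := exists_linearForm W
  let u' : κ × (Fin n →₀ ℕ) → invariantSubalgebra W := fun x => ⟨u x, huW x⟩
  have hu' : LinearIndependent ℂ u' :=
    LinearIndependent.of_comp (invariantSubalgebra W).val.toLinearMap hu
  -- Multiplying the family by 1, l, …, l^(|W| - 1) gives |W| times as many independent polynomials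
  -- at the cost of a bounded shift in degree.
  have h1 := linearIndependent_smul hu' (linearIndependent_pow W hl)
  let e : (Fin (Nat.card W) × κ) × (Fin n →₀ ℕ) → (κ × (Fin n →₀ ℕ)) × Fin (Nat.card W) :=
    fun x => ((x.1.2, x.2), x.1.1)
  have h2 := h1.comp e (by
    rintro ⟨⟨a, b⟩, c⟩ ⟨⟨a', b'⟩, c'⟩ h
    simp only [e, Prod.mk.injEq] at h
    simp [h.1.1, h.1.2, h.2])
  have h3 := sum_inv_prod_le_one (fun x : Fin (Nat.card W) × κ => w x.2) (fun x => hw x.2) _ h2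
    (c + Nat.card W) (by
      rintro ⟨j, k⟩ a
      change (u (k, a) * l ^ (j : ℕ)).totalDegree ≤ _
      refine (totalDegree_mul _ _).trans ?_
      have h4 := hdeg k a
      have h5 := totalDegree_pow l j
      have h6 : (j : ℕ) * l.totalDegree ≤ j * 1 := Nat.mul_le_mul_left _ hl1
      have h7 := j.2
      dsimp only
      omega)
  rw [Fintype.sum_prod_type] at h3
  simpa using h3

variable {W}

section Generators

variable {f : Fin n → MvPolynomial (Fin n) ℂ} {d : Fin n → ℕ} (hd : ∀ i, 0 < d i)
  (hfd : ∀ i, (f i).totalDegree ≤ d i)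

lemma totalDegree_aeval_monomial_le {f : Fin n → MvPolynomial (Fin n) ℂ} {d : Fin n → ℕ}
    (hfd : ∀ i, (f i).totalDegree ≤ d i) (a : Fin n →₀ ℕ) :
    (aeval f (monomial a (1 : ℂ))).totalDegree ≤ ∑ i, a i * d i := by
  rw [aeval_monomial, map_one, one_mul, Finsupp.prod_fintype _ _ (by simp)]
  refine (totalDegree_finsetProd _ _).trans (Finset.sum_le_sum fun i _ => ?_)
  exact (totalDegree_pow _ _).trans (Nat.mul_le_mul_left _ (hfd i))

lemma aeval_mem_invariantSubalgebra {f : Fin n → MvPolynomial (Fin n) ℂ}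
    (hf : ∀ i, f i ∈ invariantSubalgebra W) (P : MvPolynomial (Fin n) ℂ) :
    aeval f P ∈ invariantSubalgebra W := by
  have : aeval f P ∈ Algebra.adjoin ℂ (Set.range f) := by
    rw [Algebra.adjoin_range_eq_range_aeval]
    exact ⟨P, rfl⟩
  exact Algebra.adjoin_le (by rintro _ ⟨i, rfl⟩; exact hf i) this

lemma linearIndependent_aeval_monomial (hf : AlgebraicIndependent ℂ f) :
    LinearIndependent ℂ fun a : Fin n →₀ ℕ => aeval f (monomial a (1 : ℂ)) := by
  have := (basisMonomials (Fin n) ℂ).linearIndependent.map' (aeval f).toLinearMap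
    (LinearMap.ker_eq_bot.2 hf)
  have e : (fun a : Fin n →₀ ℕ => aeval f (monomial a (1 : ℂ))) =
      (aeval f).toLinearMap ∘ basisMonomials (Fin n) ℂ := by
    funext a
    simp
  rw [e]
  exact this

include hd hfd in
/-- Algebraically independent invariants satisfy `|W| ≤ ∏ dᵢ`. -/
theorem card_le_prod_degree [Finite W] (hf : AlgebraicIndependent ℂ f)
    (hfW : ∀ i, f i ∈ invariantSubalgebra W) : Nat.card W ≤ ∏ i, d i := by
  have h := card_mul_sum_inv_prod_le_one W (fun _ : Unit => d) (fun _ => hd)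
    (fun x => aeval f (monomial x.2 (1 : ℂ)))
    ((linearIndependent_aeval_monomial hf).comp Prod.snd (by
      rintro ⟨⟩ ⟨⟩ h
      simp_all)) (fun x => aeval_mem_invariantSubalgebra hfW _) 0
    (fun _ a => totalDegree_aeval_monomial_le hfd a)
  have hpos : (0 : ℝ) < ∏ i, (d i : ℝ) :=
    Finset.prod_pos fun i _ => by exact_mod_cast hd i
  simp only [Finset.univ_unique, Finset.sum_singleton, mul_one_div, div_le_one hpos] at h
  exact_mod_cast h

-- The hypothesis says that p · ℂ[f'] meets ℂ[f] only in 0, with independent products p · f'ᵃ.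
-- Together with the monomials in f they would give |W| (1/∏dᵢ + 1/∏d'ᵢ) ≤ 1, although the first
-- term alone is already 1.
include hd hfd in
lemma false_of_independent [Finite W] (hf : AlgebraicIndependent ℂ f)
    (hfW : ∀ i, f i ∈ invariantSubalgebra W) (hcard : Nat.card W = ∏ i, d i)
    {p : MvPolynomial (Fin n) ℂ} (hp : p ∈ invariantSubalgebra W)
    {f' : Fin n → MvPolynomial (Fin n) ℂ} (hf' : ∀ i, f' i ∈ invariantSubalgebra W)
    (h : ∀ T A : MvPolynomial (Fin n) ℂ, p * aeval f' T = aeval f A → T = 0) : False := by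
  -- One is added because weights must be positive and f' may contain constants.
  let d' : Fin n → ℕ := fun i => (f' i).totalDegree + 1
  let L : MvPolynomial (Fin n) ℂ →ₗ[ℂ] MvPolynomial (Fin n) ℂ :=
    (LinearMap.mulLeft ℂ p).comp (aeval f').toLinearMap
  have hL : ∀ T, L T = p * aeval f' T := fun _ => rfl
  have h1 : LinearIndependent ℂ fun a : Fin n →₀ ℕ => L (monomial a (1 : ℂ)) := by
    have := (basisMonomials (Fin n) ℂ).linearIndependent.map' L
      (LinearMap.ker_eq_bot'.2 fun T hT => h T 0 (by rw [← hL, hT, map_zero]))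
    have e : (fun a : Fin n →₀ ℕ => L (monomial a (1 : ℂ))) = L ∘ basisMonomials (Fin n) ℂ := by
      funext a
      simp
    rw [e]
    exact this
  have h2 := (linearIndependent_aeval_monomial hf).sum_type h1 (by
    rw [Submodule.disjoint_def]
    intro x hx hx'
    have hx1 : x ∈ LinearMap.range (aeval f).toLinearMap (R := ℂ) :=
      (Submodule.span_le.2 (by rintro _ ⟨a, rfl⟩; exact ⟨_, rfl⟩)) hx
    have hx2 : x ∈ LinearMap.range L :=
      (Submodule.span_le.2 (by rintro _ ⟨a, rfl⟩; exact ⟨_, rfl⟩)) hx'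
    obtain ⟨A, rfl⟩ := hx1
    obtain ⟨T, hT⟩ := hx2
    rw [← hT, h T A hT, map_zero])
  have h3 := h2.comp _ (Equiv.boolProdEquivSum (Fin n →₀ ℕ)).injective
  have h4 := card_mul_sum_inv_prod_le_one W (fun b : Bool => bif b then d' else d)
    (by rintro (_ | _) i; exacts [hd i, Nat.succ_pos _]) _ h3 ?_ p.totalDegree ?_
  · have hpos : (0 : ℝ) < ∏ i, (d i : ℝ) :=
      Finset.prod_pos fun i _ => by exact_mod_cast hd i
    have hpos' : (0 : ℝ) < ∏ i, (d' i : ℝ) :=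
      Finset.prod_pos fun i _ => by exact_mod_cast Nat.succ_pos _
    rw [hcard] at h4
    simp only [Fintype.sum_bool, cond_true, cond_false] at h4
    push_cast at h4
    rw [mul_add, mul_one_div_cancel hpos.ne'] at h4
    have : 0 < (∏ i, (d i : ℝ)) * (1 / ∏ i, (d' i : ℝ)) := by positivity
    linarith
  · rintro ⟨_ | _, a⟩
    · exact aeval_mem_invariantSubalgebra hfW _
    · exact mul_mem hp (aeval_mem_invariantSubalgebra hf' _)
  · rintro (_ | _) a
    · exact (totalDegree_aeval_monomial_le hfd a).trans (Nat.le_add_right _ _)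
    · refine (totalDegree_mul _ _).trans ?_
      rw [add_comm]
      exact Nat.add_le_add_right (totalDegree_aeval_monomial_le (fun i => Nat.le_succ _) a) _

open scoped Classical in
/-- A polynomial relation for a fraction `A / B` in lowest terms forces the vanishing of the
relation, if the coefficients do not involve a variable that occurs in `B`. -/
lemma eq_zero_of_relation (hf : AlgebraicIndependent ℂ f) {p A B q : MvPolynomial (Fin n) ℂ}
    (hp : aeval f B * p = aeval f A) (hq : Prime q) (hqB : q ∣ B) (hqA : ¬ q ∣ A)
    {j : Fin n} (hj : degreeOf j q ≠ 0) {T A₀ : MvPolynomial (Fin n) ℂ}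
    (h : p * aeval (Function.update f j p) T = aeval f A₀) : T = 0 := by
  by_contra hT
  let K := degreeOf j T
  have hK : ∀ a ∈ T.support, a j ≤ K := fun a ha => degreeOf_le_iff.1 le_rfl a ha
  -- H is T with the variable j replaced by A / B and denominators cleared by B^K; L is the leading
  -- coefficient of T in that variable.
  let H : MvPolynomial (Fin n) ℂ :=
    ∑ a ∈ T.support, monomial (a.erase j) (coeff a T) * (A ^ a j * B ^ (K - a j))
  let L : MvPolynomial (Fin n) ℂ :=
    ∑ a ∈ T.support with a j = K, monomial (a.erase j) (coeff a T)
  have h1 : aeval f H = aeval f B ^ K * aeval (Function.update f j p) T := by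
    conv_rhs => rw [T.as_sum]
    rw [map_sum, map_sum, Finset.mul_sum]
    refine Finset.sum_congr rfl fun a ha => ?_
    rw [map_mul, map_mul, map_pow, map_pow, ← hp, mul_pow]
    obtain ⟨m, hm⟩ := Nat.exists_eq_add_of_le (hK a ha)
    rw [hm, Nat.add_sub_cancel_left, pow_add]
    have h2 : aeval (Function.update f j p) (monomial a (coeff a T)) =
        aeval f (monomial (a.erase j) (coeff a T)) * p ^ a j := by
      rw [aeval_monomial, aeval_monomial, mul_assoc]
      congr 1
      rw [Finsupp.prod_fintype _ _ (by simp), Finsupp.prod_fintype _ _ (by simp),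
        ← Finset.mul_prod_erase _ _ (Finset.mem_univ j),
        ← Finset.mul_prod_erase Finset.univ _ (Finset.mem_univ j), Function.update_self,
        Finsupp.erase_same, pow_zero, one_mul, mul_comm]
      congr 1
      refine Finset.prod_congr rfl fun i hi => ?_
      rw [Function.update_of_ne (Finset.ne_of_mem_erase hi),
        Finsupp.erase_ne (Finset.ne_of_mem_erase hi)]
    rw [h2]
    ring
  have h2 : A * H = B ^ (K + 1) * A₀ := by
    apply hf
    rw [map_mul, map_mul, map_pow, h1, ← hp, ← h]
    ring
  have hqH : q ∣ H := by
    refine (hq.dvd_or_dvd (h2 ▸ ?_)).resolve_left hqA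
    exact dvd_mul_of_dvd_left (dvd_pow hqB (Nat.succ_ne_zero K)) _
  -- As in the rational root theorem: modulo q only the terms of top degree in the variable j
  -- survive, so H ≡ L · A^K. But L does not involve that variable and q does, so L would have to
  -- vanish.
  have hqL : q ∣ L := by
    have h3 : q ∣ H - L * A ^ K := by
      have : H - L * A ^ K =
          ∑ a ∈ T.support with ¬ a j = K,
            monomial (a.erase j) (coeff a T) * (A ^ a j * B ^ (K - a j)) := by
        rw [sub_eq_iff_eq_add', Finset.sum_mul]
        simp only [H]
        rw [← Finset.sum_filter_add_sum_filter_not T.support (fun a => a j = K)]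
        congr 1
        refine Finset.sum_congr rfl fun a ha => ?_
        rw [(Finset.mem_filter.1 ha).2, Nat.sub_self, pow_zero, mul_one]
      rw [this]
      refine Finset.dvd_sum fun a ha => ?_
      obtain ⟨ha, ha'⟩ := Finset.mem_filter.1 ha
      have := hK a ha
      exact dvd_mul_of_dvd_right (dvd_mul_of_dvd_right (dvd_pow hqB (by omega)) _) _
    have h4 : q ∣ L * A ^ K := (dvd_sub_right hqH).1 h3
    exact (hq.dvd_or_dvd h4).resolve_right fun h => hqA (hq.dvd_of_dvd_pow h)
  have hL0 : L ≠ 0 := by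
    obtain ⟨a, ha, haK⟩ : ∃ a ∈ T.support, a j = K := by
      obtain ⟨a, ha, haK⟩ := Finset.exists_mem_eq_sup T.support
        (support_nonempty.2 hT) (fun m => m j)
      exact ⟨a, ha, by rw [← haK, ← degreeOf_eq_sup]⟩
    refine MvPolynomial.ne_zero_iff.2 ⟨a.erase j, ?_⟩
    simp only [L, coeff_sum, coeff_monomial]
    rw [Finset.sum_eq_single a]
    · simpa using ha
    · intro b hb hba
      refine if_neg fun hab => hba ?_
      obtain ⟨hb, hbK⟩ := Finset.mem_filter.1 hb
      ext i
      by_cases hi : i = j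
      · rw [hi, hbK, haK]
      · have := DFunLike.congr_fun hab i
        rwa [Finsupp.erase_ne hi, Finsupp.erase_ne hi] at this
    · intro h
      exact absurd (Finset.mem_filter.2 ⟨ha, haK⟩) h
  have hLj : degreeOf j L = 0 := by
    rw [← Nat.le_zero, degreeOf_le_iff]
    intro m hm
    obtain ⟨a, -, ha⟩ := Finset.mem_biUnion.1 (support_sum hm)
    rw [Finset.mem_singleton.1 (support_monomial_subset ha), Finsupp.erase_same]
  obtain ⟨r, hr⟩ := hqL
  have := degreeOf_mul_eq (n := j) (left_ne_zero_of_mul (hr ▸ hL0)) (right_ne_zero_of_mul (hr ▸ hL0))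
  rw [← hr, hLj] at this
  omega

include hd hfd in
/-- Algebraically independent invariants whose degrees have product `|W|` generate the algebra of
invariants. -/
theorem mem_range_aeval_of_card_eq [Finite W] (hf : AlgebraicIndependent ℂ f)
    (hfW : ∀ i, f i ∈ invariantSubalgebra W) (hcard : Nat.card W = ∏ i, d i)
    {p : MvPolynomial (Fin n) ℂ} (hp : p ∈ invariantSubalgebra W) :
    p ∈ (aeval (R := ℂ) f).range := by
  by_contra hpr
  -- If p is a fraction of elements of ℂ[f], a prime q in its reduced denominator involves some
  -- variable j, and the second family is p times the monomials in f with fⱼ replaced by p.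
  -- Otherwise p times the monomials in f itself serves.
  by_cases hfrac : ∃ B A : MvPolynomial (Fin n) ℂ, B ≠ 0 ∧ aeval f B * p = aeval f A
  · obtain ⟨B₀, A₀, hB₀, h₀⟩ := hfrac
    obtain ⟨B, A, C', hrel, rfl, rfl⟩ :=
      UniqueFactorizationMonoid.exists_reduced_factors B₀ hB₀ A₀
    have hC : aeval f C' ≠ 0 := fun h0 =>
      left_ne_zero_of_mul hB₀ (hf (h0.trans (map_zero _).symm))
    have h1 : aeval f B * p = aeval f A := by
      rw [map_mul, map_mul, mul_assoc] at h₀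
      exact mul_left_cancel₀ hC h₀
    have hB := right_ne_zero_of_mul hB₀
    have hBu : ¬ IsUnit B := by
      rintro ⟨u, rfl⟩
      refine hpr ((AlgHom.mem_range _).2 ⟨↑u⁻¹ * A, ?_⟩)
      rw [map_mul, ← h1, ← mul_assoc, ← map_mul, Units.inv_mul, map_one, one_mul]
    obtain ⟨q, hq, hqB⟩ := WfDvdMonoid.exists_irreducible_factor hBu hB
    have hqA : ¬ q ∣ A := fun h => hq.not_isUnit (hrel hqB h)
    obtain ⟨j, hj⟩ : ∃ j, degreeOf j q ≠ 0 := by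
      by_contra! h
      have h2 : q.vars = ∅ := by
        refine Finset.eq_empty_of_forall_notMem fun j hj => ?_
        obtain ⟨m, hm, hjm⟩ := (mem_vars_iff_mem_support j).1 hj
        exact Finsupp.mem_support_iff.1 hjm
          (Nat.le_zero.1 ((degreeOf_le_iff.1 (h j).le) m hm))
      rw [vars_eq_empty_iff_eq_C] at h2
      refine hq.not_isUnit (h2 ▸ (IsUnit.mk0 _ fun h0 => hq.ne_zero ?_).map C)
      rw [h2, h0, C_0]
    refine false_of_independent hd hfd hf hfW hcard hp (f' := Function.update f j p) ?_
      fun T A₁ h => eq_zero_of_relation hf h1 hq.prime hqB hqA hj h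
    intro i
    by_cases hi : i = j
    · rw [hi, Function.update_self]
      exact hp
    · rw [Function.update_of_ne hi]
      exact hfW i
  · refine false_of_independent hd hfd hf hfW hcard hp hfW fun T A h => ?_
    by_contra hT
    exact hfrac ⟨T, A, hT, by rw [mul_comm, h]⟩

end Generators

end QuotG25920

end

noncomputable section

open CategoryTheory AlgebraicGeometry MvPolynomial

namespace QuotG25920

/-! ### The action on the roots -/

/-- The ring of Eisenstein integers `ℤ[ω]`. -/
abbrev Eis : Type := QuadraticAlgebra ℤ (-1) (-1)

/-- Roots of the Shephard–Todd group No. 32, one on each of the 40 root lines. -/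
def lineE : Fin 40 → Fin 4 → Eis :=
  ![
    ![⟨1, 2⟩, 0, 0, 0], ![0, ⟨1, 2⟩, 0, 0], ![0, 0, ⟨1, 2⟩, 0], ![0, 0, 0, ⟨1, 2⟩],
    ![0, 1, ⟨-1, -1⟩, ⟨-1, -1⟩], ![0, 1, ⟨-1, -1⟩, ⟨0, 1⟩], ![0, 1, ⟨-1, -1⟩, 1],
    ![0, 1, ⟨0, 1⟩, ⟨-1, -1⟩], ![0, 1, ⟨0, 1⟩, ⟨0, 1⟩], ![0, 1, ⟨0, 1⟩, 1], ![0, 1, 1, ⟨-1, -1⟩],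
    ![0, 1, 1, ⟨0, 1⟩], ![0, 1, 1, 1], ![1, 0, ⟨-1, -1⟩, ⟨-1, 0⟩], ![1, 0, ⟨-1, -1⟩, ⟨0, -1⟩],
    ![1, 0, ⟨-1, -1⟩, ⟨1, 1⟩], ![1, 0, ⟨0, 1⟩, ⟨-1, 0⟩], ![1, 0, ⟨0, 1⟩, ⟨0, -1⟩],
    ![1, 0, ⟨0, 1⟩, ⟨1, 1⟩], ![1, 0, 1, ⟨-1, 0⟩], ![1, 0, 1, ⟨0, -1⟩], ![1, 0, 1, ⟨1, 1⟩],
    ![1, ⟨-1, 0⟩, 0, ⟨-1, -1⟩], ![1, ⟨-1, 0⟩, 0, ⟨0, 1⟩], ![1, ⟨-1, 0⟩, 0, 1],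
    ![1, ⟨0, -1⟩, 0, ⟨-1, -1⟩], ![1, ⟨0, -1⟩, 0, ⟨0, 1⟩], ![1, ⟨0, -1⟩, 0, 1],
    ![1, ⟨1, 1⟩, 0, ⟨-1, -1⟩], ![1, ⟨1, 1⟩, 0, ⟨0, 1⟩], ![1, ⟨1, 1⟩, 0, 1],
    ![1, ⟨-1, -1⟩, ⟨-1, 0⟩, 0], ![1, ⟨-1, -1⟩, ⟨0, -1⟩, 0], ![1, ⟨-1, -1⟩, ⟨1, 1⟩, 0],
    ![1, ⟨0, 1⟩, ⟨-1, 0⟩, 0], ![1, ⟨0, 1⟩, ⟨0, -1⟩, 0], ![1, ⟨0, 1⟩, ⟨1, 1⟩, 0],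
    ![1, 1, ⟨-1, 0⟩, 0], ![1, 1, ⟨0, -1⟩, 0], ![1, 1, ⟨1, 1⟩, 0]]

/-- The generators multiplied by the scalars `denE` to clear denominators: first the four
reflections, then C, D, V, F. Here ⟨a, b⟩ stands for a + bω. -/
def genE : Fin 8 → Matrix (Fin 4) (Fin 4) Eis :=
  ![!![1, 0, 0, 0; 0, 1, 0, 0; 0, 0, ⟨0, 1⟩, 0; 0, 0, 0, 1],
    !![⟨2, 1⟩, ⟨-1, 1⟩, ⟨1, -1⟩, 0; ⟨-1, 1⟩, ⟨2, 1⟩, ⟨1, -1⟩, 0; ⟨1, -1⟩, ⟨1, -1⟩, ⟨2, 1⟩, 0; 0, 0, 0, ⟨3, 0⟩],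
    !![1, 0, 0, 0; 0, ⟨0, 1⟩, 0, 0; 0, 0, 1, 0; 0, 0, 0, 1],
    !![⟨2, 1⟩, ⟨1, -1⟩, 0, ⟨-1, 1⟩; ⟨1, -1⟩, ⟨2, 1⟩, 0, ⟨1, -1⟩; 0, 0, ⟨3, 0⟩, 0; ⟨-1, 1⟩, ⟨1, -1⟩, 0, ⟨2, 1⟩],
    !![1, 0, 0, 0; 0, 1, 0, 0; 0, 0, ⟨0, 1⟩, 0; 0, 0, 0, ⟨-1, -1⟩],
    !![⟨0, 1⟩, 0, 0, 0; 0, ⟨0, 1⟩, 0, 0; 0, 0, ⟨0, 1⟩, 0; 0, 0, 0, 1],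
    !![⟨1, 2⟩, 0, 0, 0; 0, 1, 1, 1; 0, 1, ⟨0, 1⟩, ⟨-1, -1⟩; 0, 1, ⟨-1, -1⟩, ⟨0, 1⟩],
    !![0, 0, ⟨-1, 0⟩, 0; 0, 1, 0, 0; ⟨-1, 0⟩, 0, 0, 0; 0, 0, 0, ⟨-1, 0⟩]]

def denE : Fin 8 → Eis := ![1, ⟨3, 0⟩, 1, ⟨3, 0⟩, 1, 1, ⟨1, 2⟩, 1]

/-- An entry (m, j) in row k and column i records that generator k sends root i to (-ω)ᵐ times root
j. -/
def tableE : Fin 8 → Fin 40 → ZMod 6 × Fin 40 :=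
  ![![(0, 0), (0, 1), (4, 2), (0, 3), (0, 10), (0, 11), (0, 12), (0, 4), (0, 5), (0, 6), (0, 7),
      (0, 8), (0, 9), (0, 19), (0, 20), (0, 21), (0, 13), (0, 14), (0, 15), (0, 16), (0, 17),
      (0, 18), (0, 22), (0, 23), (0, 24), (0, 25), (0, 26), (0, 27), (0, 28), (0, 29), (0, 30),
      (0, 32), (0, 33), (0, 31), (0, 35), (0, 36), (0, 34), (0, 38), (0, 39), (0, 37)],
    ![(4, 35), (2, 31), (5, 39), (0, 3), (3, 18), (3, 17), (3, 16), (4, 26), (4, 27), (4, 25),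
      (0, 10), (0, 11), (0, 12), (3, 9), (3, 8), (3, 7), (5, 29), (5, 28), (5, 30), (0, 19),
      (0, 20), (0, 21), (0, 22), (0, 23), (0, 24), (5, 13), (5, 15), (5, 14), (4, 5), (4, 6),
      (4, 4), (5, 34), (0, 32), (1, 0), (5, 1), (1, 33), (0, 36), (4, 37), (2, 2), (5, 38)],
    ![(0, 0), (4, 1), (0, 2), (0, 3), (4, 8), (4, 9), (4, 7), (4, 11), (4, 12), (4, 10), (4, 5),
      (4, 6), (4, 4), (0, 13), (0, 14), (0, 15), (0, 16), (0, 17), (0, 18), (0, 19), (0, 20),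
      (0, 21), (0, 25), (0, 26), (0, 27), (0, 28), (0, 29), (0, 30), (0, 22), (0, 23), (0, 24),
      (0, 37), (0, 38), (0, 39), (0, 31), (0, 32), (0, 33), (0, 34), (0, 35), (0, 36)],
    ![(4, 26), (5, 30), (0, 2), (2, 22), (0, 14), (1, 35), (0, 6), (0, 17), (1, 34), (0, 9),
      (0, 20), (1, 36), (0, 12), (0, 13), (5, 31), (0, 5), (0, 16), (5, 33), (0, 8), (0, 19),
      (5, 32), (0, 11), (5, 23), (5, 3), (4, 24), (0, 25), (1, 28), (2, 1), (1, 0), (0, 29),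
      (5, 27), (1, 4), (1, 10), (1, 7), (5, 18), (5, 15), (5, 21), (0, 37), (0, 38), (0, 39)],
    ![(0, 0), (0, 1), (4, 2), (2, 3), (0, 11), (0, 12), (0, 10), (0, 5), (0, 6), (0, 4), (0, 8),
      (0, 9), (0, 7), (0, 21), (0, 19), (0, 20), (0, 15), (0, 13), (0, 14), (0, 18), (0, 16),
      (0, 17), (0, 23), (0, 24), (0, 22), (0, 26), (0, 27), (0, 25), (0, 29), (0, 30), (0, 28),
      (0, 32), (0, 33), (0, 31), (0, 35), (0, 36), (0, 34), (0, 38), (0, 39), (0, 37)],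
    ![(4, 0), (4, 1), (4, 2), (0, 3), (4, 5), (4, 6), (4, 4), (4, 8), (4, 9), (4, 7), (4, 11),
      (4, 12), (4, 10), (4, 15), (4, 13), (4, 14), (4, 18), (4, 16), (4, 17), (4, 21), (4, 19),
      (4, 20), (4, 23), (4, 24), (4, 22), (4, 26), (4, 27), (4, 25), (4, 29), (4, 30), (4, 28),
      (4, 31), (4, 32), (4, 33), (4, 34), (4, 35), (4, 36), (4, 37), (4, 38), (4, 39)],
    ![(0, 0), (0, 12), (0, 7), (0, 5), (3, 8), (3, 2), (2, 11), (3, 3), (0, 4), (1, 6), (2, 9),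
      (1, 10), (3, 1), (0, 35), (0, 24), (0, 15), (0, 28), (0, 17), (0, 37), (0, 19), (0, 33),
      (0, 26), (0, 36), (0, 29), (0, 18), (0, 22), (0, 13), (0, 31), (0, 20), (0, 38), (0, 27),
      (0, 34), (0, 23), (0, 16), (0, 30), (0, 21), (0, 39), (0, 14), (0, 32), (0, 25)],
    ![(3, 2), (0, 1), (3, 0), (3, 3), (5, 27), (5, 25), (5, 26), (1, 29), (1, 30), (1, 28),
      (3, 22), (3, 23), (3, 24), (5, 17), (5, 18), (5, 16), (1, 15), (1, 13), (1, 14), (3, 19),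
      (3, 20), (3, 21), (3, 10), (3, 11), (3, 12), (1, 5), (1, 6), (1, 4), (5, 9), (5, 7),
      (5, 8), (0, 31), (4, 36), (2, 38), (0, 34), (4, 39), (2, 32), (0, 37), (4, 33), (2, 35)]]

lemma ω_sq_add : ω ^ 2 + ω + 1 = 0 := by
  have h : ((Real.sqrt 3 : ℝ) : ℂ) ^ 2 = 3 := by
    rw [← Complex.ofReal_pow, Real.sq_sqrt (by norm_num)]
    norm_num
  rw [ω]
  linear_combination (Complex.I ^ 2 / 4) * h + 3 / 4 * Complex.I_sq

lemma ω_pow_three : ω ^ 3 = 1 := by linear_combination (ω - 1) * ω_sq_add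

lemma I_mul_sqrt : Complex.I * (Real.sqrt 3 : ℝ) = 1 + 2 * ω := by
  rw [ω]
  ring

lemma theta_sq : (1 + 2 * ω) ^ 2 = -3 := by linear_combination 4 * ω_sq_add

lemma theta_ne_zero : (1 + 2 * ω) ≠ 0 := fun h => by
  have := theta_sq
  rw [h] at this
  norm_num at this

/-- The embedding of the Eisenstein integers into `ℂ`. -/
def eisToC : Eis →+* ℂ :=
  (QuadraticAlgebra.lift ⟨ω, by
    rw [zsmul_eq_mul, zsmul_eq_mul]
    push_cast
    linear_combination ω_sq_add⟩ : Eis →ₐ[ℤ] ℂ)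

lemma eisToC_mk (a b : ℤ) : eisToC ⟨a, b⟩ = a + b * ω := by
  simp [eisToC, QuadraticAlgebra.lift]

/-- The roots, as complex vectors. -/
def rootVec (x : ZMod 6 × Fin 40) : Fin 4 → ℂ := fun j => (-ω) ^ x.1.val * eisToC (lineE x.2 j)

lemma neg_ω_pow_six : (-ω) ^ 6 = 1 := by linear_combination (ω ^ 3 + 1) * ω_pow_three

lemma neg_ω_pow_val_add (a b : ZMod 6) :
    (-ω) ^ (a + b).val = (-ω) ^ a.val * (-ω) ^ b.val := by
  rw [ZMod.val_add, ← pow_add, ← pow_mod_orderOf, ← pow_mod_orderOf (-ω) (a.val + b.val)]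
  congr 1
  exact Nat.mod_mod_of_dvd _ (orderOf_dvd_of_pow_eq_one neg_ω_pow_six)

/-- The generators of the Shephard–Todd group No. 32, followed by those of Blichfeldt's group. -/
def genMat : Fin 8 → Matrix (Fin 4) (Fin 4) ℂ :=
  ![reflMatrix (root32 0), reflMatrix (root32 1), reflMatrix (root32 2), reflMatrix (root32 3),
    blichfeldtC, blichfeldtD, blichfeldtV, blichfeldtF]

lemma denE_ne_zero (k : Fin 8) : eisToC (denE k) ≠ 0 := by
  have := theta_ne_zero
  fin_cases k <;> simp [denE, eisToC_mk, this]

lemma dotProduct_mul_reflMatrix {a : Fin 4 → ℂ} (ha : a ⬝ᵥ a ≠ 0) (i j : Fin 4) :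
    (a ⬝ᵥ a) * reflMatrix a i j = (if i = j then a ⬝ᵥ a else 0) - (1 - ω) * (a i * a j) := by
  rw [reflMatrix, Matrix.sub_apply, Matrix.smul_apply, Matrix.vecMulVec_apply, Matrix.one_apply,
    smul_eq_mul]
  split_ifs
  all_goals
    field_simp
  all_goals ring

lemma den_smul_genMat_refl (k : Fin 4) (i j : Fin 4) :
    eisToC (denE (Fin.castAdd 4 k)) * reflMatrix (root32 k) i j =
      eisToC (genE (Fin.castAdd 4 k) i j) := by
  have hk : root32 k ⬝ᵥ root32 k = eisToC (denE (Fin.castAdd 4 k)) := by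
    fin_cases k <;> simp [denE, eisToC_mk, root32, dotProduct, Fin.sum_univ_four] <;> norm_num
  rw [← hk, dotProduct_mul_reflMatrix (hk ▸ denE_ne_zero _), hk]
  fin_cases k <;> fin_cases i <;> fin_cases j <;>
    simp [denE, eisToC_mk, root32, genE] <;> ring

lemma den_smul_blichfeldtC (i j : Fin 4) :
    eisToC (denE 4) * blichfeldtC i j = eisToC (genE 4 i j) := by
  have h3 : ω ^ 2 = -1 - ω := by linear_combination ω_sq_add
  (fin_cases i <;> fin_cases j <;> simp [denE, genE, eisToC_mk, blichfeldtC, h3]); ring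

lemma den_smul_blichfeldtD (i j : Fin 4) :
    eisToC (denE 5) * blichfeldtD i j = eisToC (genE 5 i j) := by
  fin_cases i <;> fin_cases j <;> simp [denE, genE, eisToC_mk, blichfeldtD]

lemma den_smul_blichfeldtV (i j : Fin 4) :
    eisToC (denE 6) * blichfeldtV i j = eisToC (genE 6 i j) := by
  have h3 : ω ^ 2 = -1 - ω := by linear_combination ω_sq_add
  have h : eisToC (denE 6) = 1 + 2 * ω := by simp [denE, eisToC_mk]
  rw [h, blichfeldtV, Matrix.smul_apply, I_mul_sqrt, smul_eq_mul, one_div, ← mul_assoc,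
    mul_inv_cancel₀ theta_ne_zero, one_mul]
  fin_cases i <;> fin_cases j <;> simp [genE, eisToC_mk, h3] <;> ring

lemma den_smul_blichfeldtF (i j : Fin 4) :
    eisToC (denE 7) * blichfeldtF i j = eisToC (genE 7 i j) := by
  fin_cases i <;> fin_cases j <;> simp [denE, genE, eisToC_mk, blichfeldtF]

lemma den_smul_genMat (k : Fin 8) (i j : Fin 4) :
    eisToC (denE k) * genMat k i j = eisToC (genE k i j) := by
  fin_cases k
  · exact den_smul_genMat_refl 0 i j
  · exact den_smul_genMat_refl 1 i j
  · exact den_smul_genMat_refl 2 i j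
  · exact den_smul_genMat_refl 3 i j
  · exact den_smul_blichfeldtC i j
  · exact den_smul_blichfeldtD i j
  · exact den_smul_blichfeldtV i j
  · exact den_smul_blichfeldtF i j

/-- The only matrix computation about the action: after this check of the table in ℤ[ω], words are
evaluated as permutations of the roots. -/
lemma genE_mulVec_lineE : ∀ (k : Fin 8) (i : Fin 40) (j : Fin 4),
    genE k j 0 * lineE i 0 + genE k j 1 * lineE i 1 + genE k j 2 * lineE i 2 +
      genE k j 3 * lineE i 3 =
    denE k * ((⟨0, -1⟩ : Eis) ^ (tableE k i).1.val * lineE (tableE k i).2 j) := by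
  decide +kernel

end QuotG25920

end

/-! ### Words in the generators as permutations of the roots -/

noncomputable section

open CategoryTheory AlgebraicGeometry MvPolynomial
open scoped Matrix

namespace QuotG25920

/-- The permutation of the roots induced by a generator. -/
def actE (k : Fin 8) (x : ZMod 6 × Fin 40) : ZMod 6 × Fin 40 :=
  (x.1 + (tableE k x.2).1, (tableE k x.2).2)

lemma eisToC_unit_pow (m : ZMod 6) : eisToC ((⟨0, -1⟩ : Eis) ^ m.val) = (-ω) ^ m.val := by
  rw [map_pow, eisToC_mk]
  simp

lemma genMat_mulVec_rootVec (k : Fin 8) (x : ZMod 6 × Fin 40) :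
    genMat k *ᵥ rootVec x = rootVec (actE k x) := by
  funext j
  apply mul_left_cancel₀ (denE_ne_zero k)
  have h := congrArg eisToC (genE_mulVec_lineE k x.2 j)
  simp only [map_add, map_mul, eisToC_unit_pow, ← den_smul_genMat] at h
  simp only [Matrix.mulVec, dotProduct, Fin.sum_univ_four, rootVec, actE, neg_ω_pow_val_add]
  linear_combination (-ω) ^ x.1.val * h

lemma rootVec_coord (i : Fin 4) :
    rootVec (0, Fin.castLE (by norm_num) i) = Pi.single i (1 + 2 * ω) := by
  funext j
  simp only [rootVec, ZMod.val_zero, pow_zero, one_mul]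
  fin_cases i <;> fin_cases j <;> simp [lineE, eisToC_mk]

/-- The roots 0, 1, 2, 3 are multiples of the standard basis vectors by i√3 = 1 + 2ω. -/
lemma matrix_ext_rootVec {M N : Matrix (Fin 4) (Fin 4) ℂ}
    (h : ∀ i : Fin 4, M *ᵥ rootVec (0, Fin.castLE (by norm_num) i) =
      N *ᵥ rootVec (0, Fin.castLE (by norm_num) i)) : M = N := by
  refine Matrix.ext_of_mulVec_single fun i => ?_
  have h1 := h i
  have h2 : (Pi.single i (1 + 2 * ω) : Fin 4 → ℂ) = (1 + 2 * ω) • Pi.single i 1 := by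
    rw [← Pi.single_smul, smul_eq_mul, mul_one]
  rw [rootVec_coord, h2, Matrix.mulVec_smul, Matrix.mulVec_smul] at h1
  exact smul_right_injective _ theta_ne_zero h1

/-- The action of a word in the generators. -/
def actWord (l : List (Fin 8)) (x : ZMod 6 × Fin 40) : ZMod 6 × Fin 40 := l.foldr actE x

lemma prod_genMat_mulVec_rootVec (l : List (Fin 8)) (x : ZMod 6 × Fin 40) :
    (l.map genMat).prod *ᵥ rootVec x = rootVec (actWord l x) := by
  induction l with
  | nil => simp [actWord]
  | cons k l ih =>
    rw [List.map_cons, List.prod_cons, ← Matrix.mulVec_mulVec, ih, genMat_mulVec_rootVec]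
    rfl

lemma actWord_replicate : ∀ (k : Fin 8) (i : Fin 40),
    actWord (List.replicate 12 k) (0, i) = (0, i) := by
  decide +kernel

lemma genMat_pow (k : Fin 8) : genMat k ^ 12 = 1 := by
  refine matrix_ext_rootVec fun i => ?_
  have h := prod_genMat_mulVec_rootVec (List.replicate 12 k) (0, Fin.castLE (by norm_num) i)
  rw [List.map_replicate, List.prod_replicate, actWord_replicate] at h
  rw [h, Matrix.one_mulVec]

/-- The generators as elements of the general linear group. -/
def gen (k : Fin 8) : GL (Fin 4) ℂ := Units.ofPowEqOne (genMat k) 12 (genMat_pow k) (by norm_num)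

@[simp] lemma coe_gen (k : Fin 8) : (gen k : Matrix (Fin 4) (Fin 4) ℂ) = genMat k := rfl

/-- The group element given by a word. -/
def evalWord (l : List (Fin 8)) : GL (Fin 4) ℂ := (l.map gen).prod

lemma coe_evalWord (l : List (Fin 8)) :
    (evalWord l : Matrix (Fin 4) (Fin 4) ℂ) = (l.map genMat).prod := by
  induction l with
  | nil => simp [evalWord]
  | cons k l ih =>
    rw [evalWord, List.map_cons, List.prod_cons, Units.val_mul, List.map_cons, List.prod_cons, ← ih]
    rfl

lemma evalWord_mulVec_rootVec (l : List (Fin 8)) (x : ZMod 6 × Fin 40) :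
    (evalWord l : Matrix (Fin 4) (Fin 4) ℂ) *ᵥ rootVec x = rootVec (actWord l x) := by
  rw [coe_evalWord, prod_genMat_mulVec_rootVec]

lemma evalWord_mem {H : Subgroup (GL (Fin 4) ℂ)} {l : List (Fin 8)} (h : ∀ k ∈ l, gen k ∈ H) :
    evalWord l ∈ H := by
  refine list_prod_mem fun g hg => ?_
  obtain ⟨k, hk, rfl⟩ := List.mem_map.1 hg
  exact h k hk

/-- The norm form a² - ab + b² is positive definite. -/
lemma eisToC_injective : Function.Injective eisToC := by
  rw [injective_iff_map_eq_zero]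
  rintro ⟨a, b⟩ h
  rw [eisToC_mk] at h
  have h1 : ((a : ℂ) - b * (1 + ω)) * (a + b * ω) = ((a ^ 2 - a * b + b ^ 2 : ℤ) : ℂ) := by
    push_cast
    linear_combination (-(b : ℂ) ^ 2) * ω_sq_add
  rw [h, mul_zero] at h1
  have h2 : a ^ 2 - a * b + b ^ 2 = 0 := by exact_mod_cast h1.symm
  have ha : a = 0 := by nlinarith [sq_nonneg (a - 2 * b), sq_nonneg a]
  have hb : b = 0 := by nlinarith [sq_nonneg (b - 2 * a), sq_nonneg b]
  rw [ha, hb]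
  rfl

lemma actE_smul (k : Fin 8) (m : ZMod 6) (x : ZMod 6 × Fin 40) :
    actE k (m + x.1, x.2) = (m + (actE k x).1, (actE k x).2) := by
  simp [actE, add_assoc]

lemma actWord_smul (l : List (Fin 8)) (m : ZMod 6) (x : ZMod 6 × Fin 40) :
    actWord l (m + x.1, x.2) = (m + (actWord l x).1, (actWord l x).2) := by
  induction l with
  | nil => rfl
  | cons k l ih =>
    change actE k (actWord l _) = _
    rw [ih, actE_smul]
    rfl

lemma actWord_mk (l : List (Fin 8)) (x : ZMod 6 × Fin 40) :
    actWord l x = (x.1 + (actWord l (0, x.2)).1, (actWord l (0, x.2)).2) := by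
  rw [← actWord_smul, add_zero]

lemma actE_bijective (k : Fin 8) : Function.Bijective (actE k) := by
  refine Finite.injective_iff_bijective.1 ?_
  have h : ∀ x, actWord (List.replicate 12 k) x = x := fun x => by
    rw [actWord_mk, actWord_replicate, add_zero]
  have h2 : ∀ x, actWord (List.replicate 12 k) x = actWord (List.replicate 11 k) (actE k x) := by
    intro x
    rw [show (12 : ℕ) = 11 + 1 from rfl, List.replicate_succ', actWord, List.foldr_append]
    rfl
  intro x y hxy
  rw [← h x, ← h y, h2, h2, hxy]

lemma actWord_bijective (l : List (Fin 8)) : Function.Bijective (actWord l) := by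
  induction l with
  | nil => exact Function.bijective_id
  | cons k l ih => exact (actE_bijective k).comp ih

/-- Words taking a fixed root line to all the root lines. -/
def transversal : Fin 40 → List (Fin 8) :=
  ![[3, 2, 2, 3], [3, 1, 0, 0, 1, 2, 2, 3], [1, 2, 2, 3, 1, 2, 2, 3], [], [0, 1, 1, 2, 3, 3],
    [1, 2, 2, 3], [0, 1, 1, 2, 3], [1, 1, 2, 3, 3], [0, 0, 1, 2, 2, 3], [1, 1, 2, 3],
    [2, 1, 1, 2, 3], [0, 1, 2, 2, 3], [0, 0, 1, 1, 2, 3], [1, 2, 3], [0, 1, 1, 2, 2, 3],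
    [1, 2, 3, 3], [0, 0, 1, 2, 3], [1, 1, 2, 2, 3], [0, 0, 1, 2, 3, 3], [0, 1, 2, 3],
    [3, 2, 1, 1, 2, 3], [0, 1, 2, 3, 3], [3], [3, 3], [2, 1, 0, 0, 1, 2, 3, 3], [2, 3],
    [2, 3, 3], [1, 0, 0, 1, 2, 2, 3], [2, 2, 3], [2, 2, 3, 3], [1, 0, 0, 1, 2, 3, 3],
    [3, 0, 1, 1, 2, 2, 3], [2, 3, 1, 2, 2, 3], [3, 1, 1, 2, 2, 3], [3, 0, 0, 1, 2, 2, 3],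
    [3, 1, 2, 2, 3], [3, 0, 1, 2, 2, 3], [2, 3, 0, 1, 1, 2, 2, 3], [2, 2, 3, 1, 2, 2, 3],
    [2, 3, 1, 1, 2, 2, 3]]

lemma transversal_lt : ∀ i, ∀ k ∈ transversal i, k < 4 := by decide +kernel

lemma actWord_transversal : ∀ i, (actWord (transversal i) (0, 3)).2 = i := by decide +kernel

lemma eq_three_of_lineE_eq_zero :
    ∀ i : Fin 40, lineE i 0 = 0 ∧ lineE i 1 = 0 ∧ lineE i 2 = 0 → i = 3 := by
  decide +kernel

lemma eq_of_unit_pow_eq :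
    ∀ a b : ZMod 6, (⟨0, -1⟩ : Eis) ^ a.val = ⟨0, -1⟩ ^ b.val → a = b := by
  decide +kernel

lemma neg_ω_ne_zero : -ω ≠ 0 := fun h => by
  have := neg_ω_pow_six
  rw [h] at this
  norm_num at this

lemma snd_eq_three {c : ℂ} {y : ZMod 6 × Fin 40} (h : rootVec y = c • rootVec (0, 3)) :
    y.2 = 3 := by
  have h0 : ∀ j : Fin 4, lineE 3 j = 0 → lineE y.2 j = 0 := by
    intro j hj
    have := congrFun h j
    simp only [rootVec, Pi.smul_apply, hj, map_zero, mul_zero, smul_zero] at this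
    exact eisToC_injective ((mul_eq_zero.1 this).resolve_left
      (pow_ne_zero _ neg_ω_ne_zero) |>.trans (map_zero _).symm)
  exact eq_three_of_lineE_eq_zero _ ⟨h0 0 rfl, h0 1 rfl, h0 2 rfl⟩

lemma rootVec_eq_smul (m : ZMod 6) (i : Fin 40) : rootVec (m, i) = (-ω) ^ m.val • rootVec (0, i) := by
  funext j
  simp [rootVec]

lemma mulVec_injective (g : GL (Fin 4) ℂ) :
    Function.Injective fun v => (g : Matrix (Fin 4) (Fin 4) ℂ) *ᵥ v :=
  Matrix.mulVec_injective_iff_isUnit.2 g.isUnit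

lemma exists_actWord_transversal (x : ZMod 6 × Fin 40) :
    ∃ m : ZMod 6, actWord (transversal x.2) (m, 3) = x := by
  refine ⟨x.1 - (actWord (transversal x.2) (0, 3)).1, ?_⟩
  rw [actWord_mk]
  exact Prod.ext (sub_add_cancel _ _) (actWord_transversal x.2)

lemma rootVec_three_apply (m : ZMod 6) : rootVec (m, 3) 3 = (-ω) ^ m.val * (1 + 2 * ω) := by
  have h : rootVec (0, 3) = _ := rootVec_coord 3
  rw [rootVec_eq_smul, h]
  simp

lemma neg_ω_pow_val_injective {a b : ZMod 6} (h : (-ω) ^ a.val = (-ω) ^ b.val) : a = b := by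
  rw [← eisToC_unit_pow, ← eisToC_unit_pow] at h
  exact eq_of_unit_pow_eq _ _ (eisToC_injective h)

/-- Transitivity on the lines moves the first root to a multiple of root 3. That line is the only
one of the 40 on which the first three coordinates vanish, and there the last coordinate determines
the sixth root of unity. -/
lemma rootVec_injective : Function.Injective rootVec := by
  intro x y hxy
  obtain ⟨m, hm⟩ := exists_actWord_transversal x
  obtain ⟨y', hy⟩ := (actWord_bijective (transversal x.2)).surjective y
  have h : rootVec (m, 3) = rootVec y' := by
    apply mulVec_injective (evalWord (transversal x.2))
    simp only [evalWord_mulVec_rootVec, hm, hy, hxy]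
  obtain ⟨n, i⟩ := y'
  obtain rfl : i = 3 := snd_eq_three (y := (n, i)) (h.symm.trans (rootVec_eq_smul m 3))
  have h3 := congrFun h 3
  rw [rootVec_three_apply, rootVec_three_apply] at h3
  rw [← hm, ← hy, neg_ω_pow_val_injective (mul_right_cancel₀ theta_ne_zero h3)]

end QuotG25920

end

noncomputable section

open CategoryTheory AlgebraicGeometry MvPolynomial
open scoped Matrix

namespace QuotG25920

/-! ### The groups in terms of the generators -/

lemma mem_ST32_gens_iff (g : GL (Fin 4) ℂ) :
    (∃ i, (g : Matrix (Fin 4) (Fin 4) ℂ) = reflMatrix (root32 i)) ↔ g ∈ gen '' {k | k < 4} := by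
  constructor
  · rintro ⟨i, hi⟩
    refine ⟨Fin.castAdd 4 i, i.2, Units.ext ?_⟩
    rw [hi, coe_gen]
    fin_cases i <;> rfl
  · rintro ⟨k, hk, rfl⟩
    fin_cases k
    · exact ⟨0, rfl⟩
    · exact ⟨1, rfl⟩
    · exact ⟨2, rfl⟩
    · exact ⟨3, rfl⟩
    all_goals exact absurd hk (by decide)

lemma ST32_eq : ST32 = Subgroup.closure (gen '' {k | k < 4}) :=
  congrArg _ (Set.ext mem_ST32_gens_iff)

lemma mem_G25920_gens_iff (g : GL (Fin 4) ℂ) :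
    ((g : Matrix (Fin 4) (Fin 4) ℂ) = blichfeldtC ∨ (g : Matrix (Fin 4) (Fin 4) ℂ) = blichfeldtD ∨
      (g : Matrix (Fin 4) (Fin 4) ℂ) = blichfeldtV ∨
      (g : Matrix (Fin 4) (Fin 4) ℂ) = blichfeldtF) ↔ g ∈ gen '' {k | 4 ≤ k} := by
  constructor
  · rintro (h | h | h | h)
    · exact ⟨4, by decide, Units.ext h.symm⟩
    · exact ⟨5, by decide, Units.ext h.symm⟩
    · exact ⟨6, by decide, Units.ext h.symm⟩
    · exact ⟨7, by decide, Units.ext h.symm⟩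
  · rintro ⟨k, hk, rfl⟩
    fin_cases k
    iterate 4 exact absurd hk (by decide)
    · exact Or.inl rfl
    · exact Or.inr (Or.inl rfl)
    · exact Or.inr (Or.inr (Or.inl rfl))
    · exact Or.inr (Or.inr (Or.inr rfl))

lemma G25920_eq : G25920 = Subgroup.closure (gen '' {k | 4 ≤ k}) :=
  congrArg _ (Set.ext mem_G25920_gens_iff)

lemma gen_mem_ST32 {k : Fin 8} (hk : k < 4) : gen k ∈ ST32 :=
  ST32_eq ▸ Subgroup.subset_closure ⟨k, hk, rfl⟩

lemma gen_mem_G25920 {k : Fin 8} (hk : 4 ≤ k) : gen k ∈ G25920 :=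
  G25920_eq ▸ Subgroup.subset_closure ⟨k, hk, rfl⟩

lemma evalWord_mem_ST32 {l : List (Fin 8)} (hl : ∀ k ∈ l, k < 4) : evalWord l ∈ ST32 :=
  evalWord_mem fun k hk => gen_mem_ST32 (hl k hk)

lemma evalWord_mem_G25920 {l : List (Fin 8)} (hl : ∀ k ∈ l, 4 ≤ k) : evalWord l ∈ G25920 :=
  evalWord_mem fun k hk => gen_mem_G25920 (hl k hk)

lemma gen_pow (k : Fin 8) : gen k ^ 12 = 1 := Units.ext (genMat_pow k)

/-- The generators have finite order, so the subgroup they generate is already the submonoid: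
inverses are not needed in words. -/
lemma exists_evalWord_eq {S : Set (Fin 8)} {g : GL (Fin 4) ℂ}
    (hg : g ∈ Subgroup.closure (gen '' S)) : ∃ l : List (Fin 8), (∀ k ∈ l, k ∈ S) ∧ evalWord l = g := by
  rw [← Subgroup.mem_toSubmonoid, Subgroup.closure_toSubmonoid_of_isOfFinOrder] at hg
  · induction hg using Submonoid.closure_induction with
    | mem x hx =>
      obtain ⟨k, hk, rfl⟩ := hx
      exact ⟨[k], by simpa using hk, by simp [evalWord]⟩
    | one => exact ⟨[], by simp, by simp [evalWord]⟩
    | mul x y _ _ ihx ihy =>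
      obtain ⟨l, hl, rfl⟩ := ihx
      obtain ⟨l', hl', rfl⟩ := ihy
      exact ⟨l ++ l', fun k hk => (List.mem_append.1 hk).elim (hl k) (hl' k), by simp [evalWord]⟩
  · rintro _ ⟨k, -, rfl⟩
    exact isOfFinOrder_iff_pow_eq_one.2 ⟨12, by norm_num, gen_pow k⟩

lemma exists_mulVec_rootVec {w : GL (Fin 4) ℂ} (hw : w ∈ ST32) (x : ZMod 6 × Fin 40) :
    ∃ y, (w : Matrix (Fin 4) (Fin 4) ℂ) *ᵥ rootVec x = rootVec y := by
  rw [ST32_eq] at hw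
  obtain ⟨l, -, rfl⟩ := exists_evalWord_eq hw
  exact ⟨_, evalWord_mulVec_rootVec l x⟩

/-- An element is determined by the images of the four coordinate roots, which lie in a finite set.
-/
instance finite_ST32 : Finite ST32 := by
  choose f hf using fun (w : ST32) (i : Fin 4) =>
    exists_mulVec_rootVec w.2 (0, Fin.castLE (by norm_num) i)
  refine Finite.of_injective f fun v w h => Subtype.ext (Units.ext (matrix_ext_rootVec fun i => ?_))
  rw [hf, hf, h]

/-! ### Relations between words -/

lemma coe_evalWord_eq_smul {l l' : List (Fin 8)} {m : ZMod 6}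
    (h : ∀ i : Fin 4, actWord l (0, Fin.castLE (by norm_num) i) =
      (m + (actWord l' (0, Fin.castLE (by norm_num) i)).1,
        (actWord l' (0, Fin.castLE (by norm_num) i)).2)) :
    (evalWord l : Matrix (Fin 4) (Fin 4) ℂ) = (-ω) ^ m.val • (evalWord l').1 := by
  refine matrix_ext_rootVec fun i => ?_
  rw [evalWord_mulVec_rootVec, h, Matrix.smul_mulVec, evalWord_mulVec_rootVec]
  generalize actWord l' _ = y
  rw [rootVec_eq_smul, neg_ω_pow_val_add, mul_smul, ← rootVec_eq_smul]

lemma evalWord_eq {l l' : List (Fin 8)}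
    (h : ∀ i : Fin 4, actWord l (0, Fin.castLE (by norm_num) i) =
      actWord l' (0, Fin.castLE (by norm_num) i)) : evalWord l = evalWord l' :=
  Units.ext (matrix_ext_rootVec fun i => by
    rw [evalWord_mulVec_rootVec, h, evalWord_mulVec_rootVec])

lemma evalWord_singleton (k : Fin 8) : evalWord [k] = gen k := by simp [evalWord]

/-- Words in the generators of the Shephard–Todd group for the generators of Blichfeldt's group. -/
def wordInST32 : Fin 4 → List (Fin 8) :=
  ![[3, 2, 2, 3, 1, 0, 0, 1, 2, 2, 3, 1, 0, 0, 1, 2, 2, 3, 2, 0, 0],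
    [2, 1, 0, 0, 1, 2, 1, 0, 0, 1, 0, 0],
    [1, 2, 2, 3, 1, 1, 2, 2, 1],
    [3, 2, 2, 3, 1, 0, 0, 1, 2, 2, 3, 1, 2, 0, 1, 1, 2, 3, 3, 2, 0, 1, 1, 0]]

/-- Words in the generators of Blichfeldt's group that agree up to a scalar with the generators
of the Shephard–Todd group. -/
def wordInG25920 : Fin 4 → List (Fin 8) :=
  ![[5, 5, 4], [4, 6, 7, 6, 7, 6, 5, 6, 7, 4, 4], [7, 4, 4, 7, 4, 4], [4, 7, 4, 6, 4, 7, 4]]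

lemma evalWord_wordInST32 (k : Fin 4) : evalWord (wordInST32 k) = gen (Fin.natAdd 4 k) := by
  rw [← evalWord_singleton]
  refine evalWord_eq ?_
  revert k
  decide +kernel

lemma wordInG25920_ge : ∀ j, ∀ k ∈ wordInG25920 j, 4 ≤ k := by decide

lemma gen_eq_smul_evalWord (k : Fin 4) :
    genMat (Fin.castAdd 4 k) = ω • (evalWord (wordInG25920 k)).1 := by
  have h : (evalWord [Fin.castAdd 4 k]).1 = (-ω) ^ (4 : ZMod 6).val • (evalWord (wordInG25920 k)).1 :=
    coe_evalWord_eq_smul (by revert k; decide +kernel)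
  rw [evalWord_singleton, coe_gen] at h
  rw [h]
  congr 1
  change (-ω) ^ 4 = ω
  linear_combination ω * ω_pow_three

lemma G25920_le_ST32 : G25920 ≤ ST32 := by
  rw [G25920_eq, Subgroup.closure_le]
  rintro _ ⟨k, hk, rfl⟩
  obtain ⟨j, rfl⟩ : ∃ j : Fin 4, Fin.natAdd 4 j = k := by
    revert k
    decide
  rw [← evalWord_wordInST32]
  exact evalWord_mem_ST32 (by revert j; decide)

instance finite_G25920 : Finite G25920 :=
  Finite.of_injective _ (Subgroup.inclusion_injective G25920_le_ST32)

/-- Each generating reflection is ω times an element of `G25920`, and scalars can be collected in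
front of a word. Everything proved about one of the two groups passes to the other through this
lemma. -/
lemma exists_mem_G25920_smul {w : GL (Fin 4) ℂ} (hw : w ∈ ST32) :
    ∃ g ∈ G25920, ∃ c : ℂ, c ^ 3 = 1 ∧
      (w : Matrix (Fin 4) (Fin 4) ℂ) = c • (g : Matrix (Fin 4) (Fin 4) ℂ) := by
  rw [ST32_eq] at hw
  obtain ⟨l, -, rfl⟩ := exists_evalWord_eq hw
  clear hw
  induction l with
  | nil => exact ⟨1, one_mem _, 1, one_pow _, by simp [evalWord]⟩
  | cons k l ih =>
    obtain ⟨g, hg, c, hc, h⟩ := ih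
    have hmul : (evalWord (k :: l) : Matrix (Fin 4) (Fin 4) ℂ) = genMat k * (evalWord l).1 := by
      simp [evalWord]
    rcases lt_or_ge k 4 with hk | hk
    · obtain ⟨j, rfl⟩ : ∃ j : Fin 4, Fin.castAdd 4 j = k := ⟨⟨k, hk⟩, rfl⟩
      refine ⟨evalWord (wordInG25920 j) * g,
        mul_mem (evalWord_mem_G25920 (wordInG25920_ge j)) hg, ω * c, ?_, ?_⟩
      · rw [mul_pow, hc, ω_pow_three, one_mul]
      · rw [hmul, h, gen_eq_smul_evalWord, Units.val_mul, smul_mul_smul_comm]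
    · refine ⟨gen k * g, mul_mem (gen_mem_G25920 hk) hg, c, hc, ?_⟩
      rw [hmul, h, Units.val_mul, coe_gen, mul_smul_comm]

/-! ### Scalar elements and transitivity -/

/-- A word for a central element. -/
def centralWord (m : ZMod 6) : List (Fin 8) :=
  -- The fifth power of the product of the four generators is the scalar (-ω)⁵ = (-ω)⁻¹. Its power
  -- with exponent 5m ≡ -m modulo 6 is (-ω)ᵐ.
  (List.replicate (5 * (5 * m).val) [0, 1, 2, 3]).flatten

lemma actWord_centralWord : ∀ m : ZMod 6, ∀ i : Fin 4,
    actWord (centralWord m) (0, Fin.castLE (by norm_num) i) =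
      (m, Fin.castLE (by norm_num) i) := by
  decide +kernel

lemma centralWord_lt : ∀ m, ∀ k ∈ centralWord m, k < 4 := by decide +kernel

lemma coe_evalWord_centralWord (m : ZMod 6) :
    (evalWord (centralWord m) : Matrix (Fin 4) (Fin 4) ℂ) = (-ω) ^ m.val • 1 := by
  have h := coe_evalWord_eq_smul (l := centralWord m) (l' := []) (m := m) fun i => by
    rw [actWord_centralWord]
    simp [actWord]
  simpa [evalWord] using h

lemma exists_word (y : ZMod 6 × Fin 40) :
    ∃ l : List (Fin 8), (∀ k ∈ l, k < 4) ∧ actWord l (0, 3) = y := by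
  obtain ⟨m, hm⟩ := exists_actWord_transversal y
  refine ⟨transversal y.2 ++ centralWord m, fun k hk => ?_, ?_⟩
  · rcases List.mem_append.1 hk with hk | hk
    · exact transversal_lt _ _ hk
    · exact centralWord_lt _ _ hk
  · have h : actWord (centralWord m) (0, 3) = (m, 3) := actWord_centralWord m 3
    rw [actWord, List.foldr_append]
    change actWord _ (actWord _ _) = _
    rw [h, hm]

lemma exists_mem_ST32_mulVec_rootVec (x y : ZMod 6 × Fin 40) :
    ∃ w ∈ ST32, (w : Matrix (Fin 4) (Fin 4) ℂ) *ᵥ rootVec x = rootVec y := by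
  obtain ⟨l, hl, rfl⟩ := exists_word x
  obtain ⟨l', hl', rfl⟩ := exists_word y
  refine ⟨evalWord l' * (evalWord l)⁻¹, mul_mem (evalWord_mem_ST32 hl')
    (inv_mem (evalWord_mem_ST32 hl)), ?_⟩
  rw [← evalWord_mulVec_rootVec, ← evalWord_mulVec_rootVec, Matrix.mulVec_mulVec,
    ← Units.val_mul, inv_mul_cancel_right]

/-! ### The order -/

/-- The easy half of orbit counting: elements moving v to different vectors lie in different cosets
of any subgroup fixing v. -/
lemma card_mul_card_le {H' H : Subgroup (GL (Fin 4) ℂ)} [Finite H] (hle : H' ≤ H)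
    {v : Fin 4 → ℂ} (hfix : ∀ h ∈ H', (h : Matrix (Fin 4) (Fin 4) ℂ) *ᵥ v = v)
    {ι : Type*} [Fintype ι] (t : ι → GL (Fin 4) ℂ) (ht : ∀ i, t i ∈ H)
    (hinj : Function.Injective fun i => (t i : Matrix (Fin 4) (Fin 4) ℂ) *ᵥ v) :
    Fintype.card ι * Nat.card H' ≤ Nat.card H := by
  rw [← Nat.card_eq_fintype_card, ← Nat.card_prod]
  refine Nat.card_le_card_of_injective
    (fun p : ι × H' => (⟨t p.1 * p.2, mul_mem (ht _) (hle p.2.2)⟩ : H)) ?_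
  rintro ⟨i, h⟩ ⟨i', h'⟩ heq
  have heq : t i * h = t i' * h' := congrArg Subtype.val heq
  have hv : ∀ (i : ι) (h : H'),
      ((t i * h : GL (Fin 4) ℂ) : Matrix (Fin 4) (Fin 4) ℂ) *ᵥ v = (t i).1 *ᵥ v := fun i h => by
    rw [Units.val_mul, ← Matrix.mulVec_mulVec, hfix _ h.2]
  obtain rfl : i = i' := hinj ((hv i h).symm.trans
    ((congrArg (fun g : GL (Fin 4) ℂ => g.1 *ᵥ v) heq).trans (hv i' h')))
  rw [mul_left_cancel_iff, SetLike.coe_eq_coe] at heq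
  rw [heq]

/-- The subgroup generated by the first `n` generators. -/
def chain (n : ℕ) : Subgroup (GL (Fin 4) ℂ) := Subgroup.closure (gen '' {k | (k : ℕ) < n})

lemma chain_mono {m n : ℕ} (h : m ≤ n) : chain m ≤ chain n :=
  Subgroup.closure_mono (Set.image_mono fun _ hk => lt_of_lt_of_le hk h)

lemma chain_four : chain 4 = ST32 := ST32_eq.symm

lemma card_mul_card_chain_le {n : ℕ} (hn : n < 4) {x : ZMod 6 × Fin 40}
    (hfix : ∀ k : Fin 8, (k : ℕ) < n → actE k x = x) {ι : Type*} [Fintype ι]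
    (t : ι → List (Fin 8)) (ht : ∀ i, ∀ k ∈ t i, (k : ℕ) < n + 1)
    (hinj : Function.Injective fun i => actWord (t i) x) :
    Fintype.card ι * Nat.card (chain n) ≤ Nat.card (chain (n + 1)) := by
  have : Finite (chain (n + 1)) :=
    Finite.of_injective _ (Subgroup.inclusion_injective (chain_four ▸ chain_mono hn))
  refine card_mul_card_le (v := rootVec x) (chain_mono n.le_succ) (fun h hh => ?_)
    (fun i => evalWord (t i))
    (fun i => evalWord_mem fun k hk => Subgroup.subset_closure ⟨k, ht i k hk, rfl⟩) ?_
  · induction hh using Subgroup.closure_induction with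
    | mem g hg =>
      obtain ⟨k, hk, rfl⟩ := hg
      rw [coe_gen, genMat_mulVec_rootVec, hfix k hk]
    | one => simp
    | mul a b _ _ iha ihb => rw [Units.val_mul, ← Matrix.mulVec_mulVec, ihb, iha]
    | inv a _ iha =>
      apply mulVec_injective a
      change a.1 *ᵥ _ = a.1 *ᵥ _
      rw [Matrix.mulVec_mulVec, ← Units.val_mul, mul_inv_cancel, iha]
      simp
  · simp only [evalWord_mulVec_rootVec]
    exact rootVec_injective.comp hinj

/-- In this and the next three lemmas, a root fixed by the smaller subgroup is moved to 3, 8, 27 and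
240 different roots by words for the larger one. The product 3·8·27·240 equals 25920·6. -/
lemma card_chain_one : 3 * Nat.card (chain 0) ≤ Nat.card (chain 1) :=
  card_mul_card_chain_le (x := (0, 2)) (by norm_num) (by decide) (ι := Fin 3)
    ![[], [0], [0, 0]] (by decide) (by decide +kernel)

lemma card_chain_two : 8 * Nat.card (chain 1) ≤ Nat.card (chain 2) :=
  card_mul_card_chain_le (x := (0, 0)) (by norm_num) (by decide +kernel) (ι := Fin 8)
    ![[], [1], [0, 1], [1, 1], [0, 0, 1], [0, 1, 1], [1, 0, 0, 1], [0, 0, 1, 1]]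
    (by decide +kernel) (by decide +kernel)

lemma card_chain_three : 27 * Nat.card (chain 2) ≤ Nat.card (chain 3) :=
  card_mul_card_chain_le (x := (0, 22)) (by norm_num) (by decide +kernel) (ι := Fin 27)
    ![[], [2], [1, 2], [2, 2], [0, 1, 2], [1, 1, 2], [1, 2, 2], [0, 0, 1, 2], [0, 1, 1, 2],
      [2, 1, 1, 2], [0, 1, 2, 2], [1, 1, 2, 2], [1, 0, 0, 1, 2], [0, 0, 1, 1, 2],
      [2, 0, 1, 1, 2], [0, 0, 1, 2, 2], [0, 1, 1, 2, 2], [2, 1, 0, 0, 1, 2],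
      [2, 0, 0, 1, 1, 2], [1, 2, 0, 1, 1, 2], [1, 0, 0, 1, 2, 2], [0, 0, 1, 1, 2, 2],
      [1, 2, 0, 0, 1, 1, 2], [1, 1, 2, 0, 1, 1, 2], [2, 1, 0, 0, 1, 2, 2],
      [0, 1, 1, 2, 0, 1, 1, 2], [2, 2, 1, 0, 0, 1, 2, 2]]
    (by decide +kernel) (by decide +kernel)

lemma card_chain_four : 240 * Nat.card (chain 3) ≤ Nat.card (chain 4) := by
  choose t ht htx using exists_word
  have h := card_mul_card_chain_le (n := 3) (x := (0, 3)) (by norm_num) (by decide +kernel)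
    (ι := ZMod 6 × Fin 40) t (fun y k hk => ht y k hk) (fun y z h => by simpa only [htx] using h)
  simpa [ZMod.card] using h

lemma le_card_ST32 : 25920 * 6 ≤ Nat.card ST32 := by
  have h0 : 0 < Nat.card (chain 0) := by
    have : Finite (chain 0) :=
      Finite.of_injective _ (Subgroup.inclusion_injective ((chain_mono (Nat.zero_le 4)).trans chain_four.le))
    exact Nat.card_pos
  have h1 := card_chain_one
  have h2 := card_chain_two
  have h3 := card_chain_three
  have h4 := card_chain_four
  rw [chain_four] at h4
  omega

end QuotG25920

end

noncomputable section

open CategoryTheory AlgebraicGeometry MvPolynomial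
open scoped Matrix

namespace QuotG25920

/-! ### The invariants -/

/-- The linear form with given coefficients. -/
def linForm (v : Fin 4 → ℂ) : MvPolynomial (Fin 4) ℂ := ∑ j, C (v j) * X j

lemma subst_linForm (g : GL (Fin 4) ℂ) (v : Fin 4 → ℂ) :
    subst g (linForm v) = linForm ((g : Matrix (Fin 4) (Fin 4) ℂ)ᵀ *ᵥ v) := by
  simp only [linForm, subst, map_sum, map_mul, algHom_C, aeval_X, Matrix.mulVec, dotProduct,
    Matrix.transpose_apply, Finset.mul_sum, Finset.sum_mul, algebraMap_eq]
  rw [Finset.sum_comm]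
  refine Finset.sum_congr rfl fun i _ => Finset.sum_congr rfl fun j _ => ?_
  ring

lemma linForm_isHomogeneous (v : Fin 4 → ℂ) : (linForm v).IsHomogeneous 1 :=
  IsHomogeneous.sum _ _ _ fun _ _ => isHomogeneous_C_mul_X _ _

lemma transpose_reflMatrix (a : Fin 4 → ℂ) : (reflMatrix a)ᵀ = reflMatrix a := by
  rw [reflMatrix, Matrix.transpose_sub, Matrix.transpose_smul, Matrix.transpose_one,
    Matrix.transpose_vecMulVec]

/-- Substitution acts on coefficient vectors of linear forms by the transpose. Since the generating
reflections are symmetric, they permute the root forms just as they permute the roots. -/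
lemma transpose_genMat {k : Fin 8} (hk : k < 4) : (genMat k)ᵀ = genMat k := by
  obtain ⟨j, rfl⟩ : ∃ j : Fin 4, Fin.castAdd 4 j = k := ⟨⟨k, hk⟩, rfl⟩
  have h : genMat (Fin.castAdd 4 j) = reflMatrix (root32 j) := by fin_cases j <;> rfl
  rw [h, transpose_reflMatrix]

/-- The sum of the `d`-th powers of the linear forms given by the roots. -/
def powerSum (d : ℕ) : MvPolynomial (Fin 4) ℂ := ∑ x, linForm (rootVec x) ^ d

lemma powerSum_isHomogeneous (d : ℕ) : (powerSum d).IsHomogeneous d :=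
  IsHomogeneous.sum _ _ _ fun x _ => by simpa using (linForm_isHomogeneous (rootVec x)).pow d

lemma subst_powerSum {w : GL (Fin 4) ℂ} (hw : w ∈ ST32) (d : ℕ) :
    subst w (powerSum d) = powerSum d := by
  rw [ST32_eq] at hw
  induction hw using Subgroup.closure_induction with
  | mem g hg =>
    obtain ⟨k, hk, rfl⟩ := hg
    simp only [powerSum, map_sum, map_pow, subst_linForm, coe_gen, transpose_genMat hk,
      genMat_mulVec_rootVec]
    exact Fintype.sum_bijective _ (actE_bijective k) _ _ fun _ => rfl
  | one => exact subst_one _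
  | mul a b _ _ iha ihb => rw [← subst_comp, iha, ihb]
  | inv a _ iha =>
    conv_lhs => rw [← iha]
    rw [subst_comp, mul_inv_cancel, subst_one]

/-- The degrees of the Shephard–Todd group No. 32. -/
def degrees : Fin 4 → ℕ := ![12, 18, 24, 30]

/-- Basic invariants of the Shephard–Todd group No. 32. -/
def basicInvariant (i : Fin 4) : MvPolynomial (Fin 4) ℂ := powerSum (degrees i)

lemma basicInvariant_mem (i : Fin 4) : basicInvariant i ∈ invariantSubalgebra ST32 :=
  fun _ hw => subst_powerSum hw _

/-! ### The Jacobian of the invariants -/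

/-- The roots, with entries in the Eisenstein integers. -/
def rootE (x : ZMod 6 × Fin 40) (j : Fin 4) : Eis := (⟨0, -1⟩ : Eis) ^ x.1.val * lineE x.2 j

lemma eisToC_rootE (x : ZMod 6 × Fin 40) (j : Fin 4) : eisToC (rootE x j) = rootVec x j := by
  rw [rootE, map_mul, eisToC_unit_pow, rootVec]

/-- A point at which the Jacobian of the basic invariants does not vanish. -/
def testPoint : Fin 4 → ℕ := ![1, 2, 5, 7]

/-- The Jacobian matrix of the basic invariants at the test point. -/
def jacobianE : Matrix (Fin 4) (Fin 4) Eis :=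
  Matrix.of fun i j => (degrees i : Eis) *
    ∑ x, (∑ l, rootE x l * testPoint l) ^ (degrees i - 1) * rootE x j

lemma eval_pderiv_basicInvariant (i j : Fin 4) :
    eval (fun l => (testPoint l : ℂ)) (pderiv j (basicInvariant i)) =
      eisToC (jacobianE i j) := by
  have h : ∀ v : Fin 4 → ℂ, pderiv j (linForm v) = C (v j) := fun v => by
    simp [linForm, pderiv_X, Pi.single_apply, Derivation.leibniz]
  have h' : ∀ v : Fin 4 → ℂ, eval (fun l => (testPoint l : ℂ)) (linForm v) =
      ∑ l, v l * testPoint l := fun v => by simp [linForm]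
  simp only [basicInvariant, powerSum, map_sum, Derivation.leibniz_pow, h, h', jacobianE,
    Matrix.of_apply, map_mul, map_pow, map_natCast, eisToC_rootE, smul_eq_mul, nsmul_eq_mul,
    eval_C, Finset.mul_sum]

/-- Reduction of the Eisenstein integers modulo a prime above `37`. -/
def eisToZMod : Eis →+* ZMod 37 :=
  -- 10 is a root of x² + x + 1 modulo 37, as 111 = 3·37. Accordingly -ω reduces to 27 below.
  (QuadraticAlgebra.lift ⟨10, by decide⟩ : Eis →ₐ[ℤ] ZMod 37)

lemma eisToZMod_mk (a b : ℤ) : eisToZMod ⟨a, b⟩ = a + b * 10 := by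
  simp [eisToZMod, QuadraticAlgebra.lift]

/-- The reductions of the roots modulo a prime above `37`. -/
def rootN (x : ZMod 6 × Fin 40) (j : Fin 4) : ℕ :=
  27 ^ x.1.val * (((lineE x.2 j).re + (lineE x.2 j).im * 10) % 37).toNat

lemma eisToZMod_rootE (x : ZMod 6 × Fin 40) (j : Fin 4) :
    eisToZMod (rootE x j) = rootN x j := by
  have h1 : eisToZMod ⟨0, -1⟩ = 27 := by rw [eisToZMod_mk]; decide
  have h2 : ∀ z : ℤ, (((z % 37).toNat : ℕ) : ZMod 37) = z := fun z => by
    rw [← Int.cast_natCast, Int.toNat_of_nonneg (Int.emod_nonneg _ (by norm_num))]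
    exact ZMod.intCast_mod z 37
  rw [rootE, map_mul, map_pow, h1, rootN, Nat.cast_mul, Nat.cast_pow, h2]
  congr 1
  push_cast
  rw [← eisToZMod_mk]

/-- The Jacobian matrix of the basic invariants, reduced modulo `37`. -/
def jacobianN : Matrix (Fin 4) (Fin 4) ℕ :=
  !![14, 24, 31, 33; 0, 10, 34, 31; 29, 20, 2, 11; 26, 8, 12, 33]

lemma jacobianN_eq (i j : Fin 4) : (degrees i *
    ∑ x, (∑ l, rootN x l * testPoint l) ^ (degrees i - 1) * rootN x j) % 37 =
      jacobianN i j := by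
  fin_cases i <;> fin_cases j <;> decide +kernel

lemma eisToZMod_jacobianE (i j : Fin 4) : eisToZMod (jacobianE i j) = jacobianN i j := by
  rw [← jacobianN_eq, ZMod.natCast_mod, jacobianE, Matrix.of_apply]
  push_cast
  simp only [map_mul, map_sum, map_pow, map_natCast, eisToZMod_rootE]

/-- An explicit inverse modulo 37 replaces the evaluation of the determinant. -/
lemma det_jacobianN_ne_zero : (jacobianN.map (Nat.cast : ℕ → ZMod 37)).det ≠ 0 := by
  have h : jacobianN.map (Nat.cast : ℕ → ZMod 37) *
      !![34, 24, 34, 5; 1, 30, 9, 25; 9, 23, 10, 21; 28, 26, 10, 25] = 1 := by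
    decide +kernel
  intro h0
  have := congrArg Matrix.det h
  rw [Matrix.det_mul, h0, zero_mul, Matrix.det_one] at this
  exact absurd this (by decide)

lemma algebraicIndependent_basicInvariant : AlgebraicIndependent ℂ basicInvariant := by
  refine algebraicIndependent_of_jacobian _ fun h => ?_
  have h1 : (jacobianE.map eisToC).det = 0 := by
    have h2 := congrArg (eval fun l => (testPoint l : ℂ)) h
    rw [map_zero, RingHom.map_det] at h2
    rw [← h2]
    congr 1
    ext i j
    exact (eval_pderiv_basicInvariant i j).symm
  have h3 : jacobianE.det = 0 := by
    apply eisToC_injective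
    rw [map_zero, ← h1, RingHom.map_det]
    rfl
  apply det_jacobianN_ne_zero
  have h4 := congrArg eisToZMod h3
  rw [map_zero, RingHom.map_det] at h4
  rw [← h4]
  congr 1
  ext i j
  exact (eisToZMod_jacobianE i j).symm

/-! ### Orders and degrees -/

lemma degrees_pos (i : Fin 4) : 0 < degrees i := by fin_cases i <;> decide

lemma totalDegree_basicInvariant_le (i : Fin 4) : (basicInvariant i).totalDegree ≤ degrees i :=
  (powerSum_isHomogeneous _).totalDegree_le

/-- The bound from the orbits of roots and the bound by the product 12·18·24·30 of the degrees
coincide. -/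
theorem card_ST32 : Nat.card ST32 = 25920 * 6 := by
  refine le_antisymm ?_ le_card_ST32
  refine (card_le_prod_degree degrees_pos totalDegree_basicInvariant_le
    algebraicIndependent_basicInvariant basicInvariant_mem).trans ?_
  decide

lemma mem_range_aeval_basicInvariant_iff (p : MvPolynomial (Fin 4) ℂ) :
    p ∈ (aeval (R := ℂ) basicInvariant).range ↔ ∀ w ∈ ST32, subst w p = p := by
  constructor
  · rintro ⟨q, rfl⟩
    exact aeval_mem_invariantSubalgebra basicInvariant_mem q
  · exact mem_range_aeval_of_card_eq degrees_pos totalDegree_basicInvariant_le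
      algebraicIndependent_basicInvariant basicInvariant_mem (card_ST32.trans (by decide))

theorem hasDegrees_ST32 : HasDegrees ST32 ![12, 18, 24, 30] :=
  ⟨basicInvariant, fun _ => powerSum_isHomogeneous _, algebraicIndependent_basicInvariant,
    fun p => by
      rw [Algebra.adjoin_range_eq_range_aeval]
      exact mem_range_aeval_basicInvariant_iff p⟩

end QuotG25920

end

noncomputable section

open CategoryTheory AlgebraicGeometry MvPolynomial
open scoped Matrix

namespace QuotG25920

/-! ### Reflections -/

lemma ω_ne_zero : ω ≠ 0 := fun h => by simpa [h] using ω_pow_three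

lemma ω_ne_one : ω ≠ 1 := fun h => by
  have := ω_sq_add
  rw [h] at this
  norm_num at this

lemma isPrimitiveRoot_ω : IsPrimitiveRoot ω 3 := by
  rw [IsPrimitiveRoot.iff_orderOf]
  have : Fact (Nat.Prime 3) := ⟨Nat.prime_three⟩
  exact orderOf_eq_prime ω_pow_three ω_ne_one

/-- Words for the reflections along the coordinate axes. -/
def reflWord : Fin 4 → List (Fin 8) :=
  ![[1, 0, 0, 1, 2, 1, 0, 0, 1, 0], [2], [0],
    [3, 2, 2, 3, 1, 2, 0, 1, 1, 2, 3, 0, 1, 2, 2, 3, 2, 2, 0]]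

lemma reflWord_lt : ∀ i, ∀ k ∈ reflWord i, k < 4 := by decide

lemma actWord_reflWord : ∀ i j : Fin 4,
    actWord (reflWord i) (0, Fin.castLE (by norm_num) j) =
      (if j = i then 4 else 0, Fin.castLE (by norm_num) j) := by
  decide +kernel

lemma coe_evalWord_reflWord (i : Fin 4) :
    (evalWord (reflWord i) : Matrix (Fin 4) (Fin 4) ℂ) =
      Matrix.diagonal (Function.update 1 i ω) := by
  refine matrix_ext_rootVec fun j => ?_
  rw [evalWord_mulVec_rootVec, actWord_reflWord, rootVec_eq_smul, rootVec_coord,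
    Matrix.diagonal_mulVec_single, ← Pi.single_smul]
  congr 1
  by_cases h : j = i
  · subst h
    have h4 : (-ω) ^ (4 : ZMod 6).val = ω := by
      change (-ω) ^ 4 = ω
      linear_combination ω * ω_pow_three
    simp [h4]
  · simp [h]

lemma genMat_zero_eq : genMat 0 = Matrix.diagonal ![1, 1, ω, 1] := by
  have h := coe_evalWord_reflWord 2
  rw [show reflWord 2 = [0] from rfl, evalWord_singleton, coe_gen] at h
  rw [h]
  congr 1
  ext i
  fin_cases i <;> rfl

/-- The braid relation sts = tst says that st conjugates s to t. Determinant, quadratic relation and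
characteristic polynomial of every generator can then be read off from diag(1, 1, ω, 1). -/
lemma isConj_gen_succ (k : Fin 3) :
    IsConj (gen (Fin.castLE (by norm_num) k.castSucc)) (gen (Fin.castLE (by norm_num) k.succ)) := by
  rw [isConj_iff]
  refine ⟨gen (Fin.castLE (by norm_num) k.castSucc) * gen (Fin.castLE (by norm_num) k.succ), ?_⟩
  rw [mul_inv_eq_iff_eq_mul]
  have h := evalWord_eq (l := [Fin.castLE (by norm_num) k.castSucc,
    Fin.castLE (by norm_num) k.succ, Fin.castLE (by norm_num) k.castSucc])
    (l' := [Fin.castLE (by norm_num) k.succ, Fin.castLE (by norm_num) k.castSucc,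
      Fin.castLE (by norm_num) k.succ]) (by revert k; decide +kernel)
  simpa [evalWord, mul_assoc] using h

lemma isConj_gen {k : Fin 8} (hk : k < 4) : IsConj (gen 0) (gen k) := by
  have h1 := isConj_gen_succ 0
  have h2 := h1.trans (isConj_gen_succ 1)
  have h3 := h2.trans (isConj_gen_succ 2)
  fin_cases k
  · exact IsConj.refl _
  · exact h1
  · exact h2
  · exact h3
  all_goals exact absurd hk (by decide)

lemma det_gen {k : Fin 8} (hk : k < 4) : (gen k : Matrix (Fin 4) (Fin 4) ℂ).det = ω := by
  obtain ⟨c, hc⟩ := isConj_iff.1 (isConj_gen hk)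
  rw [← hc, Units.val_mul, Units.val_mul, Matrix.det_units_conj, coe_gen, genMat_zero_eq,
    Matrix.det_diagonal]
  simp [Fin.prod_univ_four]

lemma gen_sq {k : Fin 8} (hk : k < 4) : genMat k * genMat k = (1 + ω) • genMat k - ω • 1 := by
  obtain ⟨c, hc⟩ := isConj_iff.1 (isConj_gen hk)
  have h0 : genMat 0 * genMat 0 = (1 + ω) • genMat 0 - ω • 1 := by
    rw [genMat_zero_eq, Matrix.diagonal_mul_diagonal, ← Matrix.diagonal_one,
      ← Matrix.diagonal_smul, ← Matrix.diagonal_smul, Matrix.diagonal_sub]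
    congr 1
    ext i
    (fin_cases i <;> simp); ring
  have h1 : genMat k = c.1 * genMat 0 * c⁻¹.1 := congrArg Units.val hc.symm
  have h2 : c⁻¹.1 * c.1 = 1 := by rw [← Units.val_mul, inv_mul_cancel, Units.val_one]
  have h3 : c.1 * c⁻¹.1 = 1 := by rw [← Units.val_mul, mul_inv_cancel, Units.val_one]
  calc genMat k * genMat k = c.1 * genMat 0 * (c⁻¹.1 * c.1) * genMat 0 * c⁻¹.1 := by
        rw [h1]; simp only [mul_assoc]
    _ = c.1 * (genMat 0 * genMat 0) * c⁻¹.1 := by rw [h2, mul_one]; simp only [mul_assoc]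
    _ = _ := by
        rw [h0, h1, mul_sub, sub_mul, mul_smul_comm, smul_mul_assoc, mul_smul_comm, mul_one,
          smul_mul_assoc, h3]

lemma gen_pow_three {k : Fin 8} (hk : k < 4) : gen k ^ 3 = 1 := by
  have h : evalWord [k, k, k] = evalWord [] := evalWord_eq (by revert k; decide +kernel)
  simpa [evalWord, pow_succ, mul_assoc] using h

lemma orderOf_gen {k : Fin 8} (hk : k < 4) : orderOf (gen k) = 3 := by
  have : Fact (Nat.Prime 3) := ⟨Nat.prime_three⟩
  refine orderOf_eq_prime (gen_pow_three hk) fun h => ω_ne_one ?_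
  rw [← det_gen hk, h, Units.val_one, Matrix.det_one]

lemma isReflection_gen {k : Fin 8} (hk : k < 4) : IsReflection (gen k) := by
  refine ⟨isOfFinOrder_iff_pow_eq_one.2 ⟨3, by norm_num, gen_pow_three hk⟩, ?_⟩
  obtain ⟨c, hc⟩ := isConj_iff.1 (isConj_gen hk)
  have h : (Finset.univ.val.map (![1, 1, ω, 1] : Fin 4 → ℂ)) = {1, 1, ω, 1} := rfl
  have hr : (∏ i, (Polynomial.X - Polynomial.C ((![1, 1, ω, 1] : Fin 4 → ℂ) i))).roots =
      {1, 1, ω, 1} := by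
    rw [← h, ← Polynomial.roots_multiset_prod_X_sub_C (Multiset.map _ _), Multiset.map_map]
    rfl
  rw [← hc, Units.val_mul, Units.val_mul, Matrix.coe_units_inv, Matrix.charpoly_units_conj, coe_gen, genMat_zero_eq,
    Matrix.charpoly_diagonal, hr]
  simp [ω_ne_one.symm]

theorem ST32_eq_closure_reflections :
    ST32 = Subgroup.closure {g | g ∈ ST32 ∧ IsReflection g ∧ orderOf g = 3} := by
  refine le_antisymm ?_ (Subgroup.closure_le _ |>.2 fun g hg => hg.1)
  conv_lhs => rw [ST32_eq]
  refine Subgroup.closure_mono ?_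
  rintro _ ⟨k, hk, rfl⟩
  exact ⟨gen_mem_ST32 hk, isReflection_gen hk, orderOf_gen hk⟩

/-! ### Blichfeldt's group inside the reflection group -/

lemma mem_SLn_iff {n : ℕ} (g : GL (Fin n) ℂ) :
    g ∈ SLn n ↔ (g : Matrix (Fin n) (Fin n) ℂ).det = 1 := by
  rw [SLn, MonoidHom.mem_ker, ← Units.val_inj]
  rfl

lemma det_evalWord {l : List (Fin 8)} (hl : ∀ k ∈ l, k < 4) :
    (evalWord l : Matrix (Fin 4) (Fin 4) ℂ).det = ω ^ l.length := by
  induction l with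
  | nil => simp [evalWord]
  | cons k l ih =>
    have h : evalWord (k :: l) = gen k * evalWord l := by simp [evalWord]
    rw [h, Units.val_mul, Matrix.det_mul, det_gen (hl k (by simp)),
      ih fun j hj => hl j (by simp [hj]), List.length_cons, pow_succ']

lemma wordInST32_lt : ∀ j, ∀ k ∈ wordInST32 j, k < 4 := by decide

/-- Every reflection has determinant ω, and the words for Blichfeldt's generators have lengths
divisible by 3. -/
lemma G25920_le_SLn : G25920 ≤ SLn 4 := by
  rw [G25920_eq, Subgroup.closure_le]
  rintro _ ⟨k, hk, rfl⟩
  obtain ⟨j, rfl⟩ : ∃ j : Fin 4, Fin.natAdd 4 j = k := by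
    revert k
    decide
  rw [SetLike.mem_coe, ← evalWord_wordInST32, mem_SLn_iff, det_evalWord (wordInST32_lt j)]
  exact (isPrimitiveRoot_ω.pow_eq_one_iff_dvd _).2 (by revert j; decide)

lemma det_eq_one_of_mem {g : GL (Fin 4) ℂ} (hg : g ∈ G25920) :
    (g : Matrix (Fin 4) (Fin 4) ℂ).det = 1 := (mem_SLn_iff g).1 (G25920_le_SLn hg)

theorem G25920_eq_inf : G25920 = ST32 ⊓ SLn 4 := by
  refine le_antisymm (le_inf G25920_le_ST32 G25920_le_SLn) ?_
  rintro w ⟨hw, hdet⟩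
  obtain ⟨g, hg, c, hc, h⟩ := exists_mem_G25920_smul hw
  have h1 := (mem_SLn_iff w).1 hdet
  rw [h, Matrix.det_smul, det_eq_one_of_mem hg, mul_one, Fintype.card_fin] at h1
  have hc1 : c = 1 := by linear_combination h1 - c * hc
  rw [hc1, one_smul] at h
  rwa [Units.ext h]

theorem card_G25920 : Nat.card G25920 = 25920 * 2 := by
  let z : GL (Fin 4) ℂ := evalWord (centralWord 4)
  have hz : z.1 = ω • 1 := by
    rw [coe_evalWord_centralWord]
    congr 1
    change (-ω) ^ 4 = ω
    linear_combination ω * ω_pow_three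
  have hzj : ∀ (j : ℕ) (g : GL (Fin 4) ℂ), (z ^ j * g).1 = ω ^ j • g.1 := fun j g => by
    rw [Units.val_mul, Units.val_pow_eq_pow_val, hz, smul_pow, one_pow, smul_mul_assoc, one_mul]
  have hzW : z ∈ ST32 := evalWord_mem_ST32 (centralWord_lt 4)
  let F : Fin 3 × G25920 → ST32 := fun p =>
    ⟨z ^ (p.1 : ℕ) * p.2, mul_mem (pow_mem hzW _) (G25920_le_ST32 p.2.2)⟩
  -- The cubic scalars times `G25920` fill the reflection group without repetition: the determinant
  -- of ωʲg is ω⁴ʲ = ωʲ, which determines j.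
  have hF : Function.Bijective F := by
    constructor
    · rintro ⟨i, g⟩ ⟨j, h⟩ hij
      have hij : z ^ (i : ℕ) * g = z ^ (j : ℕ) * h := congrArg Subtype.val hij
      have h1 := congrArg (fun g : GL (Fin 4) ℂ => g.1.det) hij
      simp only [hzj, Matrix.det_smul, det_eq_one_of_mem g.2, det_eq_one_of_mem h.2,
        Fintype.card_fin, mul_one, ← pow_mul] at h1
      have h2 : ω ^ (i : ℕ) = ω ^ (j : ℕ) := by
        have h4 : ∀ n : ℕ, ω ^ (n * 4) = ω ^ n := fun n => by
          rw [mul_comm, pow_mul, pow_succ, ω_pow_three, one_mul]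
        rwa [h4, h4] at h1
      obtain rfl : i = j := Fin.ext (isPrimitiveRoot_ω.pow_inj i.2 j.2 h2)
      rw [mul_left_cancel_iff, SetLike.coe_eq_coe] at hij
      rw [hij]
    · rintro ⟨w, hw⟩
      obtain ⟨g, hg, c, hc, h⟩ := exists_mem_G25920_smul hw
      obtain ⟨j, hj, rfl⟩ := isPrimitiveRoot_ω.eq_pow_of_pow_eq_one hc
      exact ⟨(⟨j, hj⟩, ⟨g, hg⟩), Subtype.ext (Units.ext ((hzj _ _).trans h.symm))⟩
  have h := Nat.card_eq_of_bijective F hF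
  rw [Nat.card_prod, Nat.card_fin, card_ST32] at h
  omega

/-! ### The centre -/

lemma commute_of_mem_center {c w : GL (Fin 4) ℂ} (hc : ∀ g ∈ G25920, g * c = c * g)
    (hw : w ∈ ST32) : w.1 * c.1 = c.1 * w.1 := by
  obtain ⟨g, hg, a, -, h⟩ := exists_mem_G25920_smul hw
  have h1 : g.1 * c.1 = c.1 * g.1 := congrArg Units.val (hc g hg)
  rw [h, smul_mul_assoc, mul_smul_comm, h1]

/-- Commuting with diag(1, 1, 1, ω) makes the last basis vector an eigenvector. Transitivity on the
roots carries the same eigenvalue to the other basis vectors. -/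
lemma eq_smul_one_of_commute {c : Matrix (Fin 4) (Fin 4) ℂ}
    (hc : ∀ w ∈ ST32, w.1 * c = c * w.1) : ∃ a : ℂ, c = a • 1 := by
  have h3 : c *ᵥ rootVec (0, 3) = (c 3 3) • rootVec (0, 3) := by
    have hr := hc _ (evalWord_mem_ST32 (reflWord_lt 3))
    rw [coe_evalWord_reflWord] at hr
    have hz : ∀ i, i ≠ 3 → c i 3 = 0 := fun i hi => by
      have h := congrFun (congrFun hr i) 3
      rw [Matrix.diagonal_mul, Matrix.mul_diagonal, Function.update_of_ne hi,
        Function.update_self, Pi.one_apply] at h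
      have h' : (1 - ω) * c i 3 = 0 := by linear_combination h
      exact (mul_eq_zero.1 h').resolve_left (sub_ne_zero.2 ω_ne_one.symm)
    have hroot : rootVec (0, 3) = _ := rootVec_coord 3
    rw [hroot]
    ext i
    by_cases hi : i = 3
    · subst hi
      simp
    · simp [hz i hi, hi]
  refine ⟨c 3 3, matrix_ext_rootVec fun i => ?_⟩
  obtain ⟨w, hw, hwx⟩ := exists_mem_ST32_mulVec_rootVec (0, 3) (0, Fin.castLE (by norm_num) i)
  rw [← hwx, Matrix.mulVec_mulVec, ← hc w hw, ← Matrix.mulVec_mulVec, h3, Matrix.mulVec_smul,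
    Matrix.smul_mulVec, Matrix.one_mulVec]

/-- A scalar in the group moves a root to a root on the same line, so a⁶ = 1; determinant one gives
a⁴ = 1; hence a² = 1. -/
lemma eq_one_or_neg_one_of_smul_one_mem {c : GL (Fin 4) ℂ} (hc : c ∈ G25920) {a : ℂ}
    (h : c.1 = a • 1) : a = 1 ∨ a = -1 := by
  obtain ⟨y, hy⟩ := exists_mulVec_rootVec (G25920_le_ST32 hc) (0, 3)
  rw [h, Matrix.smul_mulVec, Matrix.one_mulVec] at hy
  obtain ⟨m, i⟩ := y
  obtain rfl : i = 3 := snd_eq_three hy.symm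
  have h3 := congrFun hy 3
  rw [Pi.smul_apply, rootVec_three_apply, rootVec_three_apply, ZMod.val_zero, pow_zero, one_mul,
    smul_eq_mul] at h3
  have ha : a ^ 6 = 1 := by
    rw [mul_right_cancel₀ theta_ne_zero h3, ← pow_mul, mul_comm, pow_mul, neg_ω_pow_six, one_pow]
  have hdet := det_eq_one_of_mem hc
  rw [h, Matrix.det_smul, Matrix.det_one, mul_one, Fintype.card_fin] at hdet
  exact sq_eq_one_iff.1 (by linear_combination ha - a ^ 2 * hdet)

theorem card_center_G25920 : Nat.card (Subgroup.center G25920) = 2 := by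
  have hneg : (-1 : GL (Fin 4) ℂ) ∈ G25920 := by
    have h : evalWord (centralWord 3) = -1 := Units.ext (by
      rw [coe_evalWord_centralWord]
      have h3 : (-ω) ^ (3 : ZMod 6).val = -1 := by
        change (-ω) ^ 3 = -1
        linear_combination -ω_pow_three
      rw [h3]
      simp)
    rw [G25920_eq_inf]
    refine ⟨h ▸ evalWord_mem_ST32 (centralWord_lt 3), (mem_SLn_iff _).2 ?_⟩
    rw [Units.val_neg, Units.val_one, Matrix.det_neg, Matrix.det_one]
    norm_num
  have hneg' : (⟨-1, hneg⟩ : G25920) ∈ Subgroup.center G25920 := by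
    rw [Subgroup.mem_center_iff]
    intro g
    exact Subtype.ext (by simp)
  rw [Nat.card_eq_two_iff]
  refine ⟨1, ⟨⟨-1, hneg⟩, hneg'⟩, fun h => ?_, Set.eq_univ_of_forall fun z => ?_⟩
  · have h1 := congrArg (fun z : Subgroup.center G25920 => z.1.1.1 0 0) h
    simp at h1
    norm_num at h1
  · obtain ⟨⟨c, hcG⟩, hc⟩ := z
    rw [Subgroup.mem_center_iff] at hc
    obtain ⟨a, ha⟩ := eq_smul_one_of_commute fun w hw => commute_of_mem_center
      (fun g hg => congrArg Subtype.val (hc ⟨g, hg⟩)) hw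
    rcases eq_one_or_neg_one_of_smul_one_mem hcG ha with rfl | rfl
    · refine Or.inl (Subtype.ext (Subtype.ext (Units.ext ?_)))
      simpa using ha
    · refine Or.inr (Subtype.ext (Subtype.ext (Units.ext ?_)))
      simpa using ha

/-! ### Irreducibility and primitivity -/

/-- If u in U has a nonzero i-th coordinate and s is the reflection along that axis, then s u - u is
a nonzero multiple of a root. Transitivity on the roots puts all basis vectors in U. -/
lemma eq_bot_or_eq_top_of_stable (U : Submodule ℂ (Fin 4 → ℂ))
    (hU : ∀ k < 4, ∀ u ∈ U, genMat k *ᵥ u ∈ U) : U = ⊥ ∨ U = ⊤ := by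
  have hST : ∀ w ∈ ST32, ∀ u ∈ U, w.1 *ᵥ u ∈ U := by
    intro w hw u hu
    rw [ST32_eq] at hw
    obtain ⟨l, hl, rfl⟩ := exists_evalWord_eq hw
    clear hw
    induction l with
    | nil => simpa [evalWord] using hu
    | cons k l ih =>
      have h : evalWord (k :: l) = gen k * evalWord l := by simp [evalWord]
      rw [h, Units.val_mul, ← Matrix.mulVec_mulVec]
      exact hU k (hl k (by simp)) _ (ih fun j hj => hl j (by simp [hj]))
  refine or_iff_not_imp_left.2 fun hbot => ?_
  obtain ⟨u, hu, hu0⟩ := U.ne_bot_iff.1 hbot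
  obtain ⟨i, hi⟩ := Function.ne_iff.1 hu0
  have hroot : rootVec (0, Fin.castLE (by norm_num) i) ∈ U := by
    have h1 := U.sub_mem (hST _ (evalWord_mem_ST32 (reflWord_lt i)) u hu) hu
    have h2 : (evalWord (reflWord i)).1 *ᵥ u - u =
        ((ω - 1) * u i / (1 + 2 * ω)) • rootVec (0, Fin.castLE (by norm_num) i) := by
      have := theta_ne_zero
      rw [coe_evalWord_reflWord, rootVec_coord, ← Pi.single_smul]
      ext j
      rw [Pi.sub_apply, Matrix.mulVec_diagonal]
      by_cases hj : j = i
      · subst hj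
        simp only [Function.update_self, Pi.single_eq_same, smul_eq_mul]
        rw [div_mul_cancel₀ _ this]
        ring
      · simp [hj]
    rw [h2] at h1
    refine (U.smul_mem_iff (div_ne_zero (mul_ne_zero (sub_ne_zero.2 ω_ne_one) hi)
      theta_ne_zero)).1 h1
  have hsingle : ∀ j, Pi.single j (1 : ℂ) ∈ U := by
    intro j
    obtain ⟨w, hw, hwx⟩ := exists_mem_ST32_mulVec_rootVec (0, Fin.castLE (by norm_num) i)
      (0, Fin.castLE (by norm_num) j)
    have h1 := hST w hw _ hroot
    rw [hwx, rootVec_coord, ← mul_one (1 + 2 * ω), ← smul_eq_mul, Pi.single_smul] at h1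
    exact (U.smul_mem_iff theta_ne_zero).1 h1
  rw [eq_top_iff]
  intro v _
  rw [pi_eq_sum_univ' v]
  refine U.sum_mem fun j _ => U.smul_mem _ ?_
  convert hsingle j using 1

lemma isIrreducibleGroup_G25920 : IsIrreducibleGroup G25920 := by
  refine ⟨by norm_num, fun U hU => eq_bot_or_eq_top_of_stable U fun k hk u hu => ?_⟩
  obtain ⟨g, hg, c, -, h⟩ := exists_mem_G25920_smul (gen_mem_ST32 hk)
  rw [coe_gen] at h
  rw [h, Matrix.smul_mulVec]
  exact U.smul_mem _ (hU g hg ⟨u, hu, rfl⟩)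

lemma not_preservesDecomposition {m k : ℕ} (hk : 2 ≤ k) : ¬ PreservesDecomposition G25920 m k := by
  rintro ⟨V, hV, hm, hperm⟩
  have hind := hV.submodule_iSupIndep
  have hgen : ∀ s < 4, ∀ i, ∃ j, ∀ v ∈ V i, genMat s *ᵥ v ∈ V j := by
    intro s hs i
    obtain ⟨g, hg, c, -, h⟩ := exists_mem_G25920_smul (gen_mem_ST32 hs)
    obtain ⟨j, hj⟩ := hperm g hg i
    refine ⟨j, fun v hv => ?_⟩
    rw [coe_gen] at h
    rw [h, Matrix.smul_mulVec]
    exact (V j).smul_mem _ (hj ▸ ⟨v, hv, rfl⟩)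
  have hne : ∀ {i j : Fin k}, i ≠ j → ∀ {v}, v ∈ V j → v ∈ ⨆ l ≠ i, V l := fun {i j} hij v hv =>
    (le_iSup₂_of_le (f := fun l (_ : l ≠ i) => V l) j hij.symm le_rfl) hv
  have hzero : ∀ {i : Fin k} {v}, v ∈ V i → v ∈ ⨆ l ≠ i, V l → v = 0 := fun {i v} h1 h2 =>
    (Submodule.disjoint_def.1 (hind i)) v h1 h2
  -- Suppose s moves `V i` into `V j` with j ≠ i, and `V j` into `V l`, and use s²v = (1 + ω)sv -
  -- ωv. If l = i, then sv lies in `V i` and in `V j`, so it is zero; if l ≠ i, then v lies in the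
  -- sum of the other summands, so it is zero.
  have hstable : ∀ i, ∀ s < 4, ∀ v ∈ V i, genMat s *ᵥ v ∈ V i := by
    intro i s hs v hv
    obtain ⟨j, hj⟩ := hgen s hs i
    by_cases hij : i = j
    · exact hij ▸ hj v hv
    obtain ⟨l, hl⟩ := hgen s hs j
    have h1 := hj v hv
    have h2 := hl _ h1
    have hsq : genMat s *ᵥ (genMat s *ᵥ v) = (1 + ω) • (genMat s *ᵥ v) - ω • v := by
      rw [Matrix.mulVec_mulVec, gen_sq hs, Matrix.sub_mulVec, Matrix.smul_mulVec,
        Matrix.smul_mulVec, Matrix.one_mulVec]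
    suffices hv0 : v = 0 by
      rw [hv0, Matrix.mulVec_zero]
      exact (V i).zero_mem
    by_cases hil : i = l
    · subst hil
      have h3 : (1 + ω) • (genMat s *ᵥ v) ∈ V i := by
        rw [eq_add_of_sub_eq hsq.symm]
        exact (V i).add_mem h2 ((V i).smul_mem _ hv)
      have h4 := hzero h3 (hne hij ((V j).smul_mem _ h1))
      have hω : 1 + ω ≠ 0 := fun h => pow_ne_zero 2 ω_ne_zero (by linear_combination ω_sq_add - h)
      have h5 := (smul_eq_zero.1 h4).resolve_left hω
      exact mulVec_injective (gen s) (by simpa using h5)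
    · have h3 : ω • v ∈ ⨆ l ≠ i, V l := by
        rw [show ω • v = (1 + ω) • (genMat s *ᵥ v) - genMat s *ᵥ (genMat s *ᵥ v) by
          rw [hsq, sub_sub_cancel]]
        exact Submodule.sub_mem _ (hne hij ((V j).smul_mem _ h1)) (hne hil h2)
      exact (smul_eq_zero.1 (hzero ((V i).smul_mem _ hv) h3)).resolve_left ω_ne_zero
  have hor := fun i => eq_bot_or_eq_top_of_stable (V i) (hstable i)
  let i0 : Fin k := ⟨0, by omega⟩
  let i1 : Fin k := ⟨1, by omega⟩
  -- Every summand is now trivial or the whole space. Two different summands cannot both be the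
  -- whole space, so the common dimension is 0, and then the summands do not span.
  have hm0 : m = 0 := by
    rcases hor i0 with h | h
    · rw [← hm i0, h, finrank_bot]
    · have hdisj := hind.pairwiseDisjoint (show i0 ≠ i1 by simp [i0, i1])
      rw [Function.onFun, h, top_disjoint] at hdisj
      rw [← hm i1, hdisj, finrank_bot]
  have hbot : ∀ i, V i = ⊥ := fun i => Submodule.finrank_eq_zero.1 ((hm i).trans hm0)
  have htop := hV.submodule_iSup_eq_top
  exact bot_ne_top ((iSup_eq_bot.2 hbot).symm.trans htop)

theorem isPrimitiveGroup_G25920 : IsPrimitiveGroup G25920 :=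
  ⟨inferInstance, isIrreducibleGroup_G25920, fun _ _ hk => not_preservesDecomposition hk⟩

end QuotG25920

end

noncomputable section

open CategoryTheory AlgebraicGeometry MvPolynomial
open scoped Matrix

namespace QuotG25920

/-! ### The quotient of projective space -/

/-- The degrees 12, 18, 24, 30 are 6 times the weights 2, 3, 4, 5. Taking out the factor 6 makes the
multiplier k = 6 a multiple of the order of the cubic scalars that separate the two groups. -/
lemma aeval_basicInvariant_mem (m : ℕ) (p : MvPolynomial (Fin 4) ℂ)
    (hp : p ∈ weightedHomogeneousSubmodule ℂ ![2, 3, 4, 5] m) :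
    aeval (R := ℂ) basicInvariant p ∈ homogeneousSubmodule (Fin 4) ℂ (6 * m) := by
  rw [mem_weightedHomogeneousSubmodule] at hp
  rw [aeval_def, eval₂_eq']
  refine Submodule.sum_mem _ fun a ha => ?_
  have hdeg : ∑ i, degrees i * a i = 6 * m := by
    rw [← hp (mem_support_iff.1 ha), Finsupp.weight_apply, Finsupp.sum_fintype _ _ (by simp)]
    simp only [Fin.sum_univ_four, degrees, smul_eq_mul, Matrix.cons_val]
    ring
  rw [mem_homogeneousSubmodule, ← hdeg, ← zero_add (∑ i, degrees i * a i)]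
  exact (isHomogeneous_C _ _).mul (IsHomogeneous.prod _ _ _ fun i _ =>
    (powerSum_isHomogeneous (degrees i)).pow (a i))

/-- The inclusion of the ring of invariants. -/
abbrev invariantHom : MvPolynomial (Fin 4) ℂ →+* MvPolynomial (Fin 4) ℂ :=
  (aeval (R := ℂ) basicInvariant).toRingHom

lemma mem_range_invariantHom_iff (p : MvPolynomial (Fin 4) ℂ) :
    p ∈ invariantHom.range ↔ ∀ w ∈ ST32, subst w p = p :=
  mem_range_aeval_basicInvariant_iff p

/-- The quotient morphism from `ℙ³`. -/
def toWeightedProj : ProjSpace 4 ⟶ WeightedProj ![2, 3, 4, 5] :=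
  quotientMap (𝒜 := weightedHomogeneousSubmodule ℂ ![2, 3, 4, 5]) invariantHom
    (show 0 < 6 by norm_num) aeval_basicInvariant_mem ST32 mem_range_invariantHom_iff

lemma toWeightedProj_str :
    toWeightedProj ≫ WeightedProj.str ![2, 3, 4, 5] = ProjSpace.str 4 :=
  Proj.mapMul_comp_toSpecZero _ _ _ _ _ _ fun r => (aeval (R := ℂ) basicInvariant).commutes r

theorem isGeometricQuotient_toWeightedProj :
    IsGeometricQuotient (fun g : G25920 => projAct g.1) toWeightedProj := by
  refine isGeometricQuotient_quotientMap _ _ _ algebraicIndependent_basicInvariant _ _ _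
    G25920_le_ST32 fun w hw => ?_
  obtain ⟨g, hg, c, hc, h⟩ := exists_mem_G25920_smul hw
  exact ⟨g, hg, c, by rw [show 6 = 3 * 2 from rfl, pow_mul, hc, one_pow], h⟩

end QuotG25920

end

theorem mainTheorem11 :
    -- the Shephard–Todd group No. 32
    QuotG25920.ST32 = Subgroup.closure
        {g | g ∈ QuotG25920.ST32 ∧ QuotG25920.IsReflection g ∧ orderOf g = 3} ∧
    Nat.card QuotG25920.ST32 = 25920 * 6 ∧
    QuotG25920.HasDegrees QuotG25920.ST32 ![12, 18, 24, 30] ∧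
    -- the primitive group `G₂₅₉₂₀`
    QuotG25920.IsPrimitiveGroup QuotG25920.G25920 ∧
    Nat.card QuotG25920.G25920 = 25920 * 2 ∧
    Nat.card (Subgroup.center QuotG25920.G25920) = 2 ∧
    QuotG25920.G25920 = QuotG25920.ST32 ⊓ QuotG25920.SLn 4 ∧
    -- the quotient `Y = ℙ³ / G₂₅₉₂₀`
    ∃ (Y : AlgebraicGeometry.Scheme.{0}) (sY : Y ⟶ QuotG25920.SpecC)
      (π : QuotG25920.ProjSpace 4 ⟶ Y),
      π ≫ sY = QuotG25920.ProjSpace.str 4 ∧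
      QuotG25920.IsGeometricQuotient (fun g : QuotG25920.G25920 => QuotG25920.projAct g.1) π ∧
      (∃ e : Y ≅ QuotG25920.WeightedProj ![12, 18, 24, 30],
        e.hom ≫ QuotG25920.WeightedProj.str ![12, 18, 24, 30] = sY) ∧
      (∃ e : Y ≅ QuotG25920.WeightedProj ![2, 3, 4, 5],
        e.hom ≫ QuotG25920.WeightedProj.str ![2, 3, 4, 5] = sY) ∧
      AlgebraicGeometry.Scheme.BirationalOver sY
        (AlgebraicGeometry.AffineSpace (Fin 3) QuotG25920.SpecC ↘ QuotG25920.SpecC) := by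
  refine ⟨QuotG25920.ST32_eq_closure_reflections, QuotG25920.card_ST32,
    QuotG25920.hasDegrees_ST32, QuotG25920.isPrimitiveGroup_G25920, QuotG25920.card_G25920,
    QuotG25920.card_center_G25920, QuotG25920.G25920_eq_inf,
    QuotG25920.WeightedProj ![2, 3, 4, 5], QuotG25920.WeightedProj.str ![2, 3, 4, 5],
    QuotG25920.toWeightedProj, QuotG25920.toWeightedProj_str,
    QuotG25920.isGeometricQuotient_toWeightedProj, ?_,
    ⟨CategoryTheory.Iso.refl _, CategoryTheory.Category.id_comp _⟩,
    QuotG25920.birationalOver_weightedProj⟩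
  exact QuotG25920.exists_weightedProj_iso (k := 6) (by norm_num) (by decide) (by decide)
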